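/- **Setting.** For each sample size $T$ let $X_t=X_{T,t}\in\mathbb R^{p_T+1}$ (regressors, an intercept being allowed) and $\varepsilon_t=\varepsilon_{T,t}\in\mathbb R$, $t\in\mathbb Z$, be random variables, and let $$y_{t+1}=X_t^\top\beta(t/T)+\varepsilon_{t+1},\qquad 1\le t\le T,\qquad \beta=\beta_T:[0,1]\to\mathbb R^{p_T+1},$$ where all coordinates of $\beta$ after the first $d=d_T$ vanish identically and, for all large $T$, $1\le d\le p_T$. Write $\beta_t=\beta(t/T)$, $R_t=(\varepsilon_{t+1},X_t^\top)^\top$, $k_{st}=h^{-1}k\big(\tfrac{s-t}{Th}\big)$. *Estimator.* For a date $t$, with $s$ running over the window $t-\lfloor Th\rfloor\le s\le t+\lfloor Th\rfloor$, $s\ne t$, let $\tilde\gamma_t=(\tilde\alpha_{0t},\tilde\alpha_{1t})$ be any (almost sure) minimizer over $(\alpha_0,\alpha_1)$ of $$T^{-1}\sum_{s}k_{st}\Big[y_{s+1}-\alpha_0^\top X_s-\alpha_1^\top\tfrac{s-t}{T}X_s\Big]^2+\lambda_1\sum_j|\alpha_{0j}|+\lambda_2\sum_j|h\alpha_{1j}|,\qquad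 \tilde\beta_t:=\tilde\alpha_{0t}.$$ The observations in the window are taken in one of two ways. *Reflected data:* for $s>t$, $(y_{s+1},X_s)$ is replaced by the pseudo-observation $(y_{2t-s+1},X_{2t-s})$; the estimation dates are $\lfloor Th\rfloor<t\le T$. *Two-sided data:* the actual observations with $1\le s\le T$ are used; the estimation dates are $1\le t\le T$. Below, $\max_t$ is over the estimation dates. **Assumptions.** * A.1: $\{R_t\}$ is $\beta$-mixing with coefficients $\beta^*(l)$ (supremum over the array) satisfying $\sum_l l^4\beta^*(l)^{\delta'/(1+\delta')}<\infty$ for some $\delta'>0$. * A.2(i): for some $\delta''>0$ and every $T$, $\sup_{1\le t\le T}E\|R_t\|^{4+\delta''}<\infty$. * A.2(ii): the coordinates of $\beta$ are $C^2$ on $[0,1]$, with first and second derivatives bounded uniformly in the coordinate and in $T$. * A.3: $E(\varepsilon_{t+1}\mid X_t,X_{t-1},\dots,\varepsilon_t,\varepsilon_{t-1},\dots)=0$. * A.4: $k:[-1,1]\to[0,\infty)$ is a symmetric bounded probability density with $k(u)\le k(0)$ and $\int k^2<\infty$. * HD.1(i): with $X^o_t$ the first $d$ coordinates of $X_t$,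 for every $T$ there are Lipschitz functions $M^o,V^o,\sigma^2$ on $[0,1]$, $M^o$ positive definite valued, with $M^o(t/T)=E(X^o_tX_t^{o\top})$, $V^o(t/T)=E(X^o_tX_t^{o\top}\varepsilon_{t+1}^2)$, $\sigma^2(t/T)=E(\varepsilon_t^2)$. * HD.1(ii): $E|\varepsilon_{t+1}X_{tj}|^\psi\le C$ for all $T$, $1\le t\le T$ and $j$, for a sufficiently large $\psi$; that is, $\psi>\Psi$, where $\Psi\ge2+\frac{\delta_1}{1-\delta_2}$ is a threshold depending only on $\delta_1,\delta_2$. * HD.2: for some $\delta>0$ let $S$ be the set of $v=(v_1,v_2)\in\mathbb R^{2(p_T+1)}$ with $\|v\|=1$ and $\sum_{m=1}^{p_T+1}(|v_{1m}|+|v_{2m}|)\le2(1+\delta)\sum_{m=1}^{d}(|v_{1m}|+|v_{2m}|)$. There are constants $0<\rho_1\le\rho_2<\infty$ such that, with probability approaching one, for all estimation dates $t$ and all $v\in S$, $$\rho_1\le T^{-1}\sum_s k_{st}\Big[\big(v_1+\tfrac{s-t}{Th}v_2\big)^\top X_s\Big]^2\le\rho_2,$$ with the same window and data as in the estimator. *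 HD.3(i): $p_T\le c_1T^{\delta_1}$ for all large $T$ and $h=c_2T^{-\delta_2}$, where $c_1,c_2>0$, $0\le\delta_1<\infty$, $0<\delta_2<1$; $\lambda_1>0$ and $\lambda_2=r\lambda_1$ with a constant $r>0$; and $$dh^2\lambda_1^{-1}+dh^{-2}\lambda_1^2+d\lambda_1^{1/2}+\Big(\frac{\log h^{-1}}{Th}\Big)^{1/2}\lambda_1^{-1}\to0.$$ * For two-sided data only: $\lambda_1<(1+2\delta)\lambda_2$, with $\delta$ from HD.2 (automatic if $\lambda_1\le\lambda_2$). **Proposition.** For all $\delta_1\ge 0$ and $\delta_2\in(0,1)$ there is a threshold $\Psi$ as in HD.1(ii) such that under these assumptions, for reflected as well as for two-sided data, $$\max_t\|\tilde\beta_t-\beta_t\|\to0\quad\text{in probability as }T\to\infty.$$ For two-sided data, if moreover $\lambda_2<(1+2\delta)\lambda_1$ (so in particular if $\lambda_1=\lambda_2$), then $$\max_t\|\tilde\beta_t-\beta_t\|=O_p(\sqrt d\,\lambda_1)\quad\text{and}\quad\max_t h\,\|\tilde\alpha_{1t}-\beta'(t/T)\|=O_p(\sqrt d\,\lambda_1).$$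 -/

import Mathlib

open Filter Topology MeasureTheory

universe u

namespace TVComb

/-- The `β`-mixing (absolute regularity) coefficient of two random elements: the total variation
distance between their joint law and the product of their marginal laws. -/
noncomputable def betaCoef {Ω E F : Type*} [MeasurableSpace Ω] [MeasurableSpace E]
    [MeasurableSpace F] (μ : Measure Ω) (U : Ω → E) (V : Ω → F) : ℝ :=
  ⨆ C : {C : Set (E × F) // MeasurableSet C},
    |(μ.map (fun ω => (U ω, V ω))).real C.1 - ((μ.map U).prod (μ.map V)).real C.1|

/-- `Z_T = O_p(r_T)` as `T → ∞`. -/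
def IsBigOp {Ω : Type*} [MeasurableSpace Ω] (μ : Measure Ω) (Z : ℕ → Ω → ℝ) (r : ℕ → ℝ) : Prop :=
  ∀ η : ℝ, 0 < η → ∃ C : ℝ, 0 < C ∧
    ∀ᶠ T in atTop, μ {ω | C * r T < |Z T ω|} ≤ ENNReal.ofReal η

/-- How the observations in the estimation window around date `t` are obtained:
`twoSided` uses the actual observations on both sides of `t`; `reflected` uses the actual
observations before `t`, and after `t` their mirror images `(y_{2t-s+1}, X_{2t-s})`. -/
inductive Scheme
  | twoSided
  | reflected

/-- The date of the actual observation which is used at position `s` of the window around `t`. -/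
def Scheme.src : Scheme → ℤ → ℤ → ℤ
  | .twoSided, _, s => s
  | .reflected, t, s => if s ≤ t then s else 2 * t - s

/-- The data of the model, a triangular array indexed by the sample size `T`. -/
structure Setting (Ω : Type u) where
  /-- there are `p T + 1` candidate regressors (intercept included) -/
  p : ℕ → ℕ
  /-- the number of relevant regressors, which come first -/
  d : ℕ → ℕ
  /-- `X T t` is the vector `X_t` of regressors -/
  X : (T : ℕ) → ℤ → Ω → EuclideanSpace ℝ (Fin (p T + 1))
  /-- `ε T t` is the forecast error `ε_t` -/
  ε : ℕ → ℤ → Ω → ℝ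
  /-- the combination weights as functions of rescaled time -/
  β : (T : ℕ) → ℝ → EuclideanSpace ℝ (Fin (p T + 1))
  /-- the kernel -/
  k : ℝ → ℝ
  /-- the bandwidth -/
  h : ℕ → ℝ
  /-- the penalty parameter of the levels -/
  lam₁ : ℕ → ℝ
  /-- the penalty parameter of the slopes -/
  lam₂ : ℕ → ℝ

namespace Setting

variable {Ω : Type u} (S : Setting Ω)

/-- The space of coefficient vectors for sample size `T`. -/
abbrev Coef (T : ℕ) : Type := EuclideanSpace ℝ (Fin (S.p T + 1))

/-- The indices of the relevant regressors. -/
abbrev Rel (T : ℕ) : Type := {j : Fin (S.p T + 1) // (j : ℕ) < S.d T}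

/-- The dependent variable: `S.y T s` is `y_{s+1} = X_sᵀ β(s/T) + ε_{s+1}`. -/
noncomputable def y (T : ℕ) (s : ℤ) (ω : Ω) : ℝ :=
  ∑ j, S.X T s ω j * S.β T ((s : ℝ) / T) j + S.ε T (s + 1) ω

/-- The half window length `⌊T h⌋`. -/
noncomputable def halfWidth (T : ℕ) : ℤ := ⌊(T : ℝ) * S.h T⌋

/-- The positions `s` with `t - ⌊T h⌋ ≤ s ≤ t + ⌊T h⌋`, `s ≠ t`, for which the observation is
available, that is, comes from a date in `1, …, T`. -/
noncomputable def window (sch : Scheme) (T : ℕ) (t : ℤ) : Finset ℤ :=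
  (Finset.Icc (t - S.halfWidth T) (t + S.halfWidth T)).filter
    (fun s => s ≠ t ∧ 1 ≤ sch.src t s ∧ sch.src t s ≤ (T : ℤ))

/-- The dates at which the weights are estimated: all dates for two-sided data; the dates that
are preceded by `⌊T h⌋` observations for reflected data. -/
noncomputable def dates (T : ℕ) : Scheme → Finset ℤ
  | .twoSided => Finset.Icc 1 (T : ℤ)
  | .reflected => Finset.Icc (S.halfWidth T + 1) (T : ℤ)

/-- `k_{st} = h⁻¹ k((s - t)/(T h))`. -/
noncomputable def kst (T : ℕ) (s t : ℤ) : ℝ :=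
  (S.h T)⁻¹ * S.k (((s : ℝ) - t) / (T * S.h T))

/-- The local linear least squares criterion at date `t`, as a function of the level and slope
coefficients. -/
noncomputable def loss (sch : Scheme) (T : ℕ) (t : ℤ) (ω : Ω) (a : S.Coef T × S.Coef T) : ℝ :=
  (T : ℝ)⁻¹ * ∑ s ∈ S.window sch T t, S.kst T s t *
    (S.y T (sch.src t s) ω - ∑ j, a.1 j * S.X T (sch.src t s) ω j
      - ∑ j, a.2 j * (((s : ℝ) - t) / T) * S.X T (sch.src t s) ω j) ^ 2

/-- The Lasso-penalized local linear criterion at date `t`. -/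
noncomputable def objective (sch : Scheme) (T : ℕ) (t : ℤ) (ω : Ω) (a : S.Coef T × S.Coef T) : ℝ :=
  S.loss sch T t ω a + S.lam₁ T * ∑ j, |a.1 j| + S.lam₂ T * ∑ j, |S.h T * a.2 j|

/-- `γ` is a first-stage estimator: almost surely, `γ T t ω` minimizes the penalized criterion. -/
def IsEstimator [MeasurableSpace Ω] (μ : Measure Ω) (sch : Scheme)
    (γ : (T : ℕ) → ℤ → Ω → S.Coef T × S.Coef T) : Prop :=
  ∀ T, ∀ t ∈ S.dates T sch, ∀ᵐ ω ∂μ, ∀ b, S.objective sch T t ω (γ T t ω) ≤ S.objective sch T t ω b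

/-- The true slopes `β'(t/T)` (one-sided at the ends of `[0, 1]`). -/
noncomputable def slope (T : ℕ) (τ : ℝ) : S.Coef T :=
  WithLp.toLp 2 (fun j => derivWithin (fun x => S.β T x j) (Set.Icc 0 1) τ)

/-- `max_t ‖β̃_t - β_t‖`. -/
noncomputable def maxErr (sch : Scheme) (γ : (T : ℕ) → ℤ → Ω → S.Coef T × S.Coef T)
    (T : ℕ) (ω : Ω) : ℝ :=
  ((S.dates T sch).sup (fun t => ‖(γ T t ω).1 - S.β T ((t : ℝ) / T)‖₊) : NNReal)

/-- `max_t h ‖α̃_{1t} - β'(t/T)‖`, the error of the estimated slopes. -/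
noncomputable def maxSlopeErr (sch : Scheme) (γ : (T : ℕ) → ℤ → Ω → S.Coef T × S.Coef T)
    (T : ℕ) (ω : Ω) : ℝ :=
  S.h T * ((S.dates T sch).sup (fun t => ‖(γ T t ω).2 - S.slope T ((t : ℝ) / T)‖₊) : NNReal)

/-- `R_t = (ε_{t+1}, X_t)`. -/
def R (T : ℕ) (t : ℤ) (ω : Ω) : ℝ × S.Coef T := (S.ε T (t + 1) ω, S.X T t ω)

/-- The mixing coefficient `β*(l)` of the array `{R_t}`: the supremum over all `T` and `t` of the
coefficient of `(R_s)_{s ≤ t}` and `(R_s)_{s ≥ t + l}`. -/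
noncomputable def mixCoef [MeasurableSpace Ω] (μ : Measure Ω) (l : ℕ) : ℝ :=
  ⨆ q : ℕ × ℤ, betaCoef μ
    (fun ω (s : Set.Iic q.2) => S.R q.1 s ω) (fun ω (s : Set.Ici (q.2 + l)) => S.R q.1 s ω)

/-- The information set `I_t`, generated by `X_s` and `ε_s`, `s ≤ t`. -/
abbrev info (T : ℕ) (t : ℤ) : MeasurableSpace Ω :=
  ⨆ s : Set.Iic t, MeasurableSpace.comap (S.X T s) inferInstance ⊔
    MeasurableSpace.comap (S.ε T s) inferInstance

/-- All the `X_t` and `ε_t` are random variables. -/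
def IsMeasurable [MeasurableSpace Ω] : Prop :=
  ∀ T t, Measurable (S.X T t) ∧ Measurable (S.ε T t)

/-- Sparsity: only the first `d` weights may be nonzero. -/
def Sparse : Prop :=
  ∀ T, ∀ τ ∈ Set.Icc (0 : ℝ) 1, ∀ j : Fin (S.p T + 1), S.d T ≤ (j : ℕ) → S.β T τ j = 0

/-- Mixing condition. -/
def Mixing [MeasurableSpace Ω] (μ : Measure Ω) : Prop :=
  ∃ δ : ℝ, 0 < δ ∧ Summable (fun l : ℕ => (l : ℝ) ^ 4 * S.mixCoef μ l ^ (δ / (1 + δ)))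

/-- Moments of order `4 + δ` of `R_t`, `1 ≤ t ≤ T`. -/
def Moments [MeasurableSpace Ω] (μ : Measure Ω) : Prop :=
  ∃ δ : ℝ, 0 < δ ∧ ∀ (T : ℕ) (t : ℤ), 1 ≤ t → t ≤ T →
    Integrable (fun ω => √(S.ε T (t + 1) ω ^ 2 + ‖S.X T t ω‖ ^ 2) ^ (4 + δ)) μ

/-- The weights are twice continuously differentiable functions on `[0, 1]`, whose first and
second derivatives are bounded uniformly over the coordinates and over `T`. -/
def SmoothWeights : Prop :=
  (∀ T j, ContDiffOn ℝ 2 (fun τ => S.β T τ j) (Set.Icc 0 1)) ∧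
  ∃ B : ℝ, ∀ T j, ∀ τ ∈ Set.Icc (0 : ℝ) 1,
    |derivWithin (fun x => S.β T x j) (Set.Icc 0 1) τ| ≤ B ∧
    |iteratedDerivWithin 2 (fun x => S.β T x j) (Set.Icc 0 1) τ| ≤ B

/-- The forecast errors are martingale differences. -/
def MartingaleDiff [MeasurableSpace Ω] (μ : Measure Ω) : Prop :=
  ∀ (T : ℕ) (t : ℤ), 1 ≤ t → t ≤ T → μ[S.ε T (t + 1) | S.info T t] =ᵐ[μ] 0

/-- The kernel is a symmetric bounded probability density on `[-1, 1]`, maximal at `0`. -/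
def KernelCond : Prop :=
  (∀ u ∈ Set.Icc (-1 : ℝ) 1, 0 ≤ S.k u ∧ S.k (-u) = S.k u ∧ S.k u ≤ S.k 0) ∧
  IntegrableOn S.k (Set.Icc (-1) 1) ∧ ∫ u in Set.Icc (-1 : ℝ) 1, S.k u = 1 ∧
  IntegrableOn (fun u => S.k u ^ 2) (Set.Icc (-1) 1)

/-- Second moments of the relevant regressors and of the errors are Lipschitz functions of
rescaled time, and those of the regressors are positive definite. -/
def RelevantMoments [MeasurableSpace Ω] (μ : Measure Ω) : Prop :=
  ∀ T : ℕ, ∃ (M V : ℝ → Matrix (S.Rel T) (S.Rel T) ℝ) (σsq : ℝ → ℝ) (L : NNReal),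
    (∀ t : ℤ, 1 ≤ t → t ≤ T →
      (∀ i j, M ((t : ℝ) / T) i j = ∫ ω, S.X T t ω i.1 * S.X T t ω j.1 ∂μ) ∧
      (∀ i j, V ((t : ℝ) / T) i j =
        ∫ ω, S.X T t ω i.1 * S.X T t ω j.1 * S.ε T (t + 1) ω ^ 2 ∂μ) ∧
      σsq ((t : ℝ) / T) = ∫ ω, S.ε T t ω ^ 2 ∂μ) ∧
    (∀ i j, LipschitzOnWith L (fun τ => M τ i j) (Set.Icc 0 1) ∧
      LipschitzOnWith L (fun τ => V τ i j) (Set.Icc 0 1)) ∧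
    LipschitzOnWith L σsq (Set.Icc 0 1) ∧
    ∀ τ ∈ Set.Icc (0 : ℝ) 1, (M τ).PosDef

/-- The moments of order `ψ` of `ε_{t+1} X_{tj}` are bounded uniformly in `t`, `j` and `T`. -/
def ProductMoments [MeasurableSpace Ω] (μ : Measure Ω) (ψ : ℝ) : Prop :=
  ∃ C : ℝ, ∀ (T : ℕ) (t : ℤ), 1 ≤ t → t ≤ T → ∀ j : Fin (S.p T + 1),
    Integrable (fun ω => |S.ε T (t + 1) ω * S.X T t ω j| ^ ψ) μ ∧
    ∫ ω, |S.ε T (t + 1) ω * S.X T t ω j| ^ ψ ∂μ ≤ C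

/-- The cone section of the restricted eigenvalue condition: `v = (v₁, v₂)` of Euclidean norm one
with `∑_m (|v₁ₘ| + |v₂ₘ|) ≤ 2 (1 + δ) ∑_{m ≤ d} (|v₁ₘ| + |v₂ₘ|)`. -/
def cone (T : ℕ) (δ : ℝ) : Set (S.Coef T × S.Coef T) :=
  {v | ‖v.1‖ ^ 2 + ‖v.2‖ ^ 2 = 1 ∧
    ∑ m, (|v.1 m| + |v.2 m|) ≤
      2 * (1 + δ) * ∑ m : Fin (S.p T + 1), if (m : ℕ) < S.d T then |v.1 m| + |v.2 m| else 0}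

/-- `T⁻¹ vᵀ Qᵀ K Q v`, where the rows of `Q` are `(X_sᵀ, ((s - t)/(T h)) X_sᵀ)` and `K` is the
diagonal matrix of the `k_{st}`, with `s` running through the window around `t`. -/
noncomputable def gram (sch : Scheme) (T : ℕ) (t : ℤ) (ω : Ω) (v : S.Coef T × S.Coef T) : ℝ :=
  (T : ℝ)⁻¹ * ∑ s ∈ S.window sch T t, S.kst T s t *
    (∑ j, (v.1 j + v.2 j * (((s : ℝ) - t) / (T * S.h T))) * S.X T (sch.src t s) ω j) ^ 2

/-- Restricted eigenvalues: with probability approaching one, the quadratic form is bounded and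
bounded away from zero on the cone, uniformly over the estimation dates. -/
def RestrictedEigenvalues [MeasurableSpace Ω] (μ : Measure Ω) (sch : Scheme) (δ : ℝ) : Prop :=
  ∃ ρ₁ ρ₂ : ℝ, 0 < ρ₁ ∧ ρ₁ ≤ ρ₂ ∧
    Tendsto (fun T => μ {ω | ¬ ∀ t ∈ S.dates T sch, ∀ v ∈ S.cone T δ,
      ρ₁ ≤ S.gram sch T t ω v ∧ S.gram sch T t ω v ≤ ρ₂}) atTop (𝓝 0)

/-- Rates and tuning parameters; `r` is the constant ratio of the penalty parameters. -/
def Rates (δ₁ δ₂ r : ℝ) : Prop :=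
  (∀ᶠ T in atTop, 1 ≤ S.d T ∧ S.d T ≤ S.p T) ∧
  (∃ c₁ : ℝ, 0 < c₁ ∧ ∀ᶠ T : ℕ in atTop, (S.p T : ℝ) ≤ c₁ * (T : ℝ) ^ δ₁) ∧
  (∃ c₂ : ℝ, 0 < c₂ ∧ ∀ T : ℕ, S.h T = c₂ * (T : ℝ) ^ (-δ₂)) ∧
  0 < r ∧ (∀ T, 0 < S.lam₁ T ∧ S.lam₂ T = r * S.lam₁ T) ∧
  Tendsto (fun T : ℕ => S.d T * S.h T ^ 2 * (S.lam₁ T)⁻¹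
    + S.d T * (S.h T ^ 2)⁻¹ * S.lam₁ T ^ 2 + S.d T * √(S.lam₁ T)
    + √(Real.log (S.h T)⁻¹ / (T * S.h T)) * (S.lam₁ T)⁻¹) atTop (𝓝 0)

end Setting

end TVComb

/-! The argument is the deterministic analysis of the Lasso, carried out at all dates at once on an
event whose probability tends to one.

Deterministic part. Comparing the criterion at the estimator and at a sparse target `b` gives the
basic inequality: half the quadratic form `gram` of the error plus the increase of the penalty is at
most a noise term, which is linear in the `ℓ¹` norm of the error, plus twice the squared
approximation error `biasSq`. If the noise is below a small multiple of `λ₁`, there are two cases.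
If the bias is small compared with `λ₁` times the on-support error, the error lies in the cone of
the restricted eigenvalue condition, and its norm is `O(√d λ₁)`. Otherwise the bias dominates and
bounds the whole `ℓ¹` error by a multiple of `biasSq / λ₁`. This dichotomy is `lasso_error_bound`.

Two targets are used. For consistency, `b` consists of the true levels and zero slopes. The bias is
then of order `d h² + d² h⁴`, which is `o(λ₁)`. Since the target slopes vanish, the slope penalty
can only grow, so a one-sided restriction on `λ₁ / λ₂` suffices. With reflected data the estimated
slopes are exactly zero by symmetry, so no restriction is needed. For the rate, `b` consists of the
true levels and slopes, the bias is `O(d² h⁴) = o(λ₁)` times `λ₁²/λ₁`, that is `(d h² / λ₁)² λ₁²`,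
and both ratios of the penalties must be below `1 + 2δ`.

Stochastic part. The noise is a family of weighted sums of the scores `ε_{u+1} X_{uj}`, which are
martingale differences of a mixing array. Blocks of length `q` with the same parity are nearly
independent (`map_blocks_le_pi`). Truncation and an exponential moment bound on the product law
(`blocks_deviation`) and a union bound over dates and regressors give `noise_tendsto`. Orthogonality
of the scores keeps the variance of a block linear in its length. -/

namespace TVComb

open ProbabilityTheory

/-! ### Absolute regularity and comparison with the product law. -/

section Mixing

variable {Ω E F : Type*} [MeasurableSpace Ω] [MeasurableSpace E] [MeasurableSpace F]
  {μ : Measure Ω} [IsProbabilityMeasure μ] {U : Ω → E} {V : Ω → F}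

theorem abs_sub_real_le_one {G : Type*} [MeasurableSpace G] (P Q : Measure G)
    [IsProbabilityMeasure P] [IsProbabilityMeasure Q] (C : Set G) :
    |P.real C - Q.real C| ≤ 1 := by
  have h1 : P.real C ≤ 1 := measureReal_le_one
  have h2 : Q.real C ≤ 1 := measureReal_le_one
  have h3 : 0 ≤ P.real C := measureReal_nonneg
  have h4 : 0 ≤ Q.real C := measureReal_nonneg
  rw [abs_le]; constructor <;> linarith

theorem abs_sub_joint_le_one (hU : Measurable U) (hV : Measurable V) (C : Set (E × F)) :
    |(μ.map (fun ω => (U ω, V ω))).real C - ((μ.map U).prod (μ.map V)).real C| ≤ 1 := by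
  have := Measure.isProbabilityMeasure_map (μ := μ) hU.aemeasurable
  have := Measure.isProbabilityMeasure_map (μ := μ) hV.aemeasurable
  have := Measure.isProbabilityMeasure_map (μ := μ) (hU.prodMk hV).aemeasurable
  exact abs_sub_real_le_one _ _ C

/-- A real supremum dominates its terms only when the family is bounded above; the bound one
supplies this. -/
theorem abs_sub_le_betaCoef (hU : Measurable U) (hV : Measurable V) {C : Set (E × F)}
    (hC : MeasurableSet C) :
    |(μ.map (fun ω => (U ω, V ω))).real C - ((μ.map U).prod (μ.map V)).real C|
      ≤ betaCoef μ U V :=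
  le_ciSup (f := fun C : {C : Set (E × F) // MeasurableSet C} =>
    |(μ.map (fun ω => (U ω, V ω))).real C.1 - ((μ.map U).prod (μ.map V)).real C.1|)
    ⟨1, by rintro _ ⟨C, rfl⟩; exact abs_sub_joint_le_one hU hV C.1⟩ ⟨C, hC⟩

theorem betaCoef_nonneg {Ω E F : Type*} [MeasurableSpace Ω] [MeasurableSpace E]
    [MeasurableSpace F] {μ : Measure Ω} {U : Ω → E} {V : Ω → F} : 0 ≤ betaCoef μ U V :=
  Real.iSup_nonneg fun _ => abs_nonneg _

theorem betaCoef_le_one (hU : Measurable U) (hV : Measurable V) : betaCoef μ U V ≤ 1 :=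
  Real.iSup_le (fun C => abs_sub_joint_le_one hU hV C.1) zero_le_one

/-- Preimages of test sets are test sets, so coarsening the information cannot increase dependence.
This passes from the whole past and future to finite blocks. -/
theorem betaCoef_comp_le {E' F' : Type*} [MeasurableSpace E'] [MeasurableSpace F']
    (hU : Measurable U) (hV : Measurable V) {f : E → E'} {g : F → F'}
    (hf : Measurable f) (hg : Measurable g) :
    betaCoef μ (fun ω => f (U ω)) (fun ω => g (V ω)) ≤ betaCoef μ U V := by
  refine Real.iSup_le (fun C => ?_) betaCoef_nonneg
  have h := abs_sub_le_betaCoef (μ := μ) hU hV ((hf.prodMap hg) C.2)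
  have h1 : (μ.map (fun ω => (f (U ω), g (V ω)))).real C.1
      = (μ.map (fun ω => (U ω, V ω))).real (Prod.map f g ⁻¹' C.1) := by
    have hfg : Measurable fun ω => (f (U ω), g (V ω)) := (hf.comp hU).prodMk (hg.comp hV)
    rw [map_measureReal_apply hfg C.2,
      map_measureReal_apply (hU.prodMk hV) ((hf.prodMap hg) C.2)]
    rfl
  have h2 : ((μ.map (fun ω => f (U ω))).prod (μ.map (fun ω => g (V ω)))).real C.1
      = ((μ.map U).prod (μ.map V)).real (Prod.map f g ⁻¹' C.1) := by
    have := Measure.isProbabilityMeasure_map (μ := μ) hU.aemeasurable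
    have := Measure.isProbabilityMeasure_map (μ := μ) hV.aemeasurable
    rw [← map_measureReal_apply (hf.prodMap hg) C.2, ← Measure.map_prod_map _ _ hf hg,
      Measure.map_map hf hU, Measure.map_map hg hV]
    rfl
  rw [h1, h2]
  exact h

/-- Only this side of the total variation bound is needed. The extended nonnegative form can be
integrated over sections without integrability conditions. -/
theorem joint_le_prod_add (hU : Measurable U) (hV : Measurable V) {C : Set (E × F)}
    (hC : MeasurableSet C) {b : ℝ} (hb : betaCoef μ U V ≤ b) :
    μ.map (fun ω => (U ω, V ω)) C ≤ ((μ.map U).prod (μ.map V)) C + ENNReal.ofReal b := by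
  have := Measure.isProbabilityMeasure_map (μ := μ) hU.aemeasurable
  have := Measure.isProbabilityMeasure_map (μ := μ) hV.aemeasurable
  have := Measure.isProbabilityMeasure_map (μ := μ) (hU.prodMk hV).aemeasurable
  have h := (le_abs_self _).trans ((abs_sub_le_betaCoef (μ := μ) hU hV hC).trans hb)
  rw [← ofReal_measureReal (μ := μ.map (fun ω => (U ω, V ω))),
    ← ofReal_measureReal (μ := (μ.map U).prod (μ.map V)),
    ← ENNReal.ofReal_add measureReal_nonneg (betaCoef_nonneg.trans hb)]
  exact ENNReal.ofReal_le_ofReal (by linarith)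

/-- The law of `m` successive blocks is within `m` mixing coefficients of the product law. -/
theorem map_blocks_le_pi {b : ℝ} (m : ℕ) : ∀ (W : ℕ → Ω → E), (∀ i, Measurable (W i)) →
    (∀ i n : ℕ, betaCoef μ (W i) (fun ω (j : Fin n) => W (i + 1 + j) ω) ≤ b) →
    ∀ C : Set (Fin m → E), MeasurableSet C →
      μ.map (fun ω (j : Fin m) => W j ω) C
        ≤ Measure.pi (fun j : Fin m => μ.map (W j)) C + m * ENNReal.ofReal b := by
  induction m with
  | zero =>
    intro W hW _ C hC
    have h0 : Measurable (fun ω (j : Fin 0) => W j ω) := measurable_pi_lambda _ fun j => hW j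
    have := Measure.isProbabilityMeasure_map (μ := μ) h0.aemeasurable
    rcases Set.eq_empty_or_nonempty C with rfl | hne
    · simp
    · have : C = Set.univ := Set.eq_univ_of_forall fun x => by
        obtain ⟨y, hy⟩ := hne
        rwa [Subsingleton.elim x y]
      subst this
      simp
  | succ m ih =>
    intro W hW hb C hC
    have hP : ∀ i, IsProbabilityMeasure (μ.map (W i)) := fun i =>
      Measure.isProbabilityMeasure_map (hW i).aemeasurable
    let e := MeasurableEquiv.piFinSuccAbove (fun _ : Fin (m + 1) => E) 0
    have hT : Measurable (fun ω (j : Fin m) => W (j + 1) ω) :=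
      measurable_pi_lambda _ fun j => hW (j + 1)
    have hA : Measurable (fun ω (j : Fin (m + 1)) => W j ω) :=
      measurable_pi_lambda _ fun j => hW j
    have := Measure.isProbabilityMeasure_map (μ := μ) hT.aemeasurable
    have hC' : MeasurableSet (e.symm ⁻¹' C) := e.symm.measurable hC
    have h1 : μ.map (fun ω (j : Fin (m + 1)) => W j ω) C
        = μ.map (fun ω => (W 0 ω, fun j : Fin m => W (j + 1) ω)) (e.symm ⁻¹' C) := by
      rw [Measure.map_apply hA hC, Measure.map_apply ((hW 0).prodMk hT) hC']
      congr 1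
      ext ω
      simp only [Set.mem_preimage]
      have : e.symm (W 0 ω, fun j : Fin m => W (j + 1) ω) = fun j : Fin (m + 1) => W j ω := by
        rw [MeasurableEquiv.symm_apply_eq]
        rfl
      rw [this]
    have h2 : Measure.pi (fun j : Fin (m + 1) => μ.map (W j)) C
        = ((μ.map (W 0)).prod (Measure.pi fun j : Fin m => μ.map (W (j + 1)))) (e.symm ⁻¹' C) := by
      have h := (measurePreserving_piFinSuccAbove (fun j : Fin (m + 1) => μ.map (W j)) 0)
      have h3 := h.measure_preimage hC'.nullMeasurableSet
      have h4 : (e ⁻¹' (e.symm ⁻¹' C)) = C := by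
        rw [← Set.preimage_comp]; simp
      change Measure.pi (fun j : Fin (m + 1) => μ.map (W j)) (e ⁻¹' (e.symm ⁻¹' C)) = _ at h3
      rw [h4] at h3
      exact h3
    have h5 : betaCoef μ (W 0) (fun ω (j : Fin m) => W (j + 1) ω) ≤ b := by
      have := hb 0 m
      simpa [add_comm] using this
    have h6 := joint_le_prod_add (hW 0) hT hC' h5
    -- With the first block fixed, the section of the set is a set of later blocks, to which the
    -- induction hypothesis applies; integrating over the first block preserves the error.
    have h7 : ((μ.map (W 0)).prod (μ.map (fun ω (j : Fin m) => W (j + 1) ω))) (e.symm ⁻¹' C)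
        ≤ ((μ.map (W 0)).prod (Measure.pi fun j : Fin m => μ.map (W (j + 1)))) (e.symm ⁻¹' C)
          + m * ENNReal.ofReal b := by
      rw [Measure.prod_apply hC', Measure.prod_apply hC']
      calc _ ≤ ∫⁻ x, ((Measure.pi fun j : Fin m => μ.map (W (j + 1)))
                (Prod.mk x ⁻¹' (e.symm ⁻¹' C)) + m * ENNReal.ofReal b) ∂(μ.map (W 0)) := by
            refine lintegral_mono fun x => ?_
            refine ih (fun i => W (i + 1)) (fun i => hW _) (fun i n => ?_) _
              (measurable_prodMk_left hC')
            have := hb (i + 1) n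
            simpa only [show ∀ j, i + 1 + j + 1 = i + 1 + 1 + j from fun j => by omega] using this
        _ = _ := by
            rw [lintegral_add_right _ measurable_const]
            simp
    rw [h1, h2]
    refine h6.trans ((add_le_add_left h7 _).trans (le_of_eq ?_))
    push_cast
    ring

end Mixing

/-! ### Exponential inequalities for truncated independent sums. -/

section Chernoff

/-- Markov's inequality for the exponential, whose integral factorizes under a product measure.
Boundedness makes the exponential integrable. -/
theorem pi_sum_ge_le {E : Type*} [MeasurableSpace E] {m : ℕ} (ν : Fin m → Measure E)
    [∀ b, IsProbabilityMeasure (ν b)] (f : Fin m → E → ℝ) (hf : ∀ b, Measurable (f b))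
    {B : ℝ} (hB : ∀ b u, |f b u| ≤ B) {θ x : ℝ} (hθ : 0 ≤ θ) :
    (Measure.pi ν).real {u | x ≤ ∑ b, f b (u b)}
      ≤ Real.exp (-θ * x) * ∏ b, ∫ u, Real.exp (θ * f b u) ∂ν b := by
  have hm : Measurable fun u : Fin m → E => ∑ b, f b (u b) :=
    Finset.measurable_sum _ fun b _ => (hf b).comp (measurable_pi_apply b)
  have hint : Integrable (fun u : Fin m → E => Real.exp (θ * ∑ b, f b (u b))) (Measure.pi ν) := by
    refine Integrable.of_bound (C := Real.exp (θ * (m * B)))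
      (Real.measurable_exp.comp (hm.const_mul θ)).aestronglyMeasurable
      (Eventually.of_forall fun u => ?_)
    rw [Real.norm_eq_abs, Real.abs_exp]
    refine Real.exp_le_exp.2 (mul_le_mul_of_nonneg_left ?_ hθ)
    calc ∑ b, f b (u b) ≤ ∑ _b : Fin m, B :=
          Finset.sum_le_sum fun b _ => (le_abs_self _).trans (hB b _)
      _ = m * B := by simp
  have h := measure_ge_le_exp_mul_mgf x hθ hint
  refine h.trans (le_of_eq ?_)
  congr 1
  rw [mgf, ← integral_fintype_prod_eq_prod (𝕜 := ℝ)]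
  congr 1
  ext u
  simp only [Finset.mul_sum, Real.exp_sum]

/-- Truncation at level `B`. -/
noncomputable def trunc (B z : ℝ) : ℝ := if |z| ≤ B then z else 0

theorem measurable_trunc (B : ℝ) : Measurable (trunc B) :=
  Measurable.ite (measurableSet_le measurable_id.abs measurable_const) measurable_id
    measurable_const

theorem abs_trunc_le {B : ℝ} (hB : 0 ≤ B) (z : ℝ) : |trunc B z| ≤ B := by
  unfold trunc; split_ifs with h
  · exact h
  · simpa using hB

/-- The linear term contains the untruncated `z`, so centring survives truncation. Where `|z| > B`,
the left side is one and the last term, being at least `|z| / B ≥ |θ z|`, pays for a negative `θ z`.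
-/
theorem exp_mul_trunc_le {B θ z : ℝ} (hB : 0 < B) (hθ : |θ| * B ≤ 1) {N : ℕ} (hN : 1 ≤ N) :
    Real.exp (θ * trunc B z) ≤ 1 + θ * z + θ ^ 2 * z ^ 2 + |z| ^ N / B ^ N := by
  unfold trunc
  split_ifs with h
  · have h1 : |θ * z| ≤ 1 := by
      rw [abs_mul]; exact (mul_le_mul_of_nonneg_left h (abs_nonneg _)).trans hθ
    have h2 := (abs_le.1 (Real.abs_exp_sub_one_sub_id_le h1)).2
    have h3 : 0 ≤ |z| ^ N / B ^ N := by positivity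
    nlinarith
  · have h1 : 1 ≤ |z| / B := by rw [one_le_div hB]; linarith
    have h2 : |z| / B ≤ |z| ^ N / B ^ N := by
      rw [← div_pow]; exact le_self_pow₀ h1 (by omega)
    have h3 : |θ * z| ≤ |z| / B := by
      rw [abs_mul, le_div_iff₀ hB]; nlinarith [abs_nonneg z]
    have h4 := (abs_le.1 h3).1
    have h5 : 0 ≤ θ ^ 2 * z ^ 2 := by positivity
    simp only [mul_zero, Real.exp_zero]
    linarith

/-- Integrating the pointwise bound removes the linear term; `1 + x ≤ exp x` then gives a form that
multiplies over blocks. -/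
theorem integral_exp_trunc_le {Ω : Type*} [MeasurableSpace Ω] {μ : Measure Ω}
    [IsProbabilityMeasure μ] {Z : Ω → ℝ} (hZ : Measurable Z) (h1 : Integrable Z μ)
    (h0 : ∫ ω, Z ω ∂μ = 0) (h2 : Integrable (fun ω => Z ω ^ 2) μ) {N : ℕ} (hN : 1 ≤ N)
    (hZN : Integrable (fun ω => |Z ω| ^ N) μ) {B θ : ℝ} (hB : 0 < B) (hθ : |θ| * B ≤ 1) :
    ∫ ω, Real.exp (θ * trunc B (Z ω)) ∂μ
      ≤ Real.exp (θ ^ 2 * ∫ ω, Z ω ^ 2 ∂μ + (∫ ω, |Z ω| ^ N ∂μ) / B ^ N) := by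
  have hexp : Integrable (fun ω => Real.exp (θ * trunc B (Z ω))) μ := by
    refine Integrable.of_bound (C := Real.exp 1)
      (Real.measurable_exp.comp (((measurable_trunc B).comp hZ).const_mul θ)).aestronglyMeasurable
      (Eventually.of_forall fun ω => ?_)
    rw [Real.norm_eq_abs, Real.abs_exp]
    refine Real.exp_le_exp.2 ((le_abs_self _).trans ?_)
    rw [abs_mul]
    exact (mul_le_mul_of_nonneg_left (abs_trunc_le hB.le _) (abs_nonneg _)).trans hθ
  have i1 : Integrable (fun ω => 1 + θ * Z ω) μ := (integrable_const _).add (h1.const_mul θ)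
  have i2 : Integrable (fun ω => 1 + θ * Z ω + θ ^ 2 * Z ω ^ 2) μ := i1.add (h2.const_mul _)
  have i3 : Integrable (fun ω => |Z ω| ^ N / B ^ N) μ := hZN.div_const _
  calc _ ≤ ∫ ω, (1 + θ * Z ω + θ ^ 2 * Z ω ^ 2 + |Z ω| ^ N / B ^ N) ∂μ :=
        integral_mono hexp (i2.add i3) fun ω => exp_mul_trunc_le hB hθ hN
    _ = 1 + (θ ^ 2 * ∫ ω, Z ω ^ 2 ∂μ + (∫ ω, |Z ω| ^ N ∂μ) / B ^ N) := by
        rw [integral_add i2 i3, integral_add i1 (h2.const_mul _),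
          integral_add (integrable_const _) (h1.const_mul θ), integral_const_mul,
          integral_const_mul, integral_div, h0]
        simp
        ring
    _ ≤ _ := by
        have := Real.add_one_le_exp (θ ^ 2 * ∫ ω, Z ω ^ 2 ∂μ + (∫ ω, |Z ω| ^ N ∂μ) / B ^ N)
        linarith

/-- Deviations of sums over blocks of a mixing sequence, simultaneously for finitely many sums. -/
theorem blocks_deviation {Ω E ι : Type*} [MeasurableSpace Ω] [MeasurableSpace E] [Fintype ι]
    {μ : Measure Ω} [IsProbabilityMeasure μ] {W : ℕ → Ω → E} (hW : ∀ i, Measurable (W i))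
    {b : ℝ} (hb : ∀ i n : ℕ, betaCoef μ (W i) (fun ω (j : Fin n) => W (i + 1 + j) ω) ≤ b)
    {m : ℕ} {F : ι → ℕ → E → ℝ} (hF : ∀ i k, Measurable (F i k))
    (h1 : ∀ i k, Integrable (fun ω => F i k (W k ω)) μ)
    (h0 : ∀ i k, ∫ ω, F i k (W k ω) ∂μ = 0)
    (h2 : ∀ i k, Integrable (fun ω => F i k (W k ω) ^ 2) μ)
    {N : ℕ} (hN : 1 ≤ N) (hFN : ∀ i k, Integrable (fun ω => |F i k (W k ω)| ^ N) μ)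
    {V A B θ x : ℝ} (hV : ∀ i, ∑ k ∈ Finset.range m, ∫ ω, F i k (W k ω) ^ 2 ∂μ ≤ V)
    (hA : ∀ i k, ∫ ω, |F i k (W k ω)| ^ N ∂μ ≤ A)
    (hB : 0 < B) (hθ0 : 0 ≤ θ) (hθ : θ * B ≤ 1) :
    μ {ω | (∃ i, x ≤ |∑ k ∈ Finset.range m, F i k (W k ω)|) ∧
        ∀ i, ∀ k < m, |F i k (W k ω)| ≤ B}
      ≤ m * ENNReal.ofReal b + Fintype.card ι *
        ENNReal.ofReal (2 * Real.exp (-θ * x + (θ ^ 2 * V + m * (A / B ^ N)))) := by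
  have hP : ∀ i, IsProbabilityMeasure (μ.map (W i)) := fun i =>
    Measure.isProbabilityMeasure_map (hW i).aemeasurable
  set P := Measure.pi (fun j : Fin m => μ.map (W j)) with hPdef
  have hg : ∀ i, ∀ k : Fin m, Measurable fun u : E => trunc B (F i k u) := fun i k =>
    (measurable_trunc B).comp (hF i k)
  have hS : ∀ i, Measurable fun u : Fin m → E => ∑ k : Fin m, trunc B (F i k (u k)) := fun i =>
    Finset.measurable_sum _ fun k _ => (hg i k).comp (measurable_pi_apply k)
  set C : ι → Set (Fin m → E) := fun i => {u | x ≤ |∑ k : Fin m, trunc B (F i k (u k))|} with hC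
  have hCm : ∀ i, MeasurableSet (C i) := fun i => measurableSet_le measurable_const (hS i).abs
  have hfull : Measurable (fun ω (j : Fin m) => W j ω) := measurable_pi_lambda _ fun j => hW j
  -- Where every block sum is at most `B`, truncation changes nothing.
  have hsub : {ω | (∃ i, x ≤ |∑ k ∈ Finset.range m, F i k (W k ω)|) ∧
      ∀ i, ∀ k < m, |F i k (W k ω)| ≤ B} ⊆ (fun ω (j : Fin m) => W j ω) ⁻¹' (⋃ i, C i) := by
    rintro ω ⟨⟨i, hi⟩, hall⟩
    refine Set.mem_iUnion.2 ⟨i, ?_⟩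
    change x ≤ |∑ k : Fin m, trunc B (F i k (W k ω))|
    rw [Finset.sum_range] at hi
    convert hi using 3 with k
    exact if_pos (hall i k k.2)
  -- The sign `s` treats the upper and the lower tail together; it enters the bound only through `s
  -- ^ 2 = 1`.
  have hone : ∀ i, ∀ s : ℝ, |s| = 1 →
      P.real {u | x ≤ ∑ k : Fin m, s * trunc B (F i k (u k))}
        ≤ Real.exp (-θ * x + (θ ^ 2 * V + m * (A / B ^ N))) := by
    intro i s hs
    have h := pi_sum_ge_le (fun j : Fin m => μ.map (W j)) (fun k u => s * trunc B (F i k u))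
      (fun k => (hg i k).const_mul s) (B := B)
      (fun k u => by rw [abs_mul, hs, one_mul]; exact abs_trunc_le hB.le _) (x := x) hθ0
    refine h.trans ?_
    rw [Real.exp_add]
    refine mul_le_mul_of_nonneg_left ?_ (Real.exp_pos _).le
    calc ∏ k : Fin m, ∫ u, Real.exp (θ * (s * trunc B (F i k u))) ∂(μ.map (W k))
        ≤ ∏ k : Fin m, Real.exp (θ ^ 2 * ∫ ω, F i k (W k ω) ^ 2 ∂μ + A / B ^ N) := by
          refine Finset.prod_le_prod (fun k _ => integral_nonneg fun u => (Real.exp_pos _).le)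
            fun k _ => ?_
          have hm : Measurable fun u : E => Real.exp (θ * (s * trunc B (F i k u))) :=
            Real.measurable_exp.comp (((hg i k).const_mul s).const_mul θ)
          rw [integral_map (hW k).aemeasurable hm.aestronglyMeasurable]
          have h3 := integral_exp_trunc_le (μ := μ) (θ := θ * s) ((hF i k).comp (hW k)) (h1 i k)
            (h0 i k) (h2 i k) hN (hFN i k) hB
            (by rw [abs_mul, hs, mul_one, abs_of_nonneg hθ0]; exact hθ)
          have h4 : (θ * s) ^ 2 = θ ^ 2 := by
            rw [mul_pow, ← sq_abs s, hs]; ring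
          simp only [Function.comp_apply, mul_assoc] at h3
          refine h3.trans (Real.exp_le_exp.2 ?_)
          rw [h4]
          have : (∫ ω, |F i k (W k ω)| ^ N ∂μ) / B ^ N ≤ A / B ^ N := by
            gcongr; exact hA i k
          linarith
      _ = Real.exp (θ ^ 2 * (∑ k ∈ Finset.range m, ∫ ω, F i k (W k ω) ^ 2 ∂μ)
            + m * (A / B ^ N)) := by
          rw [← Real.exp_sum, Finset.sum_add_distrib, ← Finset.mul_sum, Finset.sum_range]
          simp
      _ ≤ _ := by
          refine Real.exp_le_exp.2 (by gcongr; exact hV i)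
  have hCi : ∀ i, P (C i)
      ≤ ENNReal.ofReal (2 * Real.exp (-θ * x + (θ ^ 2 * V + m * (A / B ^ N)))) := by
    intro i
    have hsub2 : C i ⊆ {u | x ≤ ∑ k : Fin m, 1 * trunc B (F i k (u k))} ∪
        {u | x ≤ ∑ k : Fin m, (-1) * trunc B (F i k (u k))} := by
      intro u hu
      rcases le_abs'.1 (show x ≤ |∑ k : Fin m, trunc B (F i k (u k))| from hu) with h | h
      · right
        simp only [Set.mem_ofPred_eq, neg_mul, one_mul, Finset.sum_neg_distrib]
        linarith
      · left
        simpa using h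
    rw [← ofReal_measureReal]
    refine ENNReal.ofReal_le_ofReal ?_
    refine (measureReal_mono hsub2).trans ((measureReal_union_le _ _).trans ?_)
    have ha := hone i 1 (by simp)
    have hb' := hone i (-1) (by simp)
    linarith
  calc _ ≤ μ ((fun ω (j : Fin m) => W j ω) ⁻¹' (⋃ i, C i)) := measure_mono hsub
    _ = μ.map (fun ω (j : Fin m) => W j ω) (⋃ i, C i) :=
        (Measure.map_apply hfull (MeasurableSet.iUnion hCm)).symm
    _ ≤ P (⋃ i, C i) + m * ENNReal.ofReal b :=
        map_blocks_le_pi m W hW hb _ (MeasurableSet.iUnion hCm)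
    _ ≤ Fintype.card ι *
        ENNReal.ofReal (2 * Real.exp (-θ * x + (θ ^ 2 * V + m * (A / B ^ N))))
        + m * ENNReal.ofReal b := by
        gcongr
        refine (measure_iUnion_fintype_le _ _).trans ?_
        refine (Finset.sum_le_sum fun i _ => hCi i).trans ?_
        simp
    _ = _ := add_comm _ _

end Chernoff

/-! ### Decomposition of a sum into blocks of alternating parity. -/

theorem sum_range_mul_add {M : Type*} [AddCommMonoid M] (f : ℕ → M) (m q : ℕ) :
    ∑ b ∈ Finset.range m, ∑ k ∈ Finset.range q, f (b * q + k) = ∑ n ∈ Finset.range (m * q), f n := by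
  induction m with
  | zero => simp
  | succ m ih => rw [Finset.sum_range_succ, ih, Nat.succ_mul, Finset.sum_range_add]

/-- A sum over the dates `1, …, T`, split into blocks of length `q` with even and odd index. -/
theorem sum_Icc_eq_sum_blocks {M : Type*} [AddCommMonoid M] {T q : ℕ} (hq : 1 ≤ q) (g : ℤ → M)
    (hg : ∀ u, u ∉ Finset.Icc (1 : ℤ) T → g u = 0) :
    ∑ u ∈ Finset.Icc (1 : ℤ) T, g u
      = ∑ b ∈ Finset.range T, ∑ k : Fin q, g ((2 * b + 0 : ℕ) * q + 1 + (k : ℕ))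
        + ∑ b ∈ Finset.range T, ∑ k : Fin q, g ((2 * b + 1 : ℕ) * q + 1 + (k : ℕ)) := by
  have h1 : ∑ u ∈ Finset.Icc (1 : ℤ) T, g u = ∑ n ∈ Finset.range (T * (2 * q)), g ((n : ℤ) + 1) := by
    symm
    -- `T` pairs of blocks are more than needed, but they cover the sample for every `q ≥ 1` without
    -- divisibility; the surplus terms are zero.
    have hT : T ≤ T * (2 * q) := Nat.le_mul_of_pos_right _ (by omega)
    rw [← Finset.sum_subset (Finset.range_mono hT)]
    · refine Finset.sum_bij (fun n _ => (n : ℤ) + 1) ?_ ?_ ?_ ?_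
      · intro n hn; simp only [Finset.mem_range] at hn; simp only [Finset.mem_Icc]; omega
      · intro a _ b _ h; simpa using h
      · intro u hu
        simp only [Finset.mem_Icc] at hu
        exact ⟨(u - 1).toNat, by simp only [Finset.mem_range]; omega, by omega⟩
      · intros; rfl
    · intro n _ hn
      refine hg _ ?_
      simp only [Finset.mem_range, Finset.mem_Icc] at hn ⊢
      omega
  rw [h1, ← sum_range_mul_add, ← Finset.sum_add_distrib]
  refine Finset.sum_congr rfl fun b _ => ?_
  rw [two_mul q, Finset.sum_range_add, Finset.sum_range, Finset.sum_range]
  congr 1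
  · refine Finset.sum_congr rfl fun k _ => ?_
    congr 1; push_cast; ring
  · refine Finset.sum_congr rfl fun k _ => ?_
    congr 1; push_cast; ring

/-! ### The scores: martingale property, moments and deviations. -/

namespace Setting

variable {Ω : Type u} (S : Setting Ω)

/-- The product `ε_{u+1} X_{uj}`. -/
noncomputable def score (T : ℕ) (u : ℤ) (j : Fin (S.p T + 1)) (ω : Ω) : ℝ :=
  S.ε T (u + 1) ω * S.X T u ω j

variable {S} [MeasurableSpace Ω] {μ : Measure Ω}

theorem measurable_X_apply (hS : S.IsMeasurable) (T : ℕ) (u : ℤ) (j : Fin (S.p T + 1)) :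
    Measurable fun ω => S.X T u ω j :=
  (EuclideanSpace.proj (𝕜 := ℝ) j).measurable.comp (hS T u).1

theorem measurable_score (hS : S.IsMeasurable) (T : ℕ) (u : ℤ) (j : Fin (S.p T + 1)) :
    Measurable (S.score T u j) :=
  (hS T (u + 1)).2.mul (measurable_X_apply hS T u j)

theorem measurable_R (hS : S.IsMeasurable) (T : ℕ) (u : ℤ) : Measurable (S.R T u) :=
  (hS T (u + 1)).2.prodMk (hS T u).1

theorem info_le (hS : S.IsMeasurable) (T : ℕ) (u : ℤ) : S.info T u ≤ ‹MeasurableSpace Ω› :=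
  iSup_le fun s => sup_le (hS T s).1.comap_le (hS T s).2.comap_le

omit [MeasurableSpace Ω] in
theorem measurable_info_X (T : ℕ) {s t : ℤ} (h : s ≤ t) : Measurable[S.info T t] (S.X T s) :=
  (comap_measurable (S.X T s)).mono
    (le_trans le_sup_left (le_iSup (fun s : Set.Iic t =>
      MeasurableSpace.comap (S.X T s) inferInstance ⊔
        MeasurableSpace.comap (S.ε T s) inferInstance) ⟨s, h⟩)) le_rfl

omit [MeasurableSpace Ω] in
theorem measurable_info_ε (T : ℕ) {s t : ℤ} (h : s ≤ t) : Measurable[S.info T t] (S.ε T s) :=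
  (comap_measurable (S.ε T s)).mono
    (le_trans le_sup_right (le_iSup (fun s : Set.Iic t =>
      MeasurableSpace.comap (S.X T s) inferInstance ⊔
        MeasurableSpace.comap (S.ε T s) inferInstance) ⟨s, h⟩)) le_rfl

omit [MeasurableSpace Ω] in
theorem measurable_info_X_apply (T : ℕ) {s t : ℤ} (h : s ≤ t) (j : Fin (S.p T + 1)) :
    Measurable[S.info T t] (fun ω => S.X T s ω j) :=
  (EuclideanSpace.proj (𝕜 := ℝ) j).measurable.comp (measurable_info_X T h)

theorem integrable_ε [IsProbabilityMeasure μ] (hS : S.IsMeasurable) (hM : S.Moments μ) {T : ℕ}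
    {t : ℤ} (h1 : 1 ≤ t) (hT : t ≤ T) : Integrable (S.ε T (t + 1)) μ := by
  obtain ⟨δ, hδ, h⟩ := hM
  refine ((integrable_const (1 : ℝ)).add (h T t h1 hT)).mono' (hS T (t + 1)).2.aestronglyMeasurable
    (Eventually.of_forall fun ω => ?_)
  rw [Real.norm_eq_abs]
  set z := √(S.ε T (t + 1) ω ^ 2 + ‖S.X T t ω‖ ^ 2) with hz
  have h0 : 0 ≤ z := Real.sqrt_nonneg _
  have hle : |S.ε T (t + 1) ω| ≤ z := Real.abs_le_sqrt (by nlinarith [sq_nonneg ‖S.X T t ω‖])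
  refine hle.trans ?_
  change z ≤ 1 + z ^ (4 + δ)
  rcases le_total z 1 with h | h
  · have : 0 ≤ z ^ (4 + δ) := Real.rpow_nonneg h0 _
    linarith
  · have : z ^ (1 : ℝ) ≤ z ^ (4 + δ) := Real.rpow_le_rpow_of_exponent_le h (by linarith)
    rw [Real.rpow_one] at this
    linarith

/-- A factor known at date `t` comes out of the conditional expectation, and what remains vanishes.
-/
theorem integral_mul_ε [IsProbabilityMeasure μ] (hS : S.IsMeasurable) (hM : S.Moments μ)
    (hD : S.MartingaleDiff μ) {T : ℕ} {t : ℤ} (h1 : 1 ≤ t) (hT : t ≤ T) {f : Ω → ℝ}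
    (hf : Measurable[S.info T t] f) (hi : Integrable (fun ω => f ω * S.ε T (t + 1) ω) μ) :
    ∫ ω, f ω * S.ε T (t + 1) ω ∂μ = 0 := by
  have h := condExp_mul_of_stronglyMeasurable_left (m := S.info T t) (μ := μ)
    hf.stronglyMeasurable hi (integrable_ε hS hM h1 hT)
  have h2 : μ[f * S.ε T (t + 1) | S.info T t] =ᵐ[μ] 0 := by
    filter_upwards [h, hD T t h1 hT] with ω ha hb
    rw [ha]; simp [hb]
  have h3 := integral_condExp (μ := μ) (f := f * S.ε T (t + 1)) (info_le hS T t)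
  rw [integral_congr_ae h2] at h3
  simpa using h3.symm

theorem abs_pow_le_one_add_rpow {x ψ : ℝ} {n : ℕ} (h : (n : ℝ) ≤ ψ) :
    |x| ^ n ≤ 1 + |x| ^ ψ := by
  rcases le_total |x| 1 with hx | hx
  · have := pow_le_one₀ (n := n) (abs_nonneg x) hx
    have : 0 ≤ |x| ^ ψ := Real.rpow_nonneg (abs_nonneg x) _
    linarith
  · have := Real.rpow_le_rpow_of_exponent_le hx h
    rw [Real.rpow_natCast] at this
    linarith

/-- Uniform bounds on the integer moments of order up to `N` of the scores. -/
theorem score_moments [IsProbabilityMeasure μ] (hS : S.IsMeasurable) {ψ : ℝ}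
    (hP : S.ProductMoments μ ψ) : ∃ C : ℝ, 0 < C ∧ ∀ n : ℕ, (n : ℝ) ≤ ψ →
      ∀ (T : ℕ) (t : ℤ), 1 ≤ t → t ≤ T → ∀ j : Fin (S.p T + 1),
        Integrable (fun ω => |S.score T t j ω| ^ n) μ ∧ ∫ ω, |S.score T t j ω| ^ n ∂μ ≤ C := by
  obtain ⟨C, hC⟩ := hP
  -- Since `|x|^n ≤ 1 + |x|^ψ`, one constant serves all orders; later `n = 2` gives variances and a
  -- large `n` gives tails.
  refine ⟨1 + |C|, by positivity, fun n hn T t h1 hT j => ?_⟩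
  obtain ⟨hi, hb⟩ := hC T t h1 hT j
  have hd : Integrable (fun ω => 1 + |S.ε T (t + 1) ω * S.X T t ω j| ^ ψ) μ :=
    (integrable_const (1 : ℝ)).add hi
  have hint : Integrable (fun ω => |S.score T t j ω| ^ n) μ := by
    refine hd.mono' ((measurable_score hS T t j).abs.pow_const n).aestronglyMeasurable
      (Eventually.of_forall fun ω => ?_)
    rw [Real.norm_eq_abs, abs_of_nonneg (by positivity)]
    exact abs_pow_le_one_add_rpow hn
  refine ⟨hint, (integral_mono hint hd fun ω => abs_pow_le_one_add_rpow hn).trans ?_⟩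
  rw [integral_add (integrable_const _) hi]
  simp only [integral_const, probReal_univ, smul_eq_mul, mul_one]
  linarith [le_abs_self C]

/-- Weighted scores: the products `a_u ε_{u+1} X_{uj}` vanish outside of the sample. -/
theorem integrable_wscore_pow {C : ℝ} {n T : ℕ} {j : Fin (S.p T + 1)} {a : ℤ → ℝ}
    (hC : ∀ t : ℤ, 1 ≤ t → t ≤ T →
      Integrable (fun ω => |S.score T t j ω| ^ n) μ ∧ ∫ ω, |S.score T t j ω| ^ n ∂μ ≤ C)
    (ha0 : ∀ u, u ∉ Finset.Icc (1 : ℤ) T → a u = 0) (hn : 1 ≤ n) (u : ℤ) :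
    Integrable (fun ω => |a u * S.score T u j ω| ^ n) μ ∧
      ∫ ω, |a u * S.score T u j ω| ^ n ∂μ ≤ |a u| ^ n * C := by
  by_cases hu : u ∈ Finset.Icc (1 : ℤ) T
  · rw [Finset.mem_Icc] at hu
    obtain ⟨hi, hb⟩ := hC u hu.1 hu.2
    simp only [abs_mul, mul_pow]
    refine ⟨hi.const_mul _, ?_⟩
    rw [integral_const_mul]
    exact mul_le_mul_of_nonneg_left hb (by positivity)
  · simp [ha0 u hu, zero_pow (by omega : n ≠ 0)]

section Blocks

variable [IsProbabilityMeasure μ]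

omit [IsProbabilityMeasure μ] in
theorem memLp_wscore (hS : S.IsMeasurable) {C : ℝ} {T : ℕ} {j : Fin (S.p T + 1)} {a : ℤ → ℝ}
    (hC : ∀ t : ℤ, 1 ≤ t → t ≤ T →
      Integrable (fun ω => |S.score T t j ω| ^ 2) μ ∧ ∫ ω, |S.score T t j ω| ^ 2 ∂μ ≤ C)
    (ha0 : ∀ u, u ∉ Finset.Icc (1 : ℤ) T → a u = 0) (u : ℤ) :
    MemLp (fun ω => a u * S.score T u j ω) 2 μ := by
  rw [memLp_two_iff_integrable_sq ((measurable_score hS T u j).const_mul _).aestronglyMeasurable]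
  simpa only [sq_abs] using (integrable_wscore_pow hC ha0 one_le_two u).1

theorem integral_wscore (hS : S.IsMeasurable) (hM : S.Moments μ) (hD : S.MartingaleDiff μ)
    {C : ℝ} {T : ℕ} {j : Fin (S.p T + 1)} {a : ℤ → ℝ}
    (hC : ∀ t : ℤ, 1 ≤ t → t ≤ T →
      Integrable (fun ω => |S.score T t j ω| ^ 2) μ ∧ ∫ ω, |S.score T t j ω| ^ 2 ∂μ ≤ C)
    (ha0 : ∀ u, u ∉ Finset.Icc (1 : ℤ) T → a u = 0) (u : ℤ) :
    ∫ ω, a u * S.score T u j ω ∂μ = 0 := by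
  by_cases hu : u ∈ Finset.Icc (1 : ℤ) T
  · rw [Finset.mem_Icc] at hu
    have h := (memLp_wscore hS hC ha0 u).integrable one_le_two
    have he : ∀ ω, a u * S.score T u j ω = (a u * S.X T u ω j) * S.ε T (u + 1) ω := fun ω => by
      unfold score; ring
    simp only [he] at h ⊢
    exact integral_mul_ε hS hM hD hu.1 hu.2
      ((measurable_info_X_apply T le_rfl j).const_mul (a u)) h
  · simp [ha0 u hu]

/-- As `u + 1 ≤ v`, the earlier score and `X_v` are known at date `v`, so `ε_{v+1}` is the only
innovation in the product. -/
theorem integral_wscore_mul_of_lt (hS : S.IsMeasurable) (hM : S.Moments μ)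
    (hD : S.MartingaleDiff μ)
    {C : ℝ} {T : ℕ} {j : Fin (S.p T + 1)} {a : ℤ → ℝ}
    (hC : ∀ t : ℤ, 1 ≤ t → t ≤ T →
      Integrable (fun ω => |S.score T t j ω| ^ 2) μ ∧ ∫ ω, |S.score T t j ω| ^ 2 ∂μ ≤ C)
    (ha0 : ∀ u, u ∉ Finset.Icc (1 : ℤ) T → a u = 0) {u v : ℤ} (huv : u < v) :
    ∫ ω, (a u * S.score T u j ω) * (a v * S.score T v j ω) ∂μ = 0 := by
  by_cases hv : v ∈ Finset.Icc (1 : ℤ) T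
  · rw [Finset.mem_Icc] at hv
    have h : Integrable (fun ω => (a u * S.score T u j ω) * (a v * S.score T v j ω)) μ :=
      (memLp_wscore hS hC ha0 u).integrable_mul (memLp_wscore hS hC ha0 v)
    have he : ∀ ω, (a u * S.score T u j ω) * (a v * S.score T v j ω)
        = ((a u * (S.ε T (u + 1) ω * S.X T u ω j)) * (a v * S.X T v ω j)) * S.ε T (v + 1) ω :=
      fun ω => by unfold score; ring
    simp only [he] at h ⊢
    refine integral_mul_ε hS hM hD hv.1 hv.2 ?_ h
    exact (((measurable_info_ε T (by omega)).mul (measurable_info_X_apply T huv.le j)).const_mul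
      (a u)).mul ((measurable_info_X_apply T le_rfl j).const_mul (a v))
  · simp [ha0 v hv]

/-- The off-diagonal terms vanish by orthogonality. Hence blocking does not inflate the total
variance, which stays a constant times the sum of the squared weights. -/
theorem integral_block_sq_le (hS : S.IsMeasurable) (hM : S.Moments μ)
    (hD : S.MartingaleDiff μ)
    {C : ℝ} {T : ℕ} {j : Fin (S.p T + 1)} {a : ℤ → ℝ}
    (hC : ∀ t : ℤ, 1 ≤ t → t ≤ T →
      Integrable (fun ω => |S.score T t j ω| ^ 2) μ ∧ ∫ ω, |S.score T t j ω| ^ 2 ∂μ ≤ C)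
    (ha0 : ∀ u, u ∉ Finset.Icc (1 : ℤ) T → a u = 0) (q : ℕ) (w : ℤ) :
    ∫ ω, (∑ k : Fin q, a (w + (k : ℕ)) * S.score T (w + (k : ℕ)) j ω) ^ 2 ∂μ
      ≤ ∑ k : Fin q, a (w + (k : ℕ)) ^ 2 * C := by
  have hi : ∀ u v : ℤ, Integrable (fun ω => (a u * S.score T u j ω) * (a v * S.score T v j ω)) μ :=
    fun u v => (memLp_wscore hS hC ha0 u).integrable_mul (memLp_wscore hS hC ha0 v)
  simp only [sq (∑ k : Fin q, _), Finset.sum_mul_sum]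
  rw [integral_finsetSum _ fun k _ => integrable_finsetSum _ fun l _ => hi _ _]
  refine Finset.sum_le_sum fun k _ => ?_
  rw [integral_finsetSum _ fun l _ => hi _ _, Finset.sum_eq_single k]
  · have := (integrable_wscore_pow hC ha0 one_le_two (w + (k : ℕ))).2
    simpa only [sq_abs, ← sq] using this
  · intro l _ hl
    rcases lt_or_gt_of_ne (fun h => hl (Fin.ext h) : (l : ℕ) ≠ k) with h | h
    · simp only [mul_comm (a (w + (k : ℕ)) * S.score T (w + (k : ℕ)) j _)]
      exact integral_wscore_mul_of_lt hS hM hD hC ha0 (by omega)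
    · exact integral_wscore_mul_of_lt hS hM hD hC ha0 (by omega)
  · simp

omit [IsProbabilityMeasure μ] in
-- The power mean inequality. The crude factor `q ^ N` is harmless because block sums are truncated
-- at a level proportional to `q`.
theorem integral_block_pow_le (hS : S.IsMeasurable)
    {C : ℝ} {N T : ℕ} (hN : 1 ≤ N) {j : Fin (S.p T + 1)} {a : ℤ → ℝ}
    (hC0 : 0 < C) (hC : ∀ t : ℤ, 1 ≤ t → t ≤ T →
      Integrable (fun ω => |S.score T t j ω| ^ N) μ ∧ ∫ ω, |S.score T t j ω| ^ N ∂μ ≤ C)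
    (ha : ∀ u, |a u| ≤ 1) (ha0 : ∀ u, u ∉ Finset.Icc (1 : ℤ) T → a u = 0) {q : ℕ} (hq : 1 ≤ q)
    (w : ℤ) :
    Integrable (fun ω => |∑ k : Fin q, a (w + (k : ℕ)) * S.score T (w + (k : ℕ)) j ω| ^ N) μ ∧
    ∫ ω, |∑ k : Fin q, a (w + (k : ℕ)) * S.score T (w + (k : ℕ)) j ω| ^ N ∂μ ≤ q ^ N * C := by
  have hpt : ∀ ω, |∑ k : Fin q, a (w + (k : ℕ)) * S.score T (w + (k : ℕ)) j ω| ^ N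
      ≤ q ^ (N - 1) * ∑ k : Fin q, |a (w + (k : ℕ)) * S.score T (w + (k : ℕ)) j ω| ^ N := by
    intro ω
    have h := pow_sum_div_card_le_sum_pow (s := Finset.univ)
      (f := fun k : Fin q => |a (w + (k : ℕ)) * S.score T (w + (k : ℕ)) j ω|)
      (fun _ _ => abs_nonneg _) (N - 1)
    rw [Nat.sub_add_cancel hN, Finset.card_univ, Fintype.card_fin, div_le_iff₀ (by positivity)] at h
    calc _ ≤ (∑ k : Fin q, |a (w + (k : ℕ)) * S.score T (w + (k : ℕ)) j ω|) ^ N :=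
          pow_le_pow_left₀ (abs_nonneg _) (Finset.abs_sum_le_sum_abs _ _) _
      _ ≤ _ := by rw [mul_comm]; exact h
  have hd : Integrable (fun ω => (q : ℝ) ^ (N - 1) *
      ∑ k : Fin q, |a (w + (k : ℕ)) * S.score T (w + (k : ℕ)) j ω| ^ N) μ :=
    (integrable_finsetSum _ fun k _ => (integrable_wscore_pow hC ha0 hN _).1).const_mul _
  have hm : Measurable fun ω =>
      |∑ k : Fin q, a (w + (k : ℕ)) * S.score T (w + (k : ℕ)) j ω| ^ N :=
    (Finset.measurable_sum _ fun k _ => (measurable_score hS T _ j).const_mul _).abs.pow_const N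
  have hint := hd.mono' (g := fun ω => (q : ℝ) ^ (N - 1) *
      ∑ k : Fin q, |a (w + (k : ℕ)) * S.score T (w + (k : ℕ)) j ω| ^ N)
      hm.aestronglyMeasurable (Eventually.of_forall fun ω => by
        rw [Real.norm_eq_abs, abs_of_nonneg (by positivity)]; exact hpt ω)
  refine ⟨hint, (integral_mono hint hd hpt).trans ?_⟩
  rw [integral_const_mul, integral_finsetSum _
    fun k _ => (integrable_wscore_pow hC ha0 hN _).1]
  calc _ ≤ (q : ℝ) ^ (N - 1) * ∑ _k : Fin q, C := by
        gcongr with k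
        refine (integrable_wscore_pow hC ha0 hN _).2.trans ?_
        exact mul_le_of_le_one_left hC0.le (pow_le_one₀ (abs_nonneg _) (ha _))
    _ = q ^ N * C := by
        obtain ⟨n, rfl⟩ := Nat.exists_eq_add_of_le' hN
        simp [pow_succ, mul_assoc]

omit [IsProbabilityMeasure μ] in
theorem mixCoef_nonneg (l : ℕ) : 0 ≤ S.mixCoef μ l :=
  Real.iSup_nonneg fun _ => betaCoef_nonneg

theorem betaCoef_le_mixCoef (hS : S.IsMeasurable) (T : ℕ) (t : ℤ) (l : ℕ) :
    betaCoef μ (fun ω (s : Set.Iic t) => S.R T s ω) (fun ω (s : Set.Ici (t + l)) => S.R T s ω)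
      ≤ S.mixCoef μ l :=
  le_ciSup (f := fun q : ℕ × ℤ => betaCoef μ
    (fun ω (s : Set.Iic q.2) => S.R q.1 s ω) (fun ω (s : Set.Ici (q.2 + l)) => S.R q.1 s ω))
    ⟨1, by
      rintro _ ⟨q, rfl⟩
      exact betaCoef_le_one (measurable_pi_lambda _ fun s => measurable_R hS q.1 s)
        (measurable_pi_lambda _ fun s => measurable_R hS q.1 s)⟩ (T, t)

theorem mixCoef_le_one (hS : S.IsMeasurable) (l : ℕ) : S.mixCoef μ l ≤ 1 :=
  Real.iSup_le (fun q => betaCoef_le_one (measurable_pi_lambda _ fun s => measurable_R hS q.1 s)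
        (measurable_pi_lambda _ fun s => measurable_R hS q.1 s)) zero_le_one

/-- Between two blocks of the same parity a whole block of length `q` is skipped, so the last date
`t` of one and the first date of the next differ by `q + 1`. -/
theorem betaCoef_blocks_le (hS : S.IsMeasurable) (T e q i n : ℕ) :
    betaCoef μ (fun ω (k : Fin q) => S.R T ((2 * i + e : ℕ) * q + 1 + (k : ℕ)) ω)
      (fun ω (j : Fin n) (k : Fin q) =>
        S.R T ((2 * (i + 1 + j) + e : ℕ) * q + 1 + (k : ℕ)) ω) ≤ S.mixCoef μ (q + 1) := by
  set t : ℤ := (2 * i + e : ℕ) * q + q with ht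
  refine le_trans ?_ (betaCoef_le_mixCoef hS T t (q + 1))
  have hp : ∀ k : Fin q, ((2 * i + e : ℕ) * q + 1 + (k : ℕ) : ℤ) ∈ Set.Iic t := fun k => by
    have := k.2
    rw [Set.mem_Iic, ht]; omega
  have hf : ∀ (j : Fin n) (k : Fin q),
      ((2 * (i + 1 + j) + e : ℕ) * q + 1 + (k : ℕ) : ℤ) ∈ Set.Ici (t + (q + 1 : ℕ)) := fun j k => by
    rw [Set.mem_Ici, ht]
    have : (0 : ℤ) ≤ (j : ℕ) * q := by positivity
    push_cast
    nlinarith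
  exact betaCoef_comp_le (U := fun ω (s : Set.Iic t) => S.R T s ω)
    (V := fun ω (s : Set.Ici (t + (q + 1 : ℕ))) => S.R T s ω)
    (measurable_pi_lambda _ fun s => measurable_R hS T s)
    (measurable_pi_lambda _ fun s => measurable_R hS T s)
    (f := fun x (k : Fin q) => x ⟨_, hp k⟩) (g := fun x (j : Fin n) (k : Fin q) => x ⟨_, hf j k⟩)
    (measurable_pi_lambda _ fun k => measurable_pi_apply _)
    (measurable_pi_lambda _ fun j => measurable_pi_lambda _ fun k => measurable_pi_apply _)

/-- Deviations of weighted sums of scores over the blocks of one parity. -/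
theorem parity_deviation (hS : S.IsMeasurable) (hM : S.Moments μ) (hD : S.MartingaleDiff μ)
    {C : ℝ} {N T : ℕ} (hN : 1 ≤ N) (hC0 : 0 < C)
    (hC2 : ∀ t : ℤ, 1 ≤ t → t ≤ T → ∀ j : Fin (S.p T + 1),
      Integrable (fun ω => |S.score T t j ω| ^ 2) μ ∧ ∫ ω, |S.score T t j ω| ^ 2 ∂μ ≤ C)
    (hCN : ∀ t : ℤ, 1 ≤ t → t ≤ T → ∀ j : Fin (S.p T + 1),
      Integrable (fun ω => |S.score T t j ω| ^ N) μ ∧ ∫ ω, |S.score T t j ω| ^ N ∂μ ≤ C)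
    {ι : Type*} [Fintype ι] {a : ι → ℤ → ℝ} (ha : ∀ i u, |a i u| ≤ 1)
    (ha0 : ∀ i u, u ∉ Finset.Icc (1 : ℤ) T → a i u = 0) {q : ℕ} (hq : 1 ≤ q) {e : ℕ}
    {V D θ x : ℝ}
    (hV : ∀ i, ∑ b ∈ Finset.range T, ∑ k : Fin q,
      a i ((2 * b + e : ℕ) * q + 1 + (k : ℕ)) ^ 2 ≤ V)
    (hD0 : 0 < D) (hθ0 : 0 ≤ θ) (hθ : θ * (q * D) ≤ 1) :
    μ {ω | (∃ i j, x ≤ |∑ b ∈ Finset.range T, ∑ k : Fin q,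
            a i ((2 * b + e : ℕ) * q + 1 + (k : ℕ)) *
              S.score T ((2 * b + e : ℕ) * q + 1 + (k : ℕ)) j ω|) ∧
          ∀ u ∈ Finset.Icc (1 : ℤ) T, ∀ j, |S.score T u j ω| ≤ D}
      ≤ T * ENNReal.ofReal (S.mixCoef μ (q + 1)) + (Fintype.card ι * (S.p T + 1) : ℕ) *
        ENNReal.ofReal (2 * Real.exp (-θ * x + (θ ^ 2 * (V * C) + T * (C / D ^ N)))) := by
  let W : ℕ → Ω → Fin q → ℝ × S.Coef T :=
    fun b ω k => S.R T ((2 * b + e : ℕ) * q + 1 + (k : ℕ)) ω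
  have hW : ∀ b, Measurable (W b) := fun b => measurable_pi_lambda _ fun k => measurable_R hS T _
  let F : ι × Fin (S.p T + 1) → ℕ → (Fin q → ℝ × S.Coef T) → ℝ := fun i b w =>
    ∑ k : Fin q, a i.1 ((2 * b + e : ℕ) * q + 1 + (k : ℕ)) * ((w k).1 * (w k).2 i.2)
  have hF : ∀ i b, Measurable (F i b) := fun i b =>
    Finset.measurable_sum _ fun k _ => (((measurable_pi_apply k).fst).mul
      ((EuclideanSpace.proj (𝕜 := ℝ) i.2).measurable.comp (measurable_pi_apply k).snd)).const_mul _
  have hFW : ∀ i b ω, F i b (W b ω) = ∑ k : Fin q,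
      a i.1 ((2 * b + e : ℕ) * q + 1 + (k : ℕ)) *
        S.score T ((2 * b + e : ℕ) * q + 1 + (k : ℕ)) i.2 ω := fun i b ω => rfl
  have hlp : ∀ i b, MemLp (fun ω => F i b (W b ω)) 2 μ := fun i b => by
    simp only [hFW]
    exact memLp_finsetSum _ fun k _ =>
      memLp_wscore hS (fun t h1 h2 => hC2 t h1 h2 i.2) (ha0 i.1) _
  have hq0 : (0 : ℝ) < q := by exact_mod_cast hq
  have h := blocks_deviation (μ := μ) hW (b := S.mixCoef μ (q + 1))
    (fun i n => betaCoef_blocks_le hS T e q i n) (m := T) hF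
    (fun i b => (hlp i b).integrable one_le_two)
    (fun i b => by
      simp only [hFW]
      rw [integral_finsetSum _ fun k _ => (memLp_wscore hS
        (fun t h1 h2 => hC2 t h1 h2 i.2) (ha0 i.1) _).integrable one_le_two]
      exact Finset.sum_eq_zero fun k _ => integral_wscore hS hM hD
        (fun t h1 h2 => hC2 t h1 h2 i.2) (ha0 i.1) _)
    (fun i b => (hlp i b).integrable_sq) hN
    (fun i b => (integral_block_pow_le hS hN hC0 (fun t h1 h2 => hCN t h1 h2 i.2) (ha i.1)
      (ha0 i.1) hq _).1)
    (V := V * C) (A := q ^ N * C) (B := q * D) (θ := θ) (x := x)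
    (fun i => by
      calc _ ≤ ∑ b ∈ Finset.range T, ∑ k : Fin q,
            a i.1 ((2 * b + e : ℕ) * q + 1 + (k : ℕ)) ^ 2 * C :=
            Finset.sum_le_sum fun b _ => integral_block_sq_le hS hM hD
              (fun t h1 h2 => hC2 t h1 h2 i.2) (ha0 i.1) q _
        _ = (∑ b ∈ Finset.range T, ∑ k : Fin q,
            a i.1 ((2 * b + e : ℕ) * q + 1 + (k : ℕ)) ^ 2) * C := by
            simp only [Finset.sum_mul]
        _ ≤ V * C := mul_le_mul_of_nonneg_right (hV i.1) hC0.le)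
    (fun i b => (integral_block_pow_le hS hN hC0 (fun t h1 h2 => hCN t h1 h2 i.2) (ha i.1)
      (ha0 i.1) hq _).2)
    (by positivity) hθ0 hθ
  have hcard : Fintype.card (ι × Fin (S.p T + 1)) = Fintype.card ι * (S.p T + 1) := by simp
  -- The `q ^ N` of the block moments cancels against that of the truncation level `q * D`.
  rw [hcard, mul_pow, mul_div_mul_left _ _ (by positivity)] at h
  refine le_trans (measure_mono ?_) h
  rintro ω ⟨⟨i, j, hij⟩, hall⟩
  refine ⟨⟨(i, j), hij⟩, fun i b _ => ?_⟩
  rw [hFW]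
  calc _ ≤ ∑ k : Fin q, |a i.1 ((2 * b + e : ℕ) * q + 1 + (k : ℕ)) *
        S.score T ((2 * b + e : ℕ) * q + 1 + (k : ℕ)) i.2 ω| := Finset.abs_sum_le_sum_abs _ _
    _ ≤ ∑ _k : Fin q, D := Finset.sum_le_sum fun k _ => by
        by_cases hu : ((2 * b + e : ℕ) * q + 1 + (k : ℕ) : ℤ) ∈ Finset.Icc (1 : ℤ) T
        · rw [abs_mul]
          calc _ ≤ 1 * D := mul_le_mul (ha _ _) (hall _ hu _) (abs_nonneg _) zero_le_one
            _ = D := one_mul D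
        · rw [ha0 _ _ hu]; simpa using hD0.le
    _ = q * D := by simp

/-- Deviations of weighted sums of scores. -/
theorem score_deviation (hS : S.IsMeasurable) (hM : S.Moments μ) (hD : S.MartingaleDiff μ)
    {C : ℝ} {N T : ℕ} (hN : 1 ≤ N) (hC0 : 0 < C)
    (hC2 : ∀ t : ℤ, 1 ≤ t → t ≤ T → ∀ j : Fin (S.p T + 1),
      Integrable (fun ω => |S.score T t j ω| ^ 2) μ ∧ ∫ ω, |S.score T t j ω| ^ 2 ∂μ ≤ C)
    (hCN : ∀ t : ℤ, 1 ≤ t → t ≤ T → ∀ j : Fin (S.p T + 1),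
      Integrable (fun ω => |S.score T t j ω| ^ N) μ ∧ ∫ ω, |S.score T t j ω| ^ N ∂μ ≤ C)
    {ι : Type*} [Fintype ι] {a : ι → ℤ → ℝ} (ha : ∀ i u, |a i u| ≤ 1)
    (ha0 : ∀ i u, u ∉ Finset.Icc (1 : ℤ) T → a i u = 0) {q : ℕ} (hq : 1 ≤ q) {V D θ x : ℝ}
    (hV : ∀ i, ∑ u ∈ Finset.Icc (1 : ℤ) T, a i u ^ 2 ≤ V)
    (hD0 : 0 < D) (hθ0 : 0 ≤ θ) (hθ : θ * (q * D) ≤ 1) :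
    μ {ω | ∃ i j, 2 * x < |∑ u ∈ Finset.Icc (1 : ℤ) T, a i u * S.score T u j ω|}
      ≤ 2 * (T * ENNReal.ofReal (S.mixCoef μ (q + 1)) + (Fintype.card ι * (S.p T + 1) : ℕ) *
        ENNReal.ofReal (2 * Real.exp (-θ * x + (θ ^ 2 * (V * C) + T * (C / D ^ N)))))
        + (T * (S.p T + 1) : ℕ) * ENNReal.ofReal (C / D ^ N) := by
  set E : ℕ → Set Ω := fun e => {ω | (∃ i j, x ≤ |∑ b ∈ Finset.range T, ∑ k : Fin q,
            a i ((2 * b + e : ℕ) * q + 1 + (k : ℕ)) *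
              S.score T ((2 * b + e : ℕ) * q + 1 + (k : ℕ)) j ω|) ∧
          ∀ u ∈ Finset.Icc (1 : ℤ) T, ∀ j, |S.score T u j ω| ≤ D} with hE
  have hsplit : ∀ i, ∑ u ∈ Finset.Icc (1 : ℤ) T, a i u ^ 2 = _ := fun i =>
    sum_Icc_eq_sum_blocks hq (fun u => a i u ^ 2) fun u hu => by simp [ha0 i u hu]
  have h0 : μ (E 0) ≤ _ := parity_deviation hS hM hD hN hC0 hC2 hCN ha ha0 hq (e := 0) (x := x)
    (V := V) (fun i => by
      have h1 := hV i
      rw [hsplit] at h1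
      refine le_trans (le_add_of_nonneg_right ?_) h1
      exact Finset.sum_nonneg fun b _ => Finset.sum_nonneg fun k _ => sq_nonneg _) hD0 hθ0 hθ
  have h1 : μ (E 1) ≤ _ := parity_deviation hS hM hD hN hC0 hC2 hCN ha ha0 hq (e := 1) (x := x)
    (V := V) (fun i => by
      have h1 := hV i
      rw [hsplit] at h1
      refine le_trans (le_add_of_nonneg_left ?_) h1
      exact Finset.sum_nonneg fun b _ => Finset.sum_nonneg fun k _ => sq_nonneg _) hD0 hθ0 hθ
  -- Markov's inequality of order `N` and a union bound over dates and regressors control the event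
  -- excluded by the truncation.
  have h2 : μ (⋃ u ∈ Finset.Icc (1 : ℤ) T, ⋃ j, {ω | D ≤ |S.score T u j ω|})
      ≤ (T * (S.p T + 1) : ℕ) * ENNReal.ofReal (C / D ^ N) := by
    refine (measure_biUnion_finset_le _ _).trans ?_
    have h3 : ∀ u ∈ Finset.Icc (1 : ℤ) T, μ (⋃ j, {ω | D ≤ |S.score T u j ω|})
        ≤ (S.p T + 1 : ℕ) * ENNReal.ofReal (C / D ^ N) := by
      intro u hu
      rw [Finset.mem_Icc] at hu
      refine (measure_iUnion_fintype_le _ _).trans ?_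
      refine (Finset.sum_le_sum (g := fun _ => ENNReal.ofReal (C / D ^ N)) fun j _ => ?_).trans
        (by simp)
      obtain ⟨hi, hb⟩ := hCN u hu.1 hu.2 j
      have h4 := mul_meas_ge_le_integral_of_nonneg (μ := μ)
        (f := fun ω => |S.score T u j ω| ^ N) (Eventually.of_forall fun ω => by positivity) hi
        (D ^ N)
      rw [← ofReal_measureReal]
      refine ENNReal.ofReal_le_ofReal ?_
      rw [le_div_iff₀ (by positivity), mul_comm]
      refine le_trans (mul_le_mul_of_nonneg_left (measureReal_mono fun ω hω => ?_)
        (by positivity)) (h4.trans hb)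
      exact pow_le_pow_left₀ hD0.le hω N
    refine (Finset.sum_le_sum h3).trans ?_
    simp [mul_assoc]
  have hsub : {ω | ∃ i j, 2 * x < |∑ u ∈ Finset.Icc (1 : ℤ) T, a i u * S.score T u j ω|}
      ⊆ (E 0 ∪ E 1) ∪ ⋃ u ∈ Finset.Icc (1 : ℤ) T, ⋃ j, {ω | D ≤ |S.score T u j ω|} := by
    rintro ω ⟨i, j, hij⟩
    by_cases hall : ∀ u ∈ Finset.Icc (1 : ℤ) T, ∀ j, |S.score T u j ω| ≤ D
    · left
      rw [sum_Icc_eq_sum_blocks hq (fun u => a i u * S.score T u j ω)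
        fun u hu => by simp [ha0 i u hu]] at hij
      have h3 := hij.trans_le (abs_add_le _ _)
      by_cases hx : x ≤ |∑ b ∈ Finset.range T, ∑ k : Fin q,
            a i ((2 * b + 0 : ℕ) * q + 1 + (k : ℕ)) *
              S.score T ((2 * b + 0 : ℕ) * q + 1 + (k : ℕ)) j ω|
      · exact Or.inl ⟨⟨i, j, hx⟩, hall⟩
      · refine Or.inr ⟨⟨i, j, ?_⟩, hall⟩
        linarith
    · right
      push Not at hall
      obtain ⟨u, hu, j, hj⟩ := hall
      exact Set.mem_biUnion hu (Set.mem_iUnion.2 ⟨j, hj.le⟩)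
  refine (measure_mono hsub).trans ((measure_union_le _ _).trans
    (add_le_add ((measure_union_le _ _).trans ?_) h2))
  rw [two_mul]
  exact add_le_add h0 h1

end Blocks

end Setting

/-! ### Deterministic tools: Taylor expansion and the Lasso dichotomy. -/

/-- Taylor's formula of order one on `[0, 1]`, with a bound on the remainder. -/
theorem abs_sub_sub_derivWithin_mul_le {f : ℝ → ℝ} (hf : ContDiffOn ℝ 2 f (Set.Icc 0 1)) {B : ℝ}
    (hB : ∀ x ∈ Set.Icc (0 : ℝ) 1, |iteratedDerivWithin 2 f (Set.Icc 0 1) x| ≤ B) {x y : ℝ}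
    (hx : x ∈ Set.Icc (0 : ℝ) 1) (hy : y ∈ Set.Icc (0 : ℝ) 1) :
    |f y - f x - derivWithin f (Set.Icc 0 1) x * (y - x)| ≤ B * (y - x) ^ 2 := by
  have hu : UniqueDiffOn ℝ (Set.Icc (0 : ℝ) 1) := uniqueDiffOn_Icc_zero_one
  have hB0 : 0 ≤ B := (abs_nonneg _).trans (hB x hx)
  set g := derivWithin f (Set.Icc 0 1) with hg
  have hgd : DifferentiableOn ℝ g (Set.Icc 0 1) :=
    (hf.derivWithin hu (m := 1) (by norm_num)).differentiableOn one_ne_zero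
  have hg2 : ∀ z ∈ Set.Icc (0 : ℝ) 1, ‖derivWithin g (Set.Icc 0 1) z‖ ≤ B := by
    intro z hz
    have h := hB z hz
    rw [iteratedDerivWithin_succ, iteratedDerivWithin_one] at h
    exact h
  have hglip : ∀ z ∈ Set.Icc (0 : ℝ) 1, |g z - g x| ≤ B * |z - x| := fun z hz =>
    Convex.norm_image_sub_le_of_norm_derivWithin_le hgd hg2 (convex_Icc 0 1) hx hz
  have hsub : Set.uIcc x y ⊆ Set.Icc 0 1 := Set.uIcc_subset_Icc hx hy
  -- The mean value inequality for `f` minus its tangent slope, whose derivative is at most `B * |y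
  -- - x|`. This costs a factor two in the remainder.
  have hd : ∀ z ∈ Set.uIcc x y, HasDerivWithinAt (fun z => f z - g x * z) (g z - g x)
      (Set.uIcc x y) z := by
    intro z hz
    have h1 : HasDerivWithinAt f (g z) (Set.uIcc x y) z :=
      ((hf.differentiableOn two_ne_zero z (hsub hz)).hasDerivWithinAt).mono hsub
    have h2 := h1.sub ((hasDerivWithinAt_id z _).const_mul (g x))
    rw [mul_one] at h2
    exact h2
  have hb : ∀ z ∈ Set.uIcc x y, ‖g z - g x‖ ≤ B * |y - x| := fun z hz =>
    (hglip z (hsub hz)).trans (mul_le_mul_of_nonneg_left (Set.abs_sub_left_of_mem_uIcc hz) hB0)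
  have h := Convex.norm_image_sub_le_of_norm_hasDerivWithin_le hd hb (convex_uIcc x y)
    Set.left_mem_uIcc Set.right_mem_uIcc
  rw [Real.norm_eq_abs, Real.norm_eq_abs, mul_assoc, ← sq, sq_abs] at h
  convert h using 2
  ring

/-- The error bound of the Lasso, in terms of the `ℓ¹` norms `A` and `O` of the error on and off
the support, its Euclidean norm `n`, and the quadratic form `Q`. -/
theorem lasso_error_bound {m M δ ρ : ℝ} (hm : 0 < m) (hM : 0 ≤ M) (hδ : 0 < δ) (hρ : 0 < ρ)
    (hMm : M < (1 + 2 * δ) * m) :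
    ∃ η K : ℝ, 0 < η ∧ 0 < K ∧ ∀ lam d A O n Q b : ℝ, 0 < lam → 0 ≤ d → 0 ≤ A → 0 ≤ O → 0 ≤ n →
      0 ≤ b → n ≤ A + O → A ≤ √(2 * d) * n → (O ≤ (1 + 2 * δ) * A → ρ * n ^ 2 ≤ Q) → 0 ≤ Q →
      Q / 2 + lam * (m * O) ≤ lam * (M * A) + 2 * (η * lam) * (A + O) + 2 * b →
      n ≤ K * (√d * lam + b / lam) := by
  -- The first bound keeps `m - 2κ ≥ m / 2`. The second is the solution of `M + 3κ ≤ (1 + 2δ)(m -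
  -- 2κ)`, where `2κ` is lost to the noise on either side and a further `κ` to the bias.
  set κ := min (m / 4) (((1 + 2 * δ) * m - M) / (3 + 2 * (1 + 2 * δ))) with hκ
  have hκ0 : 0 < κ := lt_min (by positivity) (div_pos (by linarith) (by positivity))
  have hκ1 : κ ≤ m / 4 := min_le_left _ _
  have hκ2 : M + 3 * κ ≤ (1 + 2 * δ) * (m - 2 * κ) := by
    have h : κ ≤ ((1 + 2 * δ) * m - M) / (3 + 2 * (1 + 2 * δ)) := min_le_right _ _
    rw [le_div_iff₀ (by positivity)] at h
    linarith
  set K₁ := 2 * (M + 3 * κ) * √2 / ρ with hK1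
  set K₂ := 2 / κ + ((M + 2 * κ) * (2 / κ) + 2) / (m / 2) with hK2
  have hK10 : 0 < K₁ := by positivity
  have hK20 : 0 < K₂ := by positivity
  refine ⟨κ, K₁ + K₂, hκ0, by positivity, ?_⟩
  intro lam d A O n Q b hlam hd hA hO hn hb hnA hAn hRE hQ hmain
  have hbl : 0 ≤ b / lam := by positivity
  have hsd : 0 ≤ √d * lam := by positivity
  -- If the bias is absorbed by the on-support error, the cone condition follows and the restricted
  -- eigenvalue turns `ρ n² ≤ const · lam √d n` into the bound on `n`.
  by_cases hc : 2 * b ≤ κ * lam * A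
  · have h1 : lam * ((m - 2 * κ) * O) ≤ lam * ((M + 3 * κ) * A) := by nlinarith
    have h2 := le_of_mul_le_mul_left h1 hlam
    have h3 : O ≤ (1 + 2 * δ) * A := by
      have h4 : (m - 2 * κ) * O ≤ (m - 2 * κ) * ((1 + 2 * δ) * A) := by nlinarith
      exact le_of_mul_le_mul_left h4 (by linarith)
    have h5 := hRE h3
    have h6 : Q / 2 ≤ lam * ((M + 3 * κ) * A) := by
      have : 0 ≤ lam * ((m - 2 * κ) * O) := by
        have : 0 ≤ m - 2 * κ := by linarith
        positivity
      nlinarith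
    have h7 : n ≤ K₁ * (√d * lam) := by
      rcases hn.eq_or_lt with h0 | h0
      · rw [← h0]; positivity
      · have h8 : ρ * n ^ 2 ≤ 2 * (lam * ((M + 3 * κ) * (√(2 * d) * n))) := by
          have : lam * ((M + 3 * κ) * A) ≤ lam * ((M + 3 * κ) * (√(2 * d) * n)) := by gcongr
          linarith
        rw [Real.sqrt_mul (by norm_num)] at h8
        rw [hK1, div_mul_eq_mul_div, le_div_iff₀ hρ]
        have h9 : n * (n * ρ) ≤ n * (2 * (M + 3 * κ) * √2 * (√d * lam)) := by linarith
        exact le_of_mul_le_mul_left h9 h0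
    calc n ≤ K₁ * (√d * lam) := h7
      _ ≤ (K₁ + K₂) * (√d * lam + b / lam) := by
        have h1 : 0 ≤ K₂ * (√d * lam) := by positivity
        have h2 : 0 ≤ (K₁ + K₂) * (b / lam) := by positivity
        linarith
  -- Otherwise `A` is bounded by the bias, and then so is `O`; no eigenvalue condition is needed
  -- since `n ≤ A + O`.
  · push Not at hc
    have h1 : A ≤ 2 / κ * (b / lam) := by
      rw [div_mul_div_comm, le_div_iff₀ (by positivity)]; linarith
    have h2 : m / 2 * O ≤ (M + 2 * κ) * A + 2 * (b / lam) := by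
      have h3 : lam * (m / 2 * O) ≤ lam * ((M + 2 * κ) * A + 2 * (b / lam)) := by
        have h4 : lam * (b / lam) = b := by field_simp
        have h5 : lam * ((m / 2 - 2 * κ) * O) ≥ 0 := by
          have : 0 ≤ m / 2 - 2 * κ := by linarith
          positivity
        nlinarith
      exact le_of_mul_le_mul_left h3 hlam
    have h3 : O ≤ ((M + 2 * κ) * (2 / κ) + 2) / (m / 2) * (b / lam) := by
      rw [div_mul_eq_mul_div, le_div_iff₀ (by positivity)]
      have : (M + 2 * κ) * A ≤ (M + 2 * κ) * (2 / κ * (b / lam)) := by gcongr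
      linarith
    calc n ≤ K₂ * (b / lam) := by rw [hK2, add_mul]; linarith
      _ ≤ (K₁ + K₂) * (√d * lam + b / lam) := by
        have h1 : 0 ≤ K₁ * (b / lam) := by positivity
        have h2 : 0 ≤ (K₁ + K₂) * (√d * lam) := by positivity
        linarith

/-! ### Norms, restricted eigenvalues and the basic inequality. -/

namespace Setting

variable {Ω : Type u} {S : Setting Ω}

theorem abs_sub_le_of_mem_window {sch : Scheme} {T : ℕ} {t s : ℤ} (hs : s ∈ S.window sch T t) :
    |(s : ℝ) - t| ≤ T * S.h T := by
  have h1 := (Finset.mem_filter.1 hs).1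
  rw [Finset.mem_Icc] at h1
  have h2 : ((S.halfWidth T : ℤ) : ℝ) ≤ T * S.h T := Int.floor_le _
  refine le_trans ?_ h2
  rw [abs_le]
  have h3 : ((t - S.halfWidth T : ℤ) : ℝ) ≤ s := by exact_mod_cast h1.1
  have h4 : (s : ℝ) ≤ ((t + S.halfWidth T : ℤ) : ℝ) := by exact_mod_cast h1.2
  push_cast at h3 h4
  constructor <;> linarith

/-- The kernel is constrained only on `[-1, 1]`; window positions fall there because the half width
is rounded down. -/
theorem abs_rel_le_one {sch : Scheme} {T : ℕ} {t s : ℤ} (hs : s ∈ S.window sch T t) :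
    |((s : ℝ) - t) / (T * S.h T)| ≤ 1 := by
  have h := abs_sub_le_of_mem_window hs
  rw [abs_div, abs_of_nonneg ((abs_nonneg _).trans h)]
  exact div_le_one_of_le₀ h ((abs_nonneg _).trans h)

theorem kst_nonneg (hK : S.KernelCond) {sch : Scheme} {T : ℕ} {t s : ℤ} (hh : 0 < S.h T)
    (hs : s ∈ S.window sch T t) : 0 ≤ S.kst T s t :=
  mul_nonneg (inv_nonneg.2 hh.le) (hK.1 _ (abs_le.1 (abs_rel_le_one hs))).1

variable (S) in
/-- The `ℓ¹` norm of the coordinates in the support. -/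
noncomputable def onNorm (T : ℕ) (v : S.Coef T × S.Coef T) : ℝ :=
  ∑ m : Fin (S.p T + 1), if (m : ℕ) < S.d T then |v.1 m| + |v.2 m| else 0

variable (S) in
/-- The `ℓ¹` norm of the coordinates off the support. -/
noncomputable def offNorm (T : ℕ) (v : S.Coef T × S.Coef T) : ℝ :=
  ∑ m : Fin (S.p T + 1), if (m : ℕ) < S.d T then 0 else |v.1 m| + |v.2 m|

theorem onNorm_nonneg (T : ℕ) (v : S.Coef T × S.Coef T) : 0 ≤ S.onNorm T v :=
  Finset.sum_nonneg fun _ _ => by split_ifs <;> positivity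

theorem offNorm_nonneg (T : ℕ) (v : S.Coef T × S.Coef T) : 0 ≤ S.offNorm T v :=
  Finset.sum_nonneg fun _ _ => by split_ifs <;> positivity

theorem onNorm_add_offNorm (T : ℕ) (v : S.Coef T × S.Coef T) :
    S.onNorm T v + S.offNorm T v = ∑ m, (|v.1 m| + |v.2 m|) := by
  rw [onNorm, offNorm, ← Finset.sum_add_distrib]
  exact Finset.sum_congr rfl fun m _ => by split_ifs <;> simp

variable (S) in
/-- The Euclidean norm of a pair of coefficient vectors. -/
noncomputable def pairNorm (T : ℕ) (v : S.Coef T × S.Coef T) : ℝ := √(‖v.1‖ ^ 2 + ‖v.2‖ ^ 2)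

theorem pairNorm_sq (T : ℕ) (v : S.Coef T × S.Coef T) :
    S.pairNorm T v ^ 2 = ‖v.1‖ ^ 2 + ‖v.2‖ ^ 2 := Real.sq_sqrt (by positivity)

theorem norm_fst_le_pairNorm (T : ℕ) (v : S.Coef T × S.Coef T) : ‖v.1‖ ≤ S.pairNorm T v :=
  Real.le_sqrt_of_sq_le (by nlinarith [sq_nonneg ‖v.2‖])

theorem norm_snd_le_pairNorm (T : ℕ) (v : S.Coef T × S.Coef T) : ‖v.2‖ ≤ S.pairNorm T v :=
  Real.le_sqrt_of_sq_le (by nlinarith [sq_nonneg ‖v.1‖])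

theorem sum_sq_add_sum_sq (T : ℕ) (v : S.Coef T × S.Coef T) :
    S.pairNorm T v ^ 2 = ∑ m, (|v.1 m| ^ 2 + |v.2 m| ^ 2) := by
  rw [pairNorm_sq, EuclideanSpace.norm_sq_eq, EuclideanSpace.norm_sq_eq, Finset.sum_add_distrib]
  simp

theorem pairNorm_le (T : ℕ) (v : S.Coef T × S.Coef T) :
    S.pairNorm T v ≤ S.onNorm T v + S.offNorm T v := by
  rw [onNorm_add_offNorm]
  refine le_of_sq_le_sq ?_ (Finset.sum_nonneg fun _ _ => by positivity)
  rw [sum_sq_add_sum_sq]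
  calc ∑ m, (|v.1 m| ^ 2 + |v.2 m| ^ 2) ≤ ∑ m, (|v.1 m| + |v.2 m|) ^ 2 :=
        Finset.sum_le_sum fun m _ => by nlinarith [abs_nonneg (v.1 m), abs_nonneg (v.2 m)]
    _ ≤ _ := Finset.sum_sq_le_sq_sum_of_nonneg fun _ _ => by positivity

theorem card_rel_le (T : ℕ) :
    (Finset.univ.filter fun m : Fin (S.p T + 1) => (m : ℕ) < S.d T).card ≤ S.d T := by
  calc _ = ((Finset.univ.filter fun m : Fin (S.p T + 1) => (m : ℕ) < S.d T).image Fin.val).card :=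
        (Finset.card_image_of_injective _ Fin.val_injective).symm
    _ ≤ (Finset.range (S.d T)).card := Finset.card_le_card fun n hn => by
        obtain ⟨m, hm, rfl⟩ := Finset.mem_image.1 hn
        exact Finset.mem_range.2 (Finset.mem_filter.1 hm).2
    _ = S.d T := Finset.card_range _

theorem sq_sum_rel_le (T : ℕ) (f : Fin (S.p T + 1) → ℝ) :
    (∑ m : Fin (S.p T + 1), if (m : ℕ) < S.d T then f m else 0) ^ 2
      ≤ S.d T * ∑ m : Fin (S.p T + 1), if (m : ℕ) < S.d T then f m ^ 2 else 0 := by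
  rw [← Finset.sum_filter, ← Finset.sum_filter]
  refine sq_sum_le_card_mul_sum_sq.trans ?_
  exact mul_le_mul_of_nonneg_right (by exact_mod_cast card_rel_le T)
    (Finset.sum_nonneg fun _ _ => sq_nonneg _)

/-- Cauchy–Schwarz over at most `d` levels and `d` slopes. -/
theorem onNorm_le (T : ℕ) (v : S.Coef T × S.Coef T) :
    S.onNorm T v ≤ √(2 * S.d T) * S.pairNorm T v := by
  refine le_of_sq_le_sq ?_ (by unfold pairNorm; positivity)
  rw [mul_pow, Real.sq_sqrt (by positivity), sum_sq_add_sum_sq]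
  refine (sq_sum_rel_le T _).trans ?_
  rw [mul_comm (2 : ℝ), mul_assoc, Finset.mul_sum _ _ (2 : ℝ)]
  refine mul_le_mul_of_nonneg_left ?_ (Nat.cast_nonneg _)
  refine Finset.sum_le_sum fun m _ => ?_
  split_ifs
  · nlinarith [sq_nonneg (|v.1 m| - |v.2 m|)]
  · positivity

theorem gram_nonneg (hK : S.KernelCond) {sch : Scheme} {T : ℕ} {t : ℤ} (hh : 0 < S.h T) (ω : Ω)
    (v : S.Coef T × S.Coef T) : 0 ≤ S.gram sch T t ω v :=
  mul_nonneg (by positivity) (Finset.sum_nonneg fun s hs =>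
    mul_nonneg (kst_nonneg hK hh hs) (sq_nonneg _))

theorem gram_smul {sch : Scheme} {T : ℕ} {t : ℤ} (ω : Ω) (c : ℝ) (v : S.Coef T × S.Coef T) :
    S.gram sch T t ω (c • v) = c ^ 2 * S.gram sch T t ω v := by
  unfold gram
  rw [mul_left_comm (c ^ 2), Finset.mul_sum _ _ (c ^ 2)]
  congr 1
  refine Finset.sum_congr rfl fun s _ => ?_
  have h : ∑ j, ((c • v).1 j + (c • v).2 j * (((s : ℝ) - t) / (T * S.h T))) *
      S.X T (sch.src t s) ω j
      = c * ∑ j, (v.1 j + v.2 j * (((s : ℝ) - t) / (T * S.h T))) * S.X T (sch.src t s) ω j := by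
    rw [Finset.mul_sum]
    refine Finset.sum_congr rfl fun j _ => ?_
    simp only [Prod.smul_fst, Prod.smul_snd, PiLp.smul_apply, smul_eq_mul]
    ring
  rw [h]
  ring

/-- Quadratic homogeneity removes the normalization of the cone. Its inequality, total at most `2(1
+ δ)` times on-support, is the same as off-support at most `1 + 2δ` times on-support. -/
theorem gram_bounds {sch : Scheme} {T : ℕ} {t : ℤ} {ω : Ω} {δ ρ₁ ρ₂ : ℝ}
    (hRE : ∀ v ∈ S.cone T δ, ρ₁ ≤ S.gram sch T t ω v ∧ S.gram sch T t ω v ≤ ρ₂)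
    {v : S.Coef T × S.Coef T} (hv : S.offNorm T v ≤ (1 + 2 * δ) * S.onNorm T v) :
    ρ₁ * S.pairNorm T v ^ 2 ≤ S.gram sch T t ω v ∧
      S.gram sch T t ω v ≤ ρ₂ * S.pairNorm T v ^ 2 := by
  have hn : 0 ≤ S.pairNorm T v := Real.sqrt_nonneg _
  rcases hn.eq_or_lt with h0 | h0
  · have h1 : v = 0 := by
      have h2 := norm_fst_le_pairNorm T v
      have h3 := norm_snd_le_pairNorm T v
      rw [← h0] at h2 h3
      exact Prod.ext (norm_le_zero_iff.1 h2) (norm_le_zero_iff.1 h3)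
    have h4 : S.gram sch T t ω v = 0 := by
      have := gram_smul (S := S) (sch := sch) (t := t) ω 0 v
      rw [zero_smul] at this
      rw [h1, this]; ring
    rw [h4, ← h0]; simp
  · have hc : (S.pairNorm T v)⁻¹ • v ∈ S.cone T δ := by
      constructor
      · simp only [Prod.smul_fst, Prod.smul_snd, norm_smul, mul_pow, norm_inv, Real.norm_eq_abs,
          sq_abs, inv_pow]
        rw [← mul_add, ← pairNorm_sq]
        exact inv_mul_cancel₀ (by positivity)
      · have hi : 0 ≤ (S.pairNorm T v)⁻¹ := by positivity
        have h1 : ∀ m, |((S.pairNorm T v)⁻¹ • v).1 m| + |((S.pairNorm T v)⁻¹ • v).2 m|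
            = (S.pairNorm T v)⁻¹ * (|v.1 m| + |v.2 m|) := fun m => by
          simp only [Prod.smul_fst, Prod.smul_snd, PiLp.smul_apply, smul_eq_mul, abs_mul,
            abs_of_nonneg hi]
          ring
        simp only [h1]
        have h2 : ∀ m : Fin (S.p T + 1), (if (m : ℕ) < S.d T then
            (S.pairNorm T v)⁻¹ * (|v.1 m| + |v.2 m|) else 0)
            = (S.pairNorm T v)⁻¹ * (if (m : ℕ) < S.d T then |v.1 m| + |v.2 m| else 0) :=
          fun m => by split_ifs <;> simp
        simp only [h2]
        rw [← Finset.mul_sum, ← Finset.mul_sum, mul_left_comm, ← onNorm_add_offNorm]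
        refine mul_le_mul_of_nonneg_left ?_ hi
        change _ ≤ 2 * (1 + δ) * S.onNorm T v
        linarith
    have h := hRE _ hc
    rw [gram_smul, inv_pow, inv_mul_eq_div, le_div_iff₀ (by positivity),
      div_le_iff₀ (by positivity)] at h
    exact h

/-- The cross term `b f` is split by `2 b f ≤ 2 b² + f² / 2`, which leaves half of the quadratic
form; the term `e f` is kept exactly, to become the noise. -/
theorem sum_mul_sq_sub_le {κ : Type*} (W : Finset κ) (w e b f : κ → ℝ) (hw : ∀ s ∈ W, 0 ≤ w s) :
    ∑ s ∈ W, w s * (e s + b s) ^ 2 - 2 * ∑ s ∈ W, w s * (e s * f s)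
        - 2 * ∑ s ∈ W, w s * b s ^ 2 + (1 / 2) * ∑ s ∈ W, w s * f s ^ 2
      ≤ ∑ s ∈ W, w s * (e s + b s - f s) ^ 2 := by
  rw [Finset.mul_sum, Finset.mul_sum, Finset.mul_sum, ← Finset.sum_sub_distrib,
    ← Finset.sum_sub_distrib, ← Finset.sum_add_distrib]
  refine Finset.sum_le_sum fun s hs => ?_
  have : 0 ≤ w s * (f s - 2 * b s) ^ 2 := mul_nonneg (hw s hs) (sq_nonneg _)
  nlinarith

variable (S) in
/-- The approximation error `X_uᵀ (β(u/T) - b₀ - ((s - t)/T) b₁)` at position `s` of the window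
around `t`, where `u` is the date of the observation used there. -/
noncomputable def bias (sch : Scheme) (T : ℕ) (t : ℤ) (ω : Ω) (b : S.Coef T × S.Coef T) (s : ℤ) :
    ℝ :=
  ∑ j, S.X T (sch.src t s) ω j *
    (S.β T ((sch.src t s : ℝ) / T) j - b.1 j - b.2 j * (((s : ℝ) - t) / T))

variable (S) in
/-- The weighted sum of squares of the approximation errors. -/
noncomputable def biasSq (sch : Scheme) (T : ℕ) (t : ℤ) (ω : Ω) (b : S.Coef T × S.Coef T) : ℝ :=
  (T : ℝ)⁻¹ * ∑ s ∈ S.window sch T t, S.kst T s t * S.bias sch T t ω b s ^ 2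

variable (S) in
/-- The weighted sums of the scores in the window around `t`, with weights of degree `i`. -/
noncomputable def noise (sch : Scheme) (T : ℕ) (t : ℤ) (ω : Ω) (i : ℕ) (j : Fin (S.p T + 1)) : ℝ :=
  (T : ℝ)⁻¹ * ∑ s ∈ S.window sch T t, S.kst T s t *
    ((((s : ℝ) - t) / (T * S.h T)) ^ i * S.score T (sch.src t s) j ω)

variable (S) in
/-- The error of `a` relative to `b`, the slopes being multiplied by the bandwidth. -/
noncomputable def err (T : ℕ) (a b : S.Coef T × S.Coef T) : S.Coef T × S.Coef T :=
  (a.1 - b.1, S.h T • (a.2 - b.2))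

/-- The basic inequality of the Lasso. -/
theorem basic_inequality (hK : S.KernelCond) {sch : Scheme} {T : ℕ} {t : ℤ} {ω : Ω}
    (hT : 0 < T) (hh : 0 < S.h T) {a b : S.Coef T × S.Coef T}
    (hab : S.objective sch T t ω a ≤ S.objective sch T t ω b) {κ : ℝ}
    (hn : ∀ j, |S.noise sch T t ω 0 j| ≤ κ ∧ |S.noise sch T t ω 1 j| ≤ κ) :
    S.gram sch T t ω (S.err T a b) / 2
      + S.lam₁ T * (∑ j, |a.1 j| - ∑ j, |b.1 j|)
      + S.lam₂ T * (∑ j, |S.h T * a.2 j| - ∑ j, |S.h T * b.2 j|)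
      ≤ 2 * κ * (S.onNorm T (S.err T a b) + S.offNorm T (S.err T a b))
        + 2 * S.biasSq sch T t ω b := by
  have hT' : (0 : ℝ) < T := by exact_mod_cast hT
  set v := S.err T a b with hv
  set f : ℤ → ℝ := fun s => ∑ j, (v.1 j + v.2 j * (((s : ℝ) - t) / (T * S.h T))) *
    S.X T (sch.src t s) ω j with hf
  set e : ℤ → ℝ := fun s => S.ε T (sch.src t s + 1) ω with he
  set c : ℤ → ℝ := fun s => S.bias sch T t ω b s with hc
  have hresb : ∀ s, S.y T (sch.src t s) ω - ∑ j, b.1 j * S.X T (sch.src t s) ω j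
      - ∑ j, b.2 j * (((s : ℝ) - t) / T) * S.X T (sch.src t s) ω j = e s + c s := fun s => by
    simp only [y, hc, bias, he, mul_sub, Finset.sum_sub_distrib]
    simp only [mul_comm]
    ring
  -- The factor `h` in the slope error cancels the one in `(s - t) / (T h)`.
  have hresa : ∀ s, S.y T (sch.src t s) ω - ∑ j, a.1 j * S.X T (sch.src t s) ω j
      - ∑ j, a.2 j * (((s : ℝ) - t) / T) * S.X T (sch.src t s) ω j = e s + c s - f s := fun s => by
    rw [← hresb, sub_sub, sub_sub, sub_sub, ← Finset.sum_add_distrib, ← Finset.sum_add_distrib,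
      ← Finset.sum_add_distrib]
    congr 1
    refine Finset.sum_congr rfl fun j _ => ?_
    simp only [hv, err, PiLp.sub_apply, PiLp.smul_apply, smul_eq_mul]
    field_simp
    ring
  have hla : S.loss sch T t ω a
      = (T : ℝ)⁻¹ * ∑ s ∈ S.window sch T t, S.kst T s t * (e s + c s - f s) ^ 2 := by
    simp only [loss, hresa]
  have hlb : S.loss sch T t ω b
      = (T : ℝ)⁻¹ * ∑ s ∈ S.window sch T t, S.kst T s t * (e s + c s) ^ 2 := by
    simp only [loss, hresb]
  have hmain := mul_le_mul_of_nonneg_left (sum_mul_sq_sub_le (S.window sch T t)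
    (fun s => S.kst T s t) e c f fun s hs => kst_nonneg hK hh hs) (inv_nonneg.2 hT'.le)
  have hnoise : (T : ℝ)⁻¹ * ∑ s ∈ S.window sch T t, S.kst T s t * (e s * f s)
      = ∑ j, (v.1 j * S.noise sch T t ω 0 j + v.2 j * S.noise sch T t ω 1 j) := by
    simp only [noise, Finset.mul_sum, hf, ← Finset.sum_add_distrib]
    rw [Finset.sum_comm]
    refine Finset.sum_congr rfl fun j _ => Finset.sum_congr rfl fun s _ => ?_
    simp only [he, score]
    ring
  have hnb : (T : ℝ)⁻¹ * ∑ s ∈ S.window sch T t, S.kst T s t * (e s * f s)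
      ≤ κ * (S.onNorm T v + S.offNorm T v) := by
    rw [hnoise, onNorm_add_offNorm, Finset.mul_sum]
    refine Finset.sum_le_sum fun j _ => ?_
    have h1 : v.1 j * S.noise sch T t ω 0 j ≤ |v.1 j| * κ := by
      refine (le_abs_self _).trans ?_
      rw [abs_mul]
      exact mul_le_mul_of_nonneg_left (hn j).1 (abs_nonneg _)
    have h2 : v.2 j * S.noise sch T t ω 1 j ≤ |v.2 j| * κ := by
      refine (le_abs_self _).trans ?_
      rw [abs_mul]
      exact mul_le_mul_of_nonneg_left (hn j).2 (abs_nonneg _)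
    linarith
  have hgr : S.gram sch T t ω v
      = (T : ℝ)⁻¹ * ∑ s ∈ S.window sch T t, S.kst T s t * f s ^ 2 := rfl
  have hbi : S.biasSq sch T t ω b
      = (T : ℝ)⁻¹ * ∑ s ∈ S.window sch T t, S.kst T s t * c s ^ 2 := rfl
  unfold objective at hab
  rw [hla, hlb] at hab
  rw [hgr, hbi]
  linarith

/-- The increase of the `ℓ¹` norm away from a vector which vanishes off the support. -/
theorem sum_abs_sub_sum_abs_ge {n : ℕ} (P : Fin n → Prop) [DecidablePred P] (a b v : Fin n → ℝ)
    (hv : ∀ j, v j = a j - b j) (hb : ∀ j, ¬ P j → b j = 0) :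
    (∑ j, if P j then 0 else |v j|) - (∑ j, if P j then |v j| else 0)
      ≤ ∑ j, |a j| - ∑ j, |b j| := by
  rw [← Finset.sum_sub_distrib, ← Finset.sum_sub_distrib]
  refine Finset.sum_le_sum fun j _ => ?_
  rw [hv]
  split_ifs with h
  · have := abs_sub_abs_le_abs_sub (b j) (a j)
    rw [abs_sub_comm] at this
    linarith
  · rw [hb j h]; simp

/-- The increase of the penalty away from sparse levels and slopes. -/
theorem penalty_ge {T : ℕ} {r : ℝ} (hr : 0 < r) {a b : S.Coef T × S.Coef T}
    (hb1 : ∀ j : Fin (S.p T + 1), S.d T ≤ (j : ℕ) → b.1 j = 0)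
    (hb2 : ∀ j : Fin (S.p T + 1), S.d T ≤ (j : ℕ) → b.2 j = 0) :
    min 1 r * S.offNorm T (S.err T a b) - max 1 r * S.onNorm T (S.err T a b)
      ≤ (∑ j, |a.1 j| - ∑ j, |b.1 j|) + r * (∑ j, |S.h T * a.2 j| - ∑ j, |S.h T * b.2 j|) := by
  set v := S.err T a b with hv
  have h1 := sum_abs_sub_sum_abs_ge (fun j : Fin (S.p T + 1) => (j : ℕ) < S.d T) a.1 b.1 v.1
    (fun j => rfl) fun j hj => hb1 j (not_lt.1 hj)
  have h2 := sum_abs_sub_sum_abs_ge (fun j : Fin (S.p T + 1) => (j : ℕ) < S.d T)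
    (fun j => S.h T * a.2 j) (fun j => S.h T * b.2 j) v.2
    (fun j => by simp only [hv, err, PiLp.smul_apply, PiLp.sub_apply, smul_eq_mul]; ring)
    fun j hj => by rw [hb2 j (not_lt.1 hj), mul_zero]
  -- Relative to `λ₁`, levels weigh `1` and slopes `r`: the smaller weight bounds the gain off the
  -- support, the larger one the loss on it.
  have h3 : min 1 r * S.offNorm T v
      ≤ (∑ j : Fin (S.p T + 1), if (j : ℕ) < S.d T then 0 else |v.1 j|)
        + r * (∑ j : Fin (S.p T + 1), if (j : ℕ) < S.d T then 0 else |v.2 j|) := by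
    rw [offNorm, Finset.mul_sum, Finset.mul_sum, ← Finset.sum_add_distrib]
    refine Finset.sum_le_sum fun j _ => ?_
    split_ifs
    · simp
    · have ha := mul_le_mul_of_nonneg_right (min_le_left 1 r) (abs_nonneg (v.1 j))
      have hb := mul_le_mul_of_nonneg_right (min_le_right 1 r) (abs_nonneg (v.2 j))
      linarith
  have h4 : (∑ j : Fin (S.p T + 1), if (j : ℕ) < S.d T then |v.1 j| else 0)
        + r * (∑ j : Fin (S.p T + 1), if (j : ℕ) < S.d T then |v.2 j| else 0)
      ≤ max 1 r * S.onNorm T v := by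
    rw [onNorm, Finset.mul_sum, Finset.mul_sum, ← Finset.sum_add_distrib]
    refine Finset.sum_le_sum fun j _ => ?_
    split_ifs
    · have ha := mul_le_mul_of_nonneg_right (le_max_left 1 r) (abs_nonneg (v.1 j))
      have hb := mul_le_mul_of_nonneg_right (le_max_right 1 r) (abs_nonneg (v.2 j))
      linarith
    · simp
  have h5 := mul_le_mul_of_nonneg_left h2 hr.le
  linarith

/-- The increase of the penalty away from sparse levels and zero slopes. -/
theorem penalty_ge_of_slope_eq_zero {T : ℕ} {r m : ℝ} (hr : 0 < r) {a b : S.Coef T × S.Coef T}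
    (hb1 : ∀ j : Fin (S.p T + 1), S.d T ≤ (j : ℕ) → b.1 j = 0) (hb2 : b.2 = 0)
    (hm1 : m ≤ 1) (hm : m ≤ r ∨ a.2 = 0) :
    m * S.offNorm T (S.err T a b) - 1 * S.onNorm T (S.err T a b)
      ≤ (∑ j, |a.1 j| - ∑ j, |b.1 j|) + r * (∑ j, |S.h T * a.2 j| - ∑ j, |S.h T * b.2 j|) := by
  set v := S.err T a b with hv
  have h1 := sum_abs_sub_sum_abs_ge (fun j : Fin (S.p T + 1) => (j : ℕ) < S.d T) a.1 b.1 v.1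
    (fun j => rfl) fun j hj => hb1 j (not_lt.1 hj)
  have hv2 : ∀ j, v.2 j = S.h T * a.2 j := fun j => by simp [hv, err, hb2]
  have h2 : ∑ j, |S.h T * a.2 j| - ∑ j, |S.h T * b.2 j| = ∑ j, |v.2 j| := by
    simp [hb2, hv2]
  have h3 : m * S.offNorm T v - 1 * S.onNorm T v
      ≤ (∑ j : Fin (S.p T + 1), if (j : ℕ) < S.d T then 0 else |v.1 j|)
        - (∑ j : Fin (S.p T + 1), if (j : ℕ) < S.d T then |v.1 j| else 0)
        + r * ∑ j, |v.2 j| := by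
    rw [offNorm, onNorm, Finset.mul_sum, Finset.mul_sum, Finset.mul_sum, ← Finset.sum_sub_distrib,
      ← Finset.sum_sub_distrib, ← Finset.sum_add_distrib]
    refine Finset.sum_le_sum fun j _ => ?_
    have ha := mul_le_mul_of_nonneg_right hm1 (abs_nonneg (v.1 j))
    -- As the target slopes vanish, every slope coordinate adds to the penalty; only levels cause a
    -- loss on the support, hence the constant `1` there.
    have hb : m * |v.2 j| ≤ r * |v.2 j| := by
      rcases hm with hm | hm
      · exact mul_le_mul_of_nonneg_right hm (abs_nonneg _)
      · rw [hv2, hm]; simp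
    have hc : 0 ≤ r * |v.2 j| := by positivity
    have hd := abs_nonneg (v.2 j)
    split_ifs <;> linarith
  rw [h2]
  linarith

end Setting

/-! ### The approximation error of the local linear fit. -/

namespace Setting

variable {Ω : Type u} {S : Setting Ω}

/-- A unit vector of a relevant level has no off-support part, so the upper eigenvalue bound
controls the weighted second moment of that regressor. -/
theorem gram_single_le {sch : Scheme} {T : ℕ} {t : ℤ} {ω : Ω} {δ ρ₁ ρ₂ : ℝ} (hδ : 0 < δ)
    (hRE : ∀ v ∈ S.cone T δ, ρ₁ ≤ S.gram sch T t ω v ∧ S.gram sch T t ω v ≤ ρ₂)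
    {j : Fin (S.p T + 1)} (hj : (j : ℕ) < S.d T) :
    (T : ℝ)⁻¹ * ∑ s ∈ S.window sch T t, S.kst T s t * S.X T (sch.src t s) ω j ^ 2 ≤ ρ₂ := by
  set v : S.Coef T × S.Coef T := (EuclideanSpace.single j 1, 0) with hv
  have hoff : S.offNorm T v = 0 := Finset.sum_eq_zero fun m _ => by
    split_ifs with h
    · rfl
    · have : m ≠ j := by rintro rfl; exact h hj
      simp [hv, this]
  have hn : S.pairNorm T v ^ 2 = 1 := by rw [pairNorm_sq]; simp [hv]
  have h := (gram_bounds hRE (v := v) (by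
    rw [hoff]; exact mul_nonneg (by linarith) (onNorm_nonneg T v))).2
  rw [hn, mul_one] at h
  refine le_trans (le_of_eq ?_) h
  simp [gram, hv]

/-- The weighted sum of squares of `X_uᵀ D_s`, for vectors `D_s` with small coordinates which
vanish off the support. -/
theorem weighted_sq_le (hK : S.KernelCond) {sch : Scheme} {T : ℕ} {t : ℤ} {ω : Ω} {δ ρ₁ ρ₂ : ℝ}
    (hδ : 0 < δ) (hh : 0 < S.h T)
    (hRE : ∀ v ∈ S.cone T δ, ρ₁ ≤ S.gram sch T t ω v ∧ S.gram sch T t ω v ≤ ρ₂)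
    {D : ℤ → Fin (S.p T + 1) → ℝ} {κ : ℝ} (hρ : 0 ≤ ρ₂)
    (hD0 : ∀ s ∈ S.window sch T t, ∀ j : Fin (S.p T + 1), S.d T ≤ (j : ℕ) → D s j = 0)
    (hD : ∀ s ∈ S.window sch T t, ∀ j, |D s j| ≤ κ) :
    (T : ℝ)⁻¹ * ∑ s ∈ S.window sch T t, S.kst T s t *
      (∑ j, S.X T (sch.src t s) ω j * D s j) ^ 2 ≤ ρ₂ * (S.d T * κ) ^ 2 := by
  -- `D s` varies with `s`, so this is not a value of the quadratic form; Cauchy–Schwarz over the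
  -- relevant coordinates reduces it to single regressors.
  have hpt : ∀ s ∈ S.window sch T t, (∑ j, S.X T (sch.src t s) ω j * D s j) ^ 2
      ≤ κ ^ 2 * S.d T * ∑ j : Fin (S.p T + 1),
        if (j : ℕ) < S.d T then S.X T (sch.src t s) ω j ^ 2 else 0 := by
    intro s hs
    have h1 : |∑ j, S.X T (sch.src t s) ω j * D s j| ≤
        ∑ j : Fin (S.p T + 1), if (j : ℕ) < S.d T then |S.X T (sch.src t s) ω j| * κ else 0 := by
      refine (Finset.abs_sum_le_sum_abs _ _).trans (Finset.sum_le_sum fun j _ => ?_)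
      split_ifs with h
      · rw [abs_mul]; exact mul_le_mul_of_nonneg_left (hD s hs j) (abs_nonneg _)
      · rw [hD0 s hs j (not_lt.1 h)]; simp
    rw [← sq_abs]
    refine (pow_le_pow_left₀ (abs_nonneg _) h1 2).trans ((sq_sum_rel_le T _).trans (le_of_eq ?_))
    rw [mul_right_comm, mul_comm, Finset.mul_sum (a := κ ^ 2)]
    congr 1
    refine Finset.sum_congr rfl fun j _ => ?_
    split_ifs
    · rw [mul_pow, sq_abs, mul_comm]
    · simp
  calc _ ≤ (T : ℝ)⁻¹ * ∑ s ∈ S.window sch T t, S.kst T s t * (κ ^ 2 * S.d T *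
        ∑ j : Fin (S.p T + 1), if (j : ℕ) < S.d T then S.X T (sch.src t s) ω j ^ 2 else 0) := by
        refine mul_le_mul_of_nonneg_left (Finset.sum_le_sum fun s hs => ?_) (by positivity)
        exact mul_le_mul_of_nonneg_left (hpt s hs) (kst_nonneg hK hh hs)
    _ = κ ^ 2 * S.d T * ∑ j : Fin (S.p T + 1), if (j : ℕ) < S.d T then
        (T : ℝ)⁻¹ * ∑ s ∈ S.window sch T t, S.kst T s t * S.X T (sch.src t s) ω j ^ 2 else 0 := by
        simp only [Finset.mul_sum, ← Finset.sum_filter]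
        rw [Finset.sum_comm]
        refine Finset.sum_congr rfl fun j _ => Finset.sum_congr rfl fun s _ => ?_
        ring
    _ ≤ κ ^ 2 * S.d T * ∑ j : Fin (S.p T + 1), if (j : ℕ) < S.d T then ρ₂ else 0 := by
        refine mul_le_mul_of_nonneg_left (Finset.sum_le_sum fun j _ => ?_) (by positivity)
        split_ifs with h
        · exact gram_single_le hδ hRE h
        · exact le_rfl
    _ ≤ κ ^ 2 * S.d T * (S.d T * ρ₂) := by
        refine mul_le_mul_of_nonneg_left ?_ (by positivity)
        rw [← Finset.sum_filter, Finset.sum_const, nsmul_eq_mul]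
        exact mul_le_mul_of_nonneg_right (by exact_mod_cast card_rel_le T) hρ
    _ = _ := by ring

/-- Reflection preserves the distance to `t`, so both schemes share the remainder bounds and differ
only in the sign of the linear term. -/
theorem src_sub (sch : Scheme) (t s : ℤ) : sch.src t s - t = s - t ∨ sch.src t s - t = -(s - t) := by
  cases sch
  · exact Or.inl rfl
  · simp only [Scheme.src]
    split_ifs
    · exact Or.inl rfl
    · right; ring

theorem mem_Icc_of_mem_dates {sch : Scheme} {T : ℕ} {t : ℤ} (hh : 0 ≤ S.h T)
    (ht : t ∈ S.dates T sch) : 1 ≤ t ∧ t ≤ T := by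
  cases sch
  · exact Finset.mem_Icc.1 ht
  · have h := Finset.mem_Icc.1 ht
    have : 0 ≤ S.halfWidth T := Int.floor_nonneg.2 (by positivity)
    omega

theorem div_mem_Icc {T : ℕ} {u : ℤ} (h1 : 1 ≤ u) (hT : u ≤ T) :
    (u : ℝ) / T ∈ Set.Icc (0 : ℝ) 1 := by
  have h1' : (1 : ℝ) ≤ u := by exact_mod_cast h1
  have h2' : (u : ℝ) ≤ T := by exact_mod_cast hT
  exact ⟨by positivity, div_le_one_of_le₀ h2' (by positivity)⟩

theorem slope_eq_zero (hsp : S.Sparse) {T : ℕ} {τ : ℝ} (hτ : τ ∈ Set.Icc (0 : ℝ) 1)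
    {j : Fin (S.p T + 1)} (hj : S.d T ≤ (j : ℕ)) : S.slope T τ j = 0 := by
  have h : derivWithin (fun x => S.β T x j) (Set.Icc 0 1) τ
      = derivWithin (fun _ => (0 : ℝ)) (Set.Icc 0 1) τ :=
    derivWithin_congr (fun x hx => hsp T x hx j hj) (hsp T τ hτ j hj)
  simpa [slope] using h

variable (S) in
/-- The remainder of the first order expansion of the weights around date `t`. -/
noncomputable def remainder (T : ℕ) (t u : ℤ) (j : Fin (S.p T + 1)) : ℝ :=
  S.β T ((u : ℝ) / T) j - S.β T ((t : ℝ) / T) j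
    - S.slope T ((t : ℝ) / T) j * (((u : ℝ) - t) / T)

theorem abs_remainder_le {B : ℝ} (hsm : ∀ T j, ContDiffOn ℝ 2 (fun τ => S.β T τ j) (Set.Icc 0 1))
    (hB : ∀ T j, ∀ τ ∈ Set.Icc (0 : ℝ) 1,
      |iteratedDerivWithin 2 (fun x => S.β T x j) (Set.Icc 0 1) τ| ≤ B)
    {sch : Scheme} {T : ℕ} {t s : ℤ} (hT : 0 < T) (ht : 1 ≤ t ∧ t ≤ T)
    (hs : s ∈ S.window sch T t) (j : Fin (S.p T + 1)) :
    |S.remainder T t (sch.src t s) j| ≤ B * S.h T ^ 2 := by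
  have hT' : (0 : ℝ) < T := by exact_mod_cast hT
  have hw := (Finset.mem_filter.1 hs).2
  have htm := div_mem_Icc ht.1 ht.2
  have hB0 : 0 ≤ B := (abs_nonneg _).trans (hB T j _ htm)
  have h := abs_sub_sub_derivWithin_mul_le (hsm T j) (hB T j) htm (div_mem_Icc hw.2.1 hw.2.2)
  have hle : |((sch.src t s : ℤ) : ℝ) - t| ≤ T * S.h T := by
    have h1 := abs_sub_le_of_mem_window hs
    rcases src_sub sch t s with h2 | h2
    · have h3 : ((sch.src t s : ℤ) : ℝ) - t = s - t := by exact_mod_cast h2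
      rwa [h3]
    · have h3 : ((sch.src t s : ℤ) : ℝ) - t = -(s - t) := by exact_mod_cast h2
      rwa [h3, abs_neg]
  rw [← sub_div] at h
  refine h.trans (mul_le_mul_of_nonneg_left ?_ hB0)
  rw [← sq_abs]
  refine pow_le_pow_left₀ (abs_nonneg _) ?_ 2
  rw [abs_div, abs_of_pos hT', div_le_iff₀ hT']
  linarith

theorem remainder_eq_zero (hsp : S.Sparse) {sch : Scheme} {T : ℕ} {t s : ℤ} (ht : 1 ≤ t ∧ t ≤ T)
    (hs : s ∈ S.window sch T t) {j : Fin (S.p T + 1)} (hj : S.d T ≤ (j : ℕ)) :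
    S.remainder T t (sch.src t s) j = 0 := by
  have hw := (Finset.mem_filter.1 hs).2
  rw [remainder, hsp T _ (div_mem_Icc hw.2.1 hw.2.2) j hj, hsp T _ (div_mem_Icc ht.1 ht.2) j hj,
    slope_eq_zero hsp (div_mem_Icc ht.1 ht.2) hj]
  simp

/-- The approximation error at the true levels and slopes, for two-sided data. -/
theorem biasSq_le_of_slope (hK : S.KernelCond) (hsp : S.Sparse) {B : ℝ}
    (hsm : ∀ T j, ContDiffOn ℝ 2 (fun τ => S.β T τ j) (Set.Icc 0 1))
    (hB : ∀ T j, ∀ τ ∈ Set.Icc (0 : ℝ) 1,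
      |iteratedDerivWithin 2 (fun x => S.β T x j) (Set.Icc 0 1) τ| ≤ B)
    {T : ℕ} {t : ℤ} {ω : Ω} {δ ρ₁ ρ₂ : ℝ} (hδ : 0 < δ) (hh : 0 < S.h T) (hT : 0 < T)
    (hρ : 0 ≤ ρ₂) (ht : 1 ≤ t ∧ t ≤ T)
    (hRE : ∀ v ∈ S.cone T δ, ρ₁ ≤ S.gram .twoSided T t ω v ∧ S.gram .twoSided T t ω v ≤ ρ₂) :
    S.biasSq .twoSided T t ω (S.β T ((t : ℝ) / T), S.slope T ((t : ℝ) / T))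
      ≤ ρ₂ * (S.d T * (B * S.h T ^ 2)) ^ 2 :=
  weighted_sq_le hK hδ hh hRE hρ (fun _ hs _ hj => remainder_eq_zero hsp ht hs hj)
    fun _ hs j => abs_remainder_le hsm hB hT ht hs j

/-- The approximation error at the true levels and zero slopes. -/
theorem biasSq_le_of_zero (hK : S.KernelCond) (hsp : S.Sparse) {B : ℝ}
    (hsm : ∀ T j, ContDiffOn ℝ 2 (fun τ => S.β T τ j) (Set.Icc 0 1))
    (hB : ∀ T j, ∀ τ ∈ Set.Icc (0 : ℝ) 1,
      |derivWithin (fun x => S.β T x j) (Set.Icc 0 1) τ| ≤ B ∧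
      |iteratedDerivWithin 2 (fun x => S.β T x j) (Set.Icc 0 1) τ| ≤ B)
    {sch : Scheme} {T : ℕ} {t : ℤ} {ω : Ω} {δ ρ₁ ρ₂ : ℝ} (hδ : 0 < δ) (hh : 0 < S.h T) (hT : 0 < T)
    (hρ : 0 ≤ ρ₂) (ht : 1 ≤ t ∧ t ≤ T)
    (hRE : ∀ v ∈ S.cone T δ, ρ₁ ≤ S.gram sch T t ω v ∧ S.gram sch T t ω v ≤ ρ₂) :
    S.biasSq sch T t ω (S.β T ((t : ℝ) / T), 0)
      ≤ 2 * (ρ₂ * (S.d T * (B * S.h T) ^ 2)) + 2 * (ρ₂ * (S.d T * (B * S.h T ^ 2)) ^ 2) := by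
  have hT' : (0 : ℝ) < T := by exact_mod_cast hT
  have htm := div_mem_Icc ht.1 ht.2
  set v : S.Coef T × S.Coef T := (0, S.h T • S.slope T ((t : ℝ) / T)) with hv
  set f : ℤ → ℝ := fun s => ∑ j, (v.1 j + v.2 j * (((s : ℝ) - t) / (T * S.h T))) *
    S.X T (sch.src t s) ω j with hf
  set g : ℤ → ℝ := fun s => ∑ j, S.X T (sch.src t s) ω j * S.remainder T t (sch.src t s) j with hg
  have hfe : ∀ s, f s = ∑ j, S.X T (sch.src t s) ω j *
      (S.slope T ((t : ℝ) / T) j * (((s : ℝ) - t) / T)) := fun s => by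
    refine Finset.sum_congr rfl fun j _ => ?_
    simp only [hv, PiLp.zero_apply, PiLp.smul_apply, smul_eq_mul]
    field_simp
    ring
  -- The bias is `g ± f`, with a minus sign at reflected positions; squaring makes the sign
  -- irrelevant.
  have hbias : ∀ s, S.bias sch T t ω (S.β T ((t : ℝ) / T), 0) s ^ 2 ≤ 2 * f s ^ 2 + 2 * g s ^ 2 := by
    intro s
    have h1 : ∀ c : ℝ, ((sch.src t s : ℤ) : ℝ) - t = c →
        S.bias sch T t ω (S.β T ((t : ℝ) / T), 0) s = g s + ∑ j, S.X T (sch.src t s) ω j *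
          (S.slope T ((t : ℝ) / T) j * (c / T)) := by
      rintro c rfl
      rw [hg, ← Finset.sum_add_distrib]
      refine Finset.sum_congr rfl fun j _ => ?_
      simp only [remainder, PiLp.zero_apply]
      ring
    rcases src_sub sch t s with h2 | h2
    · have h3 : ((sch.src t s : ℤ) : ℝ) - t = s - t := by exact_mod_cast h2
      rw [h1 _ h3, ← hfe]
      nlinarith [sq_nonneg (f s - g s)]
    · have h3 : ((sch.src t s : ℤ) : ℝ) - t = -(s - t) := by exact_mod_cast h2
      have h4 : ∑ j, S.X T (sch.src t s) ω j *
          (S.slope T ((t : ℝ) / T) j * ((-((s : ℝ) - t)) / T)) = - f s := by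
        rw [hfe, ← Finset.sum_neg_distrib]
        exact Finset.sum_congr rfl fun j _ => by ring
      rw [h1 _ h3, h4]
      nlinarith [sq_nonneg (f s + g s)]
  have hgs : (T : ℝ)⁻¹ * ∑ s ∈ S.window sch T t, S.kst T s t * g s ^ 2
      ≤ ρ₂ * (S.d T * (B * S.h T ^ 2)) ^ 2 :=
    weighted_sq_le hK hδ hh hRE hρ (fun _ hs _ hj => remainder_eq_zero hsp ht hs hj)
      fun _ hs j => abs_remainder_le hsm (fun T j τ hτ => (hB T j τ hτ).2) hT ht hs j
  have hsl0 : ∀ j : Fin (S.p T + 1), S.d T ≤ (j : ℕ) → S.slope T ((t : ℝ) / T) j = 0 :=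
    fun j hj => slope_eq_zero hsp htm hj
  -- The linear part is a value of the quadratic form at a sparse vector, which gives a factor `d`
  -- where coordinatewise Cauchy–Schwarz would give `d²`.
  have hfs : S.gram sch T t ω v ≤ ρ₂ * (S.d T * (B * S.h T) ^ 2) := by
    have hoff : S.offNorm T v = 0 := Finset.sum_eq_zero fun m _ => by
      split_ifs with h
      · rfl
      · simp [hv, hsl0 m (not_lt.1 h)]
    refine (gram_bounds hRE (v := v) (by
      rw [hoff]; exact mul_nonneg (by linarith) (onNorm_nonneg T v))).2.trans ?_
    refine mul_le_mul_of_nonneg_left ?_ hρ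
    rw [sum_sq_add_sum_sq]
    calc _ ≤ ∑ m : Fin (S.p T + 1), if (m : ℕ) < S.d T then (B * S.h T) ^ 2 else 0 := by
          refine Finset.sum_le_sum fun m _ => ?_
          split_ifs with h
          · have h1 : |S.slope T ((t : ℝ) / T) m| ≤ B := (hB T m _ htm).1
            simp only [hv, PiLp.zero_apply, PiLp.smul_apply, smul_eq_mul, abs_mul, abs_of_pos hh]
            rw [abs_zero, zero_pow two_ne_zero, zero_add]
            refine pow_le_pow_left₀ (by positivity) ?_ 2
            rw [mul_comm]
            exact mul_le_mul_of_nonneg_right h1 hh.le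
          · simp [hv, hsl0 m (not_lt.1 h)]
      _ ≤ _ := by
        rw [← Finset.sum_filter, Finset.sum_const, nsmul_eq_mul]
        exact mul_le_mul_of_nonneg_right (by exact_mod_cast card_rel_le T) (sq_nonneg _)
  have hgr : S.gram sch T t ω v = (T : ℝ)⁻¹ * ∑ s ∈ S.window sch T t, S.kst T s t * f s ^ 2 := rfl
  have hsum : S.biasSq sch T t ω (S.β T ((t : ℝ) / T), 0)
      ≤ 2 * ((T : ℝ)⁻¹ * ∑ s ∈ S.window sch T t, S.kst T s t * f s ^ 2)
        + 2 * ((T : ℝ)⁻¹ * ∑ s ∈ S.window sch T t, S.kst T s t * g s ^ 2) := by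
    unfold biasSq
    rw [mul_left_comm, mul_left_comm (2 : ℝ), ← mul_add, Finset.mul_sum _ _ (2 : ℝ),
      Finset.mul_sum _ _ (2 : ℝ), ← Finset.sum_add_distrib]
    refine mul_le_mul_of_nonneg_left (Finset.sum_le_sum fun s hs => ?_) (by positivity)
    have := mul_le_mul_of_nonneg_left (hbias s) (kst_nonneg hK hh hs)
    linarith
  rw [hgr] at hfs
  linarith

/-! ### Vanishing slopes under reflection. -/

theorem src_reflected_symm (t s : ℤ) :
    Scheme.reflected.src t (2 * t - s) = Scheme.reflected.src t s := by
  simp only [Scheme.src]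
  split_ifs <;> omega

/-- With reflected data, the estimated slopes vanish. -/
theorem slope_eq_zero_of_reflected (hK : S.KernelCond) {T : ℕ} {t : ℤ} {ω : Ω}
    (hh : 0 < S.h T) (hlam : 0 < S.lam₂ T) {a : S.Coef T × S.Coef T}
    (ha : ∀ b, S.objective .reflected T t ω a ≤ S.objective .reflected T t ω b) : a.2 = 0 := by
  set W := S.window .reflected T t with hW
  set r : ℤ → ℝ := fun s => S.y T (Scheme.reflected.src t s) ω
    - ∑ j, a.1 j * S.X T (Scheme.reflected.src t s) ω j with hr
  set f : ℤ → ℝ := fun s =>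
    ∑ j, a.2 j * (((s : ℝ) - t) / T) * S.X T (Scheme.reflected.src t s) ω j with hf
  have hWs : ∀ s ∈ W, 2 * t - s ∈ W := fun s hs => by
    have h := Finset.mem_filter.1 hs
    refine Finset.mem_filter.2 ⟨?_, ?_, ?_⟩
    · have := Finset.mem_Icc.1 h.1
      exact Finset.mem_Icc.2 (by omega)
    · have := h.2.1; omega
    · rw [src_reflected_symm]; exact h.2.2
  have hrs : ∀ s, r (2 * t - s) = r s := fun s => by simp only [hr, src_reflected_symm]
  have hfs : ∀ s, f (2 * t - s) = - f s := fun s => by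
    simp only [hf, src_reflected_symm, ← Finset.sum_neg_distrib]
    refine Finset.sum_congr rfl fun j _ => ?_
    push_cast
    ring
  have hks : ∀ s ∈ W, S.kst T (2 * t - s) t = S.kst T s t := fun s hs => by
    unfold kst
    rw [← (hK.1 _ (abs_le.1 (abs_rel_le_one hs))).2.1]
    congr 2
    push_cast
    ring
  -- Under `s ↦ 2t - s` the residual `r` and the kernel are even and `f` is odd, so the sum equals
  -- its negative.
  have hcross : ∑ s ∈ W, S.kst T s t * (r s * f s) = 0 := by
    have h : ∑ s ∈ W, S.kst T s t * (r s * f s) = ∑ s ∈ W, -(S.kst T s t * (r s * f s)) := by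
      refine Finset.sum_nbij' (fun s => 2 * t - s) (fun s => 2 * t - s) hWs hWs
        (fun s _ => by ring) (fun s _ => by ring) fun s hs => ?_
      rw [hrs, hfs, hks s hs]
      ring
    rw [Finset.sum_neg_distrib] at h
    linarith
  have hl0 : S.loss .reflected T t ω (a.1, 0) = (T : ℝ)⁻¹ * ∑ s ∈ W, S.kst T s t * r s ^ 2 := by
    simp [loss, hr, hW]
  have hla : S.loss .reflected T t ω a = (T : ℝ)⁻¹ * ∑ s ∈ W, S.kst T s t * r s ^ 2
      + (T : ℝ)⁻¹ * ∑ s ∈ W, S.kst T s t * f s ^ 2 := by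
    have h : ∑ s ∈ W, S.kst T s t * (r s - f s) ^ 2 = ∑ s ∈ W, S.kst T s t * r s ^ 2
        + ∑ s ∈ W, S.kst T s t * f s ^ 2 - 2 * ∑ s ∈ W, S.kst T s t * (r s * f s) := by
      rw [Finset.mul_sum, ← Finset.sum_add_distrib, ← Finset.sum_sub_distrib]
      exact Finset.sum_congr rfl fun s _ => by ring
    rw [hcross] at h
    rw [← mul_add]
    change (T : ℝ)⁻¹ * ∑ s ∈ W, S.kst T s t * (r s - f s) ^ 2 = _
    rw [h]; ring
  have hpos : 0 ≤ (T : ℝ)⁻¹ * ∑ s ∈ W, S.kst T s t * f s ^ 2 :=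
    mul_nonneg (by positivity) (Finset.sum_nonneg fun s hs =>
      mul_nonneg (kst_nonneg hK hh hs) (sq_nonneg _))
  -- Without cross term, setting the slopes to zero cannot raise the loss and removes their penalty;
  -- minimality then makes that penalty zero.
  have hmin := ha (a.1, 0)
  unfold objective at hmin
  rw [hl0, hla] at hmin
  simp only [PiLp.zero_apply, mul_zero, abs_zero, Finset.sum_const_zero, add_zero] at hmin
  have hsum : ∑ j, |S.h T * a.2 j| ≤ 0 := by
    have : S.lam₂ T * ∑ j, |S.h T * a.2 j| ≤ S.lam₂ T * 0 := by linarith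
    exact le_of_mul_le_mul_left this hlam
  ext j
  have h1 := (Finset.sum_eq_zero_iff_of_nonneg (fun j _ => abs_nonneg _)).1
    (le_antisymm hsum (Finset.sum_nonneg fun j _ => abs_nonneg _)) j (Finset.mem_univ j)
  rw [abs_eq_zero] at h1
  simpa using (mul_eq_zero.1 h1).resolve_left hh.ne'

/-! ### The noise as normalized weighted sums of scores. -/

variable (S) in
/-- The normalized weight of the observation of date `u` in the noise around date `t`. -/
noncomputable def noiseWeight (sch : Scheme) (T : ℕ) (t : ℤ) (i : ℕ) (u : ℤ) : ℝ :=
  (2 * (S.k 0 + 1))⁻¹ * ∑ s ∈ (S.window sch T t).filter (fun s => sch.src t s = u),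
    S.k (((s : ℝ) - t) / (T * S.h T)) * (((s : ℝ) - t) / (T * S.h T)) ^ i

theorem k_zero_nonneg (hK : S.KernelCond) : 0 ≤ S.k 0 := (hK.1 0 (by simp)).1

/-- Positions are grouped by the actual date used there, so that the deviation bound for sums over
distinct dates applies also to reflected data. -/
theorem noise_eq (hK : S.KernelCond) (sch : Scheme) (T : ℕ) (t : ℤ) (ω : Ω) (i : ℕ)
    (j : Fin (S.p T + 1)) :
    S.noise sch T t ω i j = (2 * (S.k 0 + 1)) / (T * S.h T) *
      ∑ u ∈ Finset.Icc (1 : ℤ) T, S.noiseWeight sch T t i u * S.score T u j ω := by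
  have hk := k_zero_nonneg hK
  have hmaps : ∀ s ∈ S.window sch T t, sch.src t s ∈ Finset.Icc (1 : ℤ) T := fun s hs =>
    Finset.mem_Icc.2 (Finset.mem_filter.1 hs).2.2
  rw [noise, ← Finset.sum_fiberwise_of_maps_to hmaps, Finset.mul_sum, Finset.mul_sum]
  refine Finset.sum_congr rfl fun u _ => ?_
  rw [noiseWeight, Finset.mul_sum, Finset.mul_sum, Finset.sum_mul, Finset.mul_sum]
  refine Finset.sum_congr rfl fun s hs => ?_
  rw [(Finset.mem_filter.1 hs).2, kst, mul_inv, div_eq_mul_inv (2 * (S.k 0 + 1)), mul_inv]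
  have : (S.k 0 + 1) * (S.k 0 + 1)⁻¹ = 1 := mul_inv_cancel₀ (by positivity)
  linear_combination (-(T : ℝ)⁻¹ * (S.h T)⁻¹ * S.k (((s : ℝ) - t) / (T * S.h T)) *
    (((s : ℝ) - t) / (T * S.h T)) ^ i * S.score T u j ω) * this

theorem abs_noiseWeight_le (hK : S.KernelCond) (sch : Scheme) (T : ℕ) (t : ℤ) (i : ℕ) (u : ℤ) :
    |S.noiseWeight sch T t i u| ≤ 1 := by
  have hk := k_zero_nonneg hK
  -- A date serves at most itself and its mirror image. This is the `2` in the normalization; the `+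
  -- 1` keeps the divisor positive without a case distinction.
  have hcard : ((S.window sch T t).filter (fun s => sch.src t s = u)).card ≤ 2 := by
    refine (Finset.card_le_card (t := {u, 2 * t - u}) fun s hs => ?_).trans Finset.card_le_two
    have h := (Finset.mem_filter.1 hs).2
    rw [Finset.mem_insert, Finset.mem_singleton]
    rcases src_sub sch t s with h2 | h2 <;> omega
  rw [noiseWeight, abs_mul, abs_of_nonneg (by positivity), inv_mul_le_iff₀ (by positivity), mul_one]
  calc _ ≤ ∑ s ∈ (S.window sch T t).filter (fun s => sch.src t s = u), (S.k 0 + 1) := by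
        refine (Finset.abs_sum_le_sum_abs _ _).trans (Finset.sum_le_sum fun s hs => ?_)
        have h1 := abs_rel_le_one (Finset.mem_filter.1 hs).1
        have h2 := hK.1 _ (abs_le.1 h1)
        rw [abs_mul, abs_pow, abs_of_nonneg h2.1]
        calc _ ≤ S.k 0 * 1 := mul_le_mul h2.2.2 (pow_le_one₀ (abs_nonneg _) h1)
              (by positivity) hk
          _ ≤ _ := by linarith
    _ ≤ 2 * (S.k 0 + 1) := by
        rw [Finset.sum_const, nsmul_eq_mul]
        exact mul_le_mul_of_nonneg_right (by exact_mod_cast hcard) (by positivity)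

theorem noiseWeight_eq_zero {sch : Scheme} {T : ℕ} {t : ℤ} (i : ℕ) {u : ℤ}
    (h : ∀ s ∈ S.window sch T t, sch.src t s ≠ u) : S.noiseWeight sch T t i u = 0 := by
  rw [noiseWeight, Finset.filter_eq_empty_iff.2 h]
  simp

/-- At most `2⌊Th⌋ + 1 ≤ 3Th` dates carry a nonzero weight, each at most one in absolute value. -/
theorem sum_noiseWeight_sq_le (hK : S.KernelCond) {sch : Scheme} {T : ℕ} {t : ℤ} {i : ℕ}
    (hTh : 1 ≤ T * S.h T) :
    ∑ u ∈ Finset.Icc (1 : ℤ) T, S.noiseWeight sch T t i u ^ 2 ≤ 3 * (T * S.h T) := by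
  have hz : ∀ u, u ∉ Finset.Icc (t - S.halfWidth T) (t + S.halfWidth T) →
      S.noiseWeight sch T t i u = 0 := fun u hu => noiseWeight_eq_zero i fun s hs he => hu (by
    have h := Finset.mem_Icc.1 (Finset.mem_filter.1 hs).1
    rw [Finset.mem_Icc]
    rcases src_sub sch t s with h2 | h2 <;> omega)
  have hhw : 0 ≤ S.halfWidth T := Int.floor_nonneg.2 (by linarith)
  have hhw2 : ((S.halfWidth T : ℤ) : ℝ) ≤ T * S.h T := Int.floor_le _
  calc _ ≤ ∑ u ∈ Finset.Icc (1 : ℤ) T,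
        if u ∈ Finset.Icc (t - S.halfWidth T) (t + S.halfWidth T) then (1 : ℝ) else 0 := by
        refine Finset.sum_le_sum fun u _ => ?_
        split_ifs with h
        · rw [← sq_abs]; exact pow_le_one₀ (abs_nonneg _) (abs_noiseWeight_le hK sch T t i u)
        · rw [hz u h]; simp
    _ ≤ (Finset.Icc (t - S.halfWidth T) (t + S.halfWidth T)).card := by
        rw [← Finset.sum_filter, Finset.sum_const, nsmul_eq_mul, mul_one]
        exact_mod_cast Finset.card_le_card fun u hu => (Finset.mem_filter.1 hu).2
    _ = 2 * S.halfWidth T + 1 := by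
        rw [Int.card_Icc, show t + S.halfWidth T + 1 - (t - S.halfWidth T)
          = 2 * S.halfWidth T + 1 by ring]
        have : (((2 * S.halfWidth T + 1).toNat : ℤ)) = 2 * S.halfWidth T + 1 :=
          Int.toNat_of_nonneg (by omega)
        exact_mod_cast this
    _ ≤ _ := by linarith

theorem card_dates_le {sch : Scheme} {T : ℕ} (hh : 0 ≤ S.h T) : (S.dates T sch).card ≤ T := by
  calc _ ≤ (Finset.Icc (1 : ℤ) T).card := Finset.card_le_card fun t ht =>
        Finset.mem_Icc.2 (mem_Icc_of_mem_dates hh ht)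
    _ = T := by simp

variable [MeasurableSpace Ω] {μ : Measure Ω} [IsProbabilityMeasure μ]

/-- Deviations of the noise, simultaneously for all dates and regressors. -/
theorem noise_deviation (hS : S.IsMeasurable) (hM : S.Moments μ) (hD : S.MartingaleDiff μ)
    (hK : S.KernelCond) {C : ℝ} {N T : ℕ} (hN : 1 ≤ N) (hC0 : 0 < C)
    (hC2 : ∀ t : ℤ, 1 ≤ t → t ≤ T → ∀ j : Fin (S.p T + 1),
      Integrable (fun ω => |S.score T t j ω| ^ 2) μ ∧ ∫ ω, |S.score T t j ω| ^ 2 ∂μ ≤ C)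
    (hCN : ∀ t : ℤ, 1 ≤ t → t ≤ T → ∀ j : Fin (S.p T + 1),
      Integrable (fun ω => |S.score T t j ω| ^ N) μ ∧ ∫ ω, |S.score T t j ω| ^ N ∂μ ≤ C)
    (sch : Scheme) (hh : 0 < S.h T) (hTh : 1 ≤ T * S.h T) {q : ℕ} (hq : 1 ≤ q) {D θ x : ℝ}
    (hD0 : 0 < D) (hθ0 : 0 ≤ θ) (hθ : θ * (q * D) ≤ 1) :
    μ {ω | ¬ ∀ t ∈ S.dates T sch, ∀ i < 2, ∀ j,
        |S.noise sch T t ω i j| ≤ 2 * (S.k 0 + 1) / (T * S.h T) * (2 * x)}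
      ≤ 2 * (T * ENNReal.ofReal (S.mixCoef μ (q + 1)) + (T * 2 * (S.p T + 1) : ℕ) *
        ENNReal.ofReal (2 * Real.exp (-θ * x + (θ ^ 2 * (3 * (T * S.h T) * C) + T * (C / D ^ N)))))
        + (T * (S.p T + 1) : ℕ) * ENNReal.ofReal (C / D ^ N) := by
  have hk := k_zero_nonneg hK
  have hTh0 : 0 < T * S.h T := by linarith
  have h := score_deviation hS hM hD hN hC0 hC2 hCN
    (ι := {t // t ∈ S.dates T sch} × Fin 2) (a := fun i u => S.noiseWeight sch T i.1 i.2 u)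
    (fun i u => abs_noiseWeight_le hK sch T _ _ u)
    (fun i u hu => noiseWeight_eq_zero _ fun s hs he => hu (by
      rw [← he]; exact Finset.mem_Icc.2 (Finset.mem_filter.1 hs).2.2))
    hq (V := 3 * (T * S.h T)) (x := x) (fun i => sum_noiseWeight_sq_le hK hTh) hD0 hθ0 hθ
  have hcard : Fintype.card ({t // t ∈ S.dates T sch} × Fin 2) ≤ T * 2 := by
    rw [Fintype.card_prod, Fintype.card_fin, Fintype.card_coe]
    exact Nat.mul_le_mul_right _ (card_dates_le hh.le)
  refine le_trans (measure_mono fun ω hω => ?_) (h.trans ?_)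
  · simp only [Set.mem_ofPred_eq] at hω ⊢
    push Not at hω
    obtain ⟨t, ht, i, hi, j, hj⟩ := hω
    refine ⟨(⟨t, ht⟩, ⟨i, hi⟩), j, ?_⟩
    have hc : 0 < 2 * (S.k 0 + 1) / (T * S.h T) := by positivity
    rw [noise_eq hK, abs_mul, abs_of_pos hc] at hj
    exact lt_of_mul_lt_mul_left hj hc.le
  · gcongr

end Setting

/-! ### Consequences of the rate conditions. -/

namespace Setting

variable {Ω : Type u} {S : Setting Ω}

theorem Rates.tendsto {δ₁ δ₂ r : ℝ} (hR : S.Rates δ₁ δ₂ r) :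
    Tendsto (fun T : ℕ => S.d T * S.h T ^ 2 * (S.lam₁ T)⁻¹) atTop (𝓝 0) ∧
    Tendsto (fun T : ℕ => S.d T * (S.h T ^ 2)⁻¹ * S.lam₁ T ^ 2) atTop (𝓝 0) ∧
    Tendsto (fun T : ℕ => S.d T * √(S.lam₁ T)) atTop (𝓝 0) ∧
    Tendsto (fun T : ℕ => √(Real.log (S.h T)⁻¹ / (T * S.h T)) * (S.lam₁ T)⁻¹) atTop (𝓝 0) := by
  obtain ⟨-, -, -, -, hlam, h⟩ := hR
  have h1 : ∀ T : ℕ, 0 ≤ S.d T * S.h T ^ 2 * (S.lam₁ T)⁻¹ := fun T =>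
    mul_nonneg (by positivity) (inv_nonneg.2 (hlam T).1.le)
  have h2 : ∀ T : ℕ, 0 ≤ S.d T * (S.h T ^ 2)⁻¹ * S.lam₁ T ^ 2 := fun T => by positivity
  have h3 : ∀ T : ℕ, 0 ≤ S.d T * √(S.lam₁ T) := fun T => by positivity
  have h4 : ∀ T : ℕ, 0 ≤ √(Real.log (S.h T)⁻¹ / (T * S.h T)) * (S.lam₁ T)⁻¹ := fun T =>
    mul_nonneg (by positivity) (inv_nonneg.2 (hlam T).1.le)
  refine ⟨squeeze_zero h1 (fun T => ?_) h, squeeze_zero h2 (fun T => ?_) h,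
    squeeze_zero h3 (fun T => ?_) h, squeeze_zero h4 (fun T => ?_) h⟩ <;>
  linarith [h1 T, h2 T, h3 T, h4 T]

theorem Rates.h_pos {δ₁ δ₂ r : ℝ} (hR : S.Rates δ₁ δ₂ r) {T : ℕ} (hT : 0 < T) : 0 < S.h T := by
  obtain ⟨-, -, ⟨c, hc, hh⟩, -⟩ := hR
  have hT' : (0 : ℝ) < T := by exact_mod_cast hT
  rw [hh]; positivity

/-- Since `h` is a negative power of `T`, `log h⁻¹` is eventually at least `(δ₂ / 2) log T`; the
rest is the square of the last rate condition. -/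
theorem Rates.tendsto_log {δ₁ δ₂ r : ℝ} (hR : S.Rates δ₁ δ₂ r) (hδ₂ : 0 < δ₂) :
    Tendsto (fun T : ℕ => Real.log T / (S.lam₁ T ^ 2 * (T * S.h T))) atTop (𝓝 0) := by
  have h4 := hR.tendsto.2.2.2
  have hpos := fun T (hT : 0 < T) => hR.h_pos hT
  obtain ⟨-, -, ⟨c, hc, hh⟩, -, hlam, -⟩ := hR
  have hlog : Tendsto (fun T : ℕ => Real.log T) atTop atTop :=
    Real.tendsto_log_atTop.comp tendsto_natCast_atTop_atTop
  have hsq := (h4.pow 2).const_mul (2 / δ₂)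
  rw [zero_pow two_ne_zero, mul_zero] at hsq
  have hev : ∀ᶠ T : ℕ in atTop, 2 * Real.log c / δ₂ ≤ Real.log T ∧ 0 ≤ Real.log T ∧ 0 < T :=
    (hlog.eventually_ge_atTop _).and ((hlog.eventually_ge_atTop _).and (eventually_gt_atTop 0))
  refine tendsto_of_tendsto_of_tendsto_of_le_of_le' tendsto_const_nhds hsq ?_ ?_
  · filter_upwards [hev] with T ⟨_, hT, hT0⟩
    have := hpos T hT0
    positivity
  · filter_upwards [hev] with T ⟨hT1, hT, hT0⟩
    have hT' : (0 : ℝ) < T := by exact_mod_cast hT0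
    have hp := hpos T hT0
    have hl := (hlam T).1
    have hle : δ₂ / 2 * Real.log T ≤ Real.log (S.h T)⁻¹ := by
      rw [Real.log_inv, hh, Real.log_mul hc.ne' (by positivity), Real.log_rpow hT']
      rw [div_le_iff₀ hδ₂] at hT1
      linarith
    have hL0 : 0 ≤ Real.log (S.h T)⁻¹ := le_trans (by positivity) hle
    rw [mul_pow, Real.sq_sqrt (by positivity), inv_pow, ← div_eq_mul_inv, div_div,
      mul_comm (S.lam₁ T ^ 2), ← mul_div_assoc]
    refine div_le_div_of_nonneg_right ?_ (by positivity)
    rw [div_mul_eq_mul_div, le_div_iff₀ hδ₂]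
    linarith

/-- Eventually `λ₁ ≤ h` and `1 ≤ λ₁² T h`. Hence `1 ≤ h² · T h`, that is `T² ≤ (T h)³`, and `(λ₁ T
h)² ≥ T h`. -/
theorem Rates.rpow_le {δ₁ δ₂ r : ℝ} (hR : S.Rates δ₁ δ₂ r) (hδ₂ : 0 < δ₂) :
    ∀ᶠ T : ℕ in atTop, (T : ℝ) ^ (2 / 3 : ℝ) ≤ T * S.h T ∧
      (T : ℝ) ^ (1 / 3 : ℝ) ≤ S.lam₁ T * (T * S.h T) := by
  have hlog : Tendsto (fun T : ℕ => Real.log T) atTop atTop :=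
    Real.tendsto_log_atTop.comp tendsto_natCast_atTop_atTop
  filter_upwards [(hR.tendsto_log hδ₂).eventually_le_const one_pos,
    hR.tendsto.2.1.eventually_le_const one_pos, hR.1, hlog.eventually_ge_atTop 1,
    eventually_gt_atTop 0] with T h1 h2 h3 h4 h5
  have hT' : (0 : ℝ) < T := by exact_mod_cast h5
  have hh := hR.h_pos h5
  obtain ⟨-, -, -, -, hlam, -⟩ := hR
  have hl := (hlam T).1
  have hd : (1 : ℝ) ≤ S.d T := by exact_mod_cast h3.1
  rw [div_le_one (by positivity)] at h1
  have h6 : S.lam₁ T ^ 2 ≤ S.h T ^ 2 := by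
    have h7 : (S.h T ^ 2)⁻¹ * S.lam₁ T ^ 2 ≤ 1 := by
      refine le_trans ?_ h2
      rw [mul_assoc]
      exact le_mul_of_one_le_left (by positivity) hd
    rwa [inv_mul_le_iff₀ (by positivity), mul_one] at h7
  have h8 : 1 ≤ S.h T ^ 2 * (T * S.h T) :=
    h4.trans (h1.trans (mul_le_mul_of_nonneg_right h6 (by positivity)))
  have h9 : (T : ℝ) ^ (2 / 3 : ℝ) ≤ T * S.h T := by
    have h10 : (T : ℝ) ^ 2 ≤ (T * S.h T) ^ 3 := by nlinarith [sq_nonneg (T : ℝ)]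
    refine le_of_pow_le_pow_left₀ three_ne_zero (by positivity) ?_
    rw [← Real.rpow_natCast, ← Real.rpow_mul hT'.le]
    norm_num
    exact h10
  refine ⟨h9, ?_⟩
  refine le_of_pow_le_pow_left₀ two_ne_zero (by positivity) ?_
  rw [← Real.rpow_natCast, ← Real.rpow_mul hT'.le]
  norm_num
  refine h9.trans ?_
  have h10 : 1 ≤ S.lam₁ T ^ 2 * (T * S.h T) := h4.trans h1
  nlinarith [mul_pos hT' hh]

theorem Rates.card_le {δ₁ δ₂ r : ℝ} (hδ₁ : 0 ≤ δ₁) (hR : S.Rates δ₁ δ₂ r) :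
    ∃ c : ℝ, 0 < c ∧ ∀ᶠ T : ℕ in atTop, (S.p T + 1 : ℝ) ≤ c * (T : ℝ) ^ δ₁ := by
  obtain ⟨-, ⟨c, hc, hp⟩, -⟩ := hR
  refine ⟨c + 1, by positivity, ?_⟩
  filter_upwards [hp, eventually_ge_atTop 1] with T h1 h2
  have : 1 ≤ (T : ℝ) ^ δ₁ := Real.one_le_rpow (by exact_mod_cast h2) hδ₁
  linarith

/-- The rates at which the stochastic and the approximation parts of the error vanish. -/
theorem Rates.tendsto_sqrt_mul {δ₁ δ₂ r : ℝ} (hR : S.Rates δ₁ δ₂ r) :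
    Tendsto (fun T : ℕ => √(S.d T) * S.lam₁ T) atTop (𝓝 0) ∧
    ∀ᶠ T in atTop, S.lam₁ T ≤ √(S.d T) * S.lam₁ T := by
  have h3 := hR.tendsto.2.2.1
  obtain ⟨hd, -, -, -, hlam, -⟩ := hR
  have hd' : ∀ᶠ T in atTop, (1 : ℝ) ≤ S.d T := hd.mono fun T h => by exact_mod_cast h.1
  constructor
  -- For `d ≥ 1`, `√d λ₁ ≤ d² λ₁ = (d √λ₁)²`.
  · have hsq := h3.pow 2
    rw [zero_pow two_ne_zero] at hsq
    refine tendsto_of_tendsto_of_tendsto_of_le_of_le' tendsto_const_nhds hsq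
      (Eventually.of_forall fun T => mul_nonneg (by positivity) (hlam T).1.le) ?_
    filter_upwards [hd'] with T hT
    rw [mul_pow, Real.sq_sqrt (hlam T).1.le]
    refine mul_le_mul_of_nonneg_right ?_ (hlam T).1.le
    refine Real.sqrt_le_iff.2 ⟨by positivity, ?_⟩
    nlinarith [sq_nonneg ((S.d T : ℝ) - 1), mul_nonneg (sub_nonneg.2 hT) (sq_nonneg (S.d T : ℝ)),
      pow_le_pow_right₀ hT (by norm_num : 1 ≤ 4), pow_le_pow_right₀ hT (by norm_num : 2 ≤ 4)]
  · filter_upwards [hd'] with T hT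
    exact le_mul_of_one_le_left (hlam T).1.le (Real.one_le_sqrt.2 hT)

/-! ### Uniform control of the noise. -/

section Probability

variable [MeasurableSpace Ω] {μ : Measure Ω} [IsProbabilityMeasure μ]

/-- Coefficients at most one only grow when raised to the power `δ / (1 + δ) ≤ 1`, and summable
terms tend to zero. -/
theorem Mixing.tendsto (hS : S.IsMeasurable) (hmix : S.Mixing μ) :
    Tendsto (fun l : ℕ => (l : ℝ) ^ 4 * S.mixCoef μ l) atTop (𝓝 0) := by
  obtain ⟨δ, hδ, h⟩ := hmix
  refine squeeze_zero (fun l => mul_nonneg (by positivity) (mixCoef_nonneg l)) (fun l => ?_)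
    h.tendsto_atTop_zero
  refine mul_le_mul_of_nonneg_left ?_ (by positivity)
  have h1 := Real.rpow_le_rpow_of_exponent_ge' (mixCoef_nonneg (S := S) (μ := μ) l)
    (mixCoef_le_one hS l) (by positivity : 0 ≤ δ / (1 + δ))
    (div_le_one_of_le₀ (by linarith) (by positivity) : δ / (1 + δ) ≤ 1)
  rwa [Real.rpow_one] at h1

/-- The noise is uniformly smaller than any multiple of the penalty parameter. -/
theorem noise_tendsto {δ₁ δ₂ r ψ : ℝ} (hδ₁ : 0 ≤ δ₁) (hδ₂ : 0 < δ₂) (hS : S.IsMeasurable)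
    (hmix : S.Mixing μ) (hM : S.Moments μ) (hD : S.MartingaleDiff μ) (hK : S.KernelCond)
    {N : ℕ} (hN : 24 * (3 + δ₁) ≤ N) (hψ : (N : ℝ) ≤ ψ) (hP : S.ProductMoments μ ψ)
    (hR : S.Rates δ₁ δ₂ r) (sch : Scheme) {η : ℝ} (hη : 0 < η) :
    Tendsto (fun T => μ {ω | ¬ ∀ t ∈ S.dates T sch, ∀ i < 2, ∀ j,
      |S.noise sch T t ω i j| ≤ η * S.lam₁ T}) atTop (𝓝 0) := by
  obtain ⟨C, hC0, hC⟩ := score_moments hS hP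
  obtain ⟨c, hc, hp⟩ := hR.card_le hδ₁
  have hk := k_zero_nonneg hK
  have hN2 : (2 : ℝ) ≤ N := by linarith
  have hN1 : 1 ≤ N := by
    have : (1 : ℝ) ≤ N := by linarith
    exact_mod_cast this
  -- With `T ≤ (q + 1)⁴`, the decoupling cost `T β*(q + 1)` is at most `(q + 1)⁴ β*(q + 1) → 0`.
  set q : ℕ → ℕ := fun T => ⌈(T : ℝ) ^ (1 / 4 : ℝ)⌉₊ with hq
  -- Chosen so that the deviation `2x` with `x = λ₁ T h / g` corresponds to noise of size `η λ₁`.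
  set g : ℝ := 4 * (S.k 0 + 1) / η with hg
  have hg0 : 0 < g := by positivity
  set K : ℝ := 3 + δ₁ with hKdef
  have hK0 : 0 < K := by positivity
  have hlog : Tendsto (fun T : ℕ => Real.log T) atTop atTop :=
    Real.tendsto_log_atTop.comp tendsto_natCast_atTop_atTop
  have hqtop : Tendsto (fun T => q T + 1) atTop atTop := by
    refine (tendsto_add_atTop_nat 1).comp ((tendsto_nat_ceil_atTop (α := ℝ)).comp ?_)
    exact (tendsto_rpow_atTop (by norm_num : (0 : ℝ) < 1 / 4)).comp tendsto_natCast_atTop_atTop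
  have hbound : Tendsto (fun T : ℕ => ENNReal.ofReal
      (2 * (((q T + 1 : ℕ) : ℝ) ^ 4 * S.mixCoef μ (q T + 1))
        + (8 * c * Real.exp C + c * C) * (T : ℝ)⁻¹)) atTop (𝓝 0) := by
    have h1 := ((hmix.tendsto hS).comp hqtop).const_mul 2
    have h2 := (tendsto_inv_atTop_zero.comp (tendsto_natCast_atTop_atTop (R := ℝ))).const_mul
      (8 * c * Real.exp C + c * C)
    have h3 := ENNReal.tendsto_ofReal (h1.add h2)
    rw [mul_zero, mul_zero, add_zero, ENNReal.ofReal_zero] at h3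
    exact h3
  have hsmall1 : ∀ᶠ T : ℕ in atTop, 3 * C * K ^ 2 * g ^ 2 *
      (Real.log T / (S.lam₁ T ^ 2 * (T * S.h T))) ≤ 1 := by
    have h := (hR.tendsto_log hδ₂).const_mul (3 * C * K ^ 2 * g ^ 2)
    rw [mul_zero] at h
    exact h.eventually_le_const one_pos
  have hsmall2 : ∀ᶠ T : ℕ in atTop,
      2 * K * g * (Real.log T / (T : ℝ) ^ (1 / 24 : ℝ)) ≤ 1 := by
    have h := ((isLittleO_log_rpow_atTop (by norm_num : (0 : ℝ) < 1 / 24)).tendsto_div_nhds_zero.comp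
      tendsto_natCast_atTop_atTop).const_mul (2 * K * g)
    rw [mul_zero] at h
    exact h.eventually_le_const one_pos
  refine tendsto_of_tendsto_of_tendsto_of_le_of_le' tendsto_const_nhds hbound
    (Eventually.of_forall fun T => zero_le) ?_
  filter_upwards [hp, hR.rpow_le hδ₂, hsmall1, hsmall2, hlog.eventually_ge_atTop 1,
    eventually_gt_atTop 0] with T hpT hrT hs1 hs2 hL hT
  have hT' : (0 : ℝ) < T := by exact_mod_cast hT
  have hT1 : (1 : ℝ) ≤ T := by exact_mod_cast hT
  have hh := hR.h_pos hT
  have hl : 0 < S.lam₁ T := (hR.2.2.2.2.1 T).1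
  have hTh : 1 ≤ T * S.h T := (Real.one_le_rpow hT1 (by norm_num)).trans hrT.1
  have hTh0 : 0 < T * S.h T := by linarith
  have hq0 : (T : ℝ) ^ (1 / 4 : ℝ) ≤ q T := Nat.le_ceil _
  have hq1 : (1 : ℝ) ≤ (T : ℝ) ^ (1 / 4 : ℝ) := Real.one_le_rpow hT1 (by norm_num)
  have hq2 : (q T : ℝ) ≤ 2 * (T : ℝ) ^ (1 / 4 : ℝ) := by
    have : (q T : ℝ) < (T : ℝ) ^ (1 / 4 : ℝ) + 1 := Nat.ceil_lt_add_one (by positivity)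
    linarith
  have hq1' : 1 ≤ q T := by exact_mod_cast hq1.trans hq0
  set L := Real.log T with hLdef
  -- As `1/4 + 1/24 < 1/3`, `q D` stays below `λ₁ T h` with a spare factor `T ^ (1/24)` for the
  -- logarithm, while `N ≥ 24(3 + δ₁)` makes `D ^ N ≥ T ^ (3 + δ₁)`.
  set D : ℝ := (T : ℝ) ^ (1 / 24 : ℝ) with hDdef
  have hD0 : 0 < D := by positivity
  set x : ℝ := S.lam₁ T * (T * S.h T) / g with hx
  have hx0 : 0 < x := by positivity
  -- Makes `exp (-θ x) = T ^ (-(3 + δ₁))`.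
  set θ : ℝ := K * L / x with hθdef
  have hθ0 : 0 ≤ θ := by positivity
  have hθx : θ * x = K * L := by rw [hθdef]; field_simp
  have hθB : θ * (q T * D) ≤ 1 := by
    refine le_trans ?_ hs2
    have h1 : θ ≤ K * L * g / (T : ℝ) ^ (1 / 3 : ℝ) := by
      rw [hθdef, hx, div_div_eq_mul_div]
      exact div_le_div_of_nonneg_left (by positivity) (by positivity) hrT.2
    have h2 : q T * D ≤ 2 * ((T : ℝ) ^ (1 / 4 : ℝ) * D) := by
      rw [← mul_assoc]; exact mul_le_mul_of_nonneg_right hq2 hD0.le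
    have h3 : (T : ℝ) ^ (1 / 3 : ℝ) = (T : ℝ) ^ (1 / 4 : ℝ) * D * D := by
      rw [hDdef, ← Real.rpow_add hT', ← Real.rpow_add hT']; norm_num
    calc _ ≤ K * L * g / (T : ℝ) ^ (1 / 3 : ℝ) * (2 * ((T : ℝ) ^ (1 / 4 : ℝ) * D)) := by
          gcongr
      _ = _ := by rw [h3]; field_simp
  have hDN : C / D ^ N ≤ C * (T : ℝ) ^ (-(3 + δ₁)) := by
    rw [Real.rpow_neg hT'.le, ← div_eq_mul_inv]
    refine div_le_div_of_nonneg_left hC0.le (by positivity) ?_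
    rw [hDdef, ← Real.rpow_natCast, ← Real.rpow_mul hT'.le]
    exact Real.rpow_le_rpow_of_exponent_le hT1 (by linarith)
  -- The variance term costs at most one factor `T` and the truncation term a constant; the power
  -- left beats the `O(T ^ (1 + δ₁))` events of the union bound.
  have hexp : Real.exp (-θ * x + (θ ^ 2 * (3 * (T * S.h T) * C) + T * (C / D ^ N)))
      ≤ Real.exp C * (T : ℝ) ^ (-(2 + δ₁)) := by
    have h1 : θ ^ 2 * (3 * (T * S.h T) * C) ≤ L := by
      have h2 : θ ^ 2 * (3 * (T * S.h T) * C)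
          = 3 * C * K ^ 2 * g ^ 2 * (L / (S.lam₁ T ^ 2 * (T * S.h T))) * L := by
        rw [hθdef, hx]; field_simp
      rw [h2]
      exact mul_le_of_le_one_left (by linarith) hs1
    have h3 : T * (C / D ^ N) ≤ C := by
      calc _ ≤ T * (C * (T : ℝ) ^ (-(3 + δ₁))) := by gcongr
        _ = C * (T : ℝ) ^ (1 + -(3 + δ₁)) := by
          rw [Real.rpow_add hT', Real.rpow_one]; ring
        _ ≤ C * 1 := by
          gcongr
          exact Real.rpow_le_one_of_one_le_of_nonpos hT1 (by linarith)
        _ = C := mul_one C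
    rw [Real.rpow_def_of_pos hT', ← Real.exp_add, Real.exp_le_exp, neg_mul, hθx, hKdef]
    linarith
  have hdev := noise_deviation hS hM hD hK hN1 hC0
    (fun t h1 h2 j => hC 2 (by push_cast; linarith) T t h1 h2 j)
    (fun t h1 h2 j => hC N hψ T t h1 h2 j) sch hh hTh hq1' hD0 hθ0 hθB (x := x)
  have hlevel : 2 * (S.k 0 + 1) / (T * S.h T) * (2 * x) = η * S.lam₁ T := by
    rw [hx, hg]; field_simp; ring
  rw [hlevel] at hdev
  refine hdev.trans ?_
  have hmn := mixCoef_nonneg (S := S) (μ := μ) (q T + 1)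
  rw [← ENNReal.ofReal_natCast T, ← ENNReal.ofReal_natCast (T * 2 * (S.p T + 1)),
    ← ENNReal.ofReal_natCast (T * (S.p T + 1)), ← ENNReal.ofReal_mul (by positivity),
    ← ENNReal.ofReal_mul (by positivity), ← ENNReal.ofReal_mul (by positivity),
    ← ENNReal.ofReal_add (by positivity) (by positivity),
    show (2 : ENNReal) = ENNReal.ofReal 2 by simp, ← ENNReal.ofReal_mul (by positivity),
    ← ENNReal.ofReal_add (by positivity) (by positivity)]
  refine ENNReal.ofReal_le_ofReal ?_
  push_cast
  have hTq : (T : ℝ) ≤ ((q T : ℝ) + 1) ^ 4 := by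
    calc (T : ℝ) = ((T : ℝ) ^ (1 / 4 : ℝ)) ^ 4 := by
          rw [← Real.rpow_natCast, ← Real.rpow_mul hT'.le]; norm_num
      _ ≤ _ := pow_le_pow_left₀ (by positivity) (by linarith) 4
  have e1 : (T : ℝ) * S.mixCoef μ (q T + 1) ≤ ((q T : ℝ) + 1) ^ 4 * S.mixCoef μ (q T + 1) :=
    mul_le_mul_of_nonneg_right hTq hmn
  have e2 : (T : ℝ) * 2 * ((S.p T : ℝ) + 1) *
      (2 * Real.exp (-θ * x + (θ ^ 2 * (3 * (T * S.h T) * C) + T * (C / D ^ N))))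
      ≤ 4 * c * Real.exp C * (T : ℝ)⁻¹ := by
    calc _ ≤ (T : ℝ) * 2 * (c * (T : ℝ) ^ δ₁) *
          (2 * (Real.exp C * (T : ℝ) ^ (-(2 + δ₁)))) := by gcongr
      _ = 4 * c * Real.exp C * ((T : ℝ) ^ (1 : ℝ) * (T : ℝ) ^ δ₁ * (T : ℝ) ^ (-(2 + δ₁))) := by
          rw [Real.rpow_one]; ring
      _ = _ := by
          rw [← Real.rpow_add hT', ← Real.rpow_add hT', ← Real.rpow_neg_one]
          congr 2; ring
  have e3 : (T : ℝ) * ((S.p T : ℝ) + 1) * (C / D ^ N) ≤ c * C * (T : ℝ)⁻¹ := by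
    calc _ ≤ (T : ℝ) * (c * (T : ℝ) ^ δ₁) * (C * (T : ℝ) ^ (-(3 + δ₁))) := by gcongr
      _ = c * C * ((T : ℝ) ^ (1 : ℝ) * (T : ℝ) ^ δ₁ * (T : ℝ) ^ (-(3 + δ₁))) := by
          rw [Real.rpow_one]; ring
      _ = c * C * (T : ℝ) ^ (-2 : ℝ) := by
          rw [← Real.rpow_add hT', ← Real.rpow_add hT']
          congr 2; ring
      _ ≤ c * C * (T : ℝ) ^ (-1 : ℝ) := by
          exact mul_le_mul_of_nonneg_left
            (Real.rpow_le_rpow_of_exponent_le hT1 (by norm_num)) (by positivity)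
      _ = _ := by rw [Real.rpow_neg_one]
  linarith

end Probability

end Setting

/-! ### The error bound at one date, consistency and rates. -/

namespace Setting

variable {Ω : Type u} {S : Setting Ω}

/-- The error bound of the penalized local linear estimator at one date. -/
theorem exists_pairNorm_err_le {m M δ ρ₁ : ℝ} (hm : 0 < m) (hM : 0 ≤ M) (hδ : 0 < δ)
    (hρ : 0 < ρ₁) (hMm : M < (1 + 2 * δ) * m) :
    ∃ η K : ℝ, 0 < η ∧ 0 < K ∧ ∀ {Ω : Type u} (S : Setting Ω) (sch : Scheme) (T : ℕ) (t : ℤ)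
      (ω : Ω) (a b : S.Coef T × S.Coef T) (ρ₂ c r : ℝ), S.KernelCond → 0 < T → 0 < S.h T →
      0 < S.lam₁ T → S.lam₂ T = r * S.lam₁ T →
      (∀ v ∈ S.cone T δ, ρ₁ ≤ S.gram sch T t ω v ∧ S.gram sch T t ω v ≤ ρ₂) →
      S.objective sch T t ω a ≤ S.objective sch T t ω b →
      (∀ i < 2, ∀ j, |S.noise sch T t ω i j| ≤ η * S.lam₁ T) →
      m * S.offNorm T (S.err T a b) - M * S.onNorm T (S.err T a b)
        ≤ (∑ j, |a.1 j| - ∑ j, |b.1 j|) + r * (∑ j, |S.h T * a.2 j| - ∑ j, |S.h T * b.2 j|) →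
      S.biasSq sch T t ω b ≤ c →
      S.pairNorm T (S.err T a b) ≤ K * (√(S.d T) * S.lam₁ T + c / S.lam₁ T) := by
  obtain ⟨η, K, hη, hK, h⟩ := lasso_error_bound hm hM hδ hρ hMm
  refine ⟨η, K, hη, hK, ?_⟩
  intro Ω S sch T t ω a b ρ₂ c r hker hT hh hlam hlam2 hRE hobj hnoise hpen hbias
  have hb0 : 0 ≤ S.biasSq sch T t ω b :=
    mul_nonneg (by positivity) (Finset.sum_nonneg fun s hs =>
      mul_nonneg (kst_nonneg hker hh hs) (sq_nonneg _))
  have hbasic := basic_inequality hker hT hh hobj (κ := η * S.lam₁ T)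
    fun j => ⟨hnoise 0 (by norm_num) j, hnoise 1 (by norm_num) j⟩
  refine h (S.lam₁ T) (S.d T) (S.onNorm T (S.err T a b)) (S.offNorm T (S.err T a b)) _
    (S.gram sch T t ω (S.err T a b)) c hlam (Nat.cast_nonneg _) (onNorm_nonneg T _)
    (offNorm_nonneg T _) (Real.sqrt_nonneg _) (hb0.trans hbias) (pairNorm_le T _) (onNorm_le T _)
    (fun ho => (gram_bounds hRE ho).1) (gram_nonneg hker hh ω _) ?_
  rw [hlam2] at hbasic
  have hp := mul_le_mul_of_nonneg_left hpen hlam.le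
  linarith

theorem coe_sup_nnnorm_le {ι E : Type*} [SeminormedAddCommGroup E] (s : Finset ι) (f : ι → E)
    {x : ℝ} (hx : 0 ≤ x) (h : ∀ i ∈ s, ‖f i‖ ≤ x) : ((s.sup fun i => ‖f i‖₊ : NNReal) : ℝ) ≤ x := by
  lift x to NNReal using hx
  exact_mod_cast Finset.sup_le fun i hi => by exact_mod_cast h i hi

variable [MeasurableSpace Ω] {μ : Measure Ω} [IsProbabilityMeasure μ]

omit [IsProbabilityMeasure μ] in
/-- With probability approaching one, at every date the quadratic form is well behaved on the cone,
the noise is small, and the estimator minimizes the criterion. -/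
theorem regular_tendsto {sch : Scheme} {γ : (T : ℕ) → ℤ → Ω → S.Coef T × S.Coef T} {δ ρ₁ ρ₂ η : ℝ}
    (hRE : Tendsto (fun T => μ {ω | ¬ ∀ t ∈ S.dates T sch, ∀ v ∈ S.cone T δ,
      ρ₁ ≤ S.gram sch T t ω v ∧ S.gram sch T t ω v ≤ ρ₂}) atTop (𝓝 0))
    (hnoise : Tendsto (fun T => μ {ω | ¬ ∀ t ∈ S.dates T sch, ∀ i < 2, ∀ j,
      |S.noise sch T t ω i j| ≤ η * S.lam₁ T}) atTop (𝓝 0))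
    (hγ : S.IsEstimator μ sch γ) :
    Tendsto (fun T => μ {ω | ¬ ∀ t ∈ S.dates T sch,
      (∀ v ∈ S.cone T δ, ρ₁ ≤ S.gram sch T t ω v ∧ S.gram sch T t ω v ≤ ρ₂) ∧
      (∀ i < 2, ∀ j, |S.noise sch T t ω i j| ≤ η * S.lam₁ T) ∧
      ∀ b, S.objective sch T t ω (γ T t ω) ≤ S.objective sch T t ω b}) atTop (𝓝 0) := by
  have hsum := hRE.add hnoise
  rw [add_zero] at hsum
  refine tendsto_of_tendsto_of_tendsto_of_le_of_le tendsto_const_nhds hsum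
    (fun T => zero_le) fun T => ?_
  -- Finitely many dates, so the almost sure minimization holds at all of them simultaneously.
  have hest : μ {ω | ¬ ∀ t ∈ S.dates T sch, ∀ b,
      S.objective sch T t ω (γ T t ω) ≤ S.objective sch T t ω b} = 0 :=
    ae_iff.1 ((Finset.eventually_all _).2 (hγ T))
  refine (measure_mono (t := ({ω | ¬ ∀ t ∈ S.dates T sch, ∀ v ∈ S.cone T δ,
      ρ₁ ≤ S.gram sch T t ω v ∧ S.gram sch T t ω v ≤ ρ₂} ∪
      {ω | ¬ ∀ t ∈ S.dates T sch, ∀ i < 2, ∀ j, |S.noise sch T t ω i j| ≤ η * S.lam₁ T}) ∪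
      {ω | ¬ ∀ t ∈ S.dates T sch, ∀ b,
        S.objective sch T t ω (γ T t ω) ≤ S.objective sch T t ω b}) fun ω hω => ?_).trans
      ((measure_union_le _ _).trans ?_)
  · by_contra hcon
    simp only [Set.mem_union, Set.mem_ofPred_eq, not_or, not_not] at hcon
    exact hω fun t ht => ⟨hcon.1.1 t ht, hcon.1.2 t ht, hcon.2 t ht⟩
  · rw [hest, add_zero]
    exact measure_union_le _ _

/-- Uniform consistency of the estimated levels. -/
theorem consistency {δ₁ δ₂ r ψ δ : ℝ} (hδ₁ : 0 ≤ δ₁) (hδ₂ : 0 < δ₂) (hS : S.IsMeasurable)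
    (hsp : S.Sparse) (hmix : S.Mixing μ) (hM : S.Moments μ) (hsm : S.SmoothWeights)
    (hD : S.MartingaleDiff μ) (hK : S.KernelCond)
    {N : ℕ} (hN : 24 * (3 + δ₁) ≤ N) (hψ : (N : ℝ) ≤ ψ) (hP : S.ProductMoments μ ψ)
    (hδ : 0 < δ) {sch : Scheme} (hRE : S.RestrictedEigenvalues μ sch δ) (hR : S.Rates δ₁ δ₂ r)
    (hr : sch = .twoSided → 1 < (1 + 2 * δ) * r)
    {γ : (T : ℕ) → ℤ → Ω → S.Coef T × S.Coef T} (hγ : S.IsEstimator μ sch γ) :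
    TendstoInMeasure μ (S.maxErr sch γ) atTop (fun _ => 0) := by
  obtain ⟨ρ₁, ρ₂, hρ₁, hρ₁₂, hRE⟩ := hRE
  obtain ⟨hsm, B, hB⟩ := hsm
  have hr0 : 0 < r := hR.2.2.2.1
  -- The off-support gain against zero target slopes, with on-support loss `M = 1`: `min 1 r` in
  -- general, and `1` for reflected data, where there is no slope error.
  obtain ⟨m, hm0, hm1, hmr, hMm⟩ : ∃ m : ℝ, 0 < m ∧ m ≤ 1 ∧ (m ≤ r ∨ sch = .reflected) ∧
      1 < (1 + 2 * δ) * m := by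
    cases sch
    · refine ⟨min 1 r, lt_min one_pos hr0, min_le_left _ _, Or.inl (min_le_right _ _), ?_⟩
      rcases min_choice 1 r with h | h <;> rw [h]
      · linarith
      · exact hr rfl
    · exact ⟨1, one_pos, le_rfl, Or.inr rfl, by linarith⟩
  obtain ⟨η, K, hη, hK0, hbound⟩ := exists_pairNorm_err_le.{u} hm0 zero_le_one hδ hρ₁ hMm
  have hnoise := noise_tendsto hδ₁ hδ₂ hS hmix hM hD hK hN hψ hP hR sch hη
  have hreg := regular_tendsto (γ := γ) hRE hnoise hγ
  set R : ℕ → ℝ := fun T => K * (√(S.d T) * S.lam₁ T +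
    (2 * (ρ₂ * (S.d T * (B * S.h T) ^ 2)) + 2 * (ρ₂ * (S.d T * (B * S.h T ^ 2)) ^ 2))
      / S.lam₁ T) with hRdef
  have hlam := hR.2.2.2.2.1
  have hlim : Tendsto R atTop (𝓝 0) := by
    have h1 := hR.tendsto_sqrt_mul.1
    have h2 := hR.tendsto.1
    have hl0 : Tendsto (fun T => S.lam₁ T) atTop (𝓝 0) :=
      tendsto_of_tendsto_of_tendsto_of_le_of_le' tendsto_const_nhds h1
        (Eventually.of_forall fun T => (hlam T).1.le) hR.tendsto_sqrt_mul.2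
    -- The two bias terms over `λ₁` are constant multiples of `d h² / λ₁` and `(d h² / λ₁)² λ₁`.
    have h3 := (h1.add ((h2.const_mul (2 * ρ₂ * B ^ 2)).add
      (((h2.pow 2).mul hl0).const_mul (2 * ρ₂ * B ^ 2)))).const_mul K
    simp only [mul_zero, add_zero] at h3
    refine h3.congr fun T => ?_
    have := (hlam T).1.ne'
    rw [hRdef]
    field_simp
  rw [tendstoInMeasure_iff_norm]
  intro ε hε
  refine tendsto_of_tendsto_of_tendsto_of_le_of_le' tendsto_const_nhds hreg
    (Eventually.of_forall fun T => zero_le) ?_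
  filter_upwards [hlim.eventually_lt_const hε, eventually_gt_atTop 0] with T hRT hT
  refine measure_mono fun ω hω hgood => ?_
  have hh := hR.h_pos hT
  have hρ₂ : 0 ≤ ρ₂ := hρ₁.le.trans hρ₁₂
  have hle : S.maxErr sch γ T ω ≤ R T := by
    have hl := (hlam T).1
    refine coe_sup_nnnorm_le _ _ (by rw [hRdef]; positivity) fun t ht => ?_
    obtain ⟨g1, g2, g3⟩ := hgood t ht
    have htT := mem_Icc_of_mem_dates hh.le ht
    have hzero : m ≤ r ∨ (γ T t ω).2 = 0 := hmr.imp_right fun he => by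
      subst he
      exact slope_eq_zero_of_reflected hK hh
        (by rw [(hlam T).2]; exact mul_pos hr0 hl) g3
    refine (norm_fst_le_pairNorm T (S.err T (γ T t ω) (S.β T ((t : ℝ) / T), 0))).trans ?_
    exact hbound S sch T t ω _ _ ρ₂ _ r hK hT hh hl (hlam T).2 g1 (g3 _) g2
      (penalty_ge_of_slope_eq_zero hr0 (fun j hj => hsp T _ (div_mem_Icc htT.1 htT.2) j hj) rfl
        hm1 hzero)
      (biasSq_le_of_zero hK hsp hsm hB hδ hh hT hρ₂ htT g1)
  have h0 : 0 ≤ S.maxErr sch γ T ω := NNReal.coe_nonneg _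
  have hω' : ε ≤ ‖S.maxErr sch γ T ω - 0‖ := hω
  rw [sub_zero, Real.norm_eq_abs, abs_of_nonneg h0] at hω'
  linarith

/-- Uniform rates of convergence of the estimated levels and slopes for two-sided data. -/
theorem rate {δ₁ δ₂ r ψ δ : ℝ} (hδ₁ : 0 ≤ δ₁) (hδ₂ : 0 < δ₂) (hS : S.IsMeasurable)
    (hsp : S.Sparse) (hmix : S.Mixing μ) (hM : S.Moments μ) (hsm : S.SmoothWeights)
    (hD : S.MartingaleDiff μ) (hK : S.KernelCond)
    {N : ℕ} (hN : 24 * (3 + δ₁) ≤ N) (hψ : (N : ℝ) ≤ ψ) (hP : S.ProductMoments μ ψ)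
    (hδ : 0 < δ) (hRE : S.RestrictedEigenvalues μ .twoSided δ) (hR : S.Rates δ₁ δ₂ r)
    (hr : 1 < (1 + 2 * δ) * r) (hr' : r < 1 + 2 * δ)
    {γ : (T : ℕ) → ℤ → Ω → S.Coef T × S.Coef T} (hγ : S.IsEstimator μ .twoSided γ) :
    IsBigOp μ (S.maxErr .twoSided γ) (fun T => √(S.d T) * S.lam₁ T) ∧
      IsBigOp μ (S.maxSlopeErr .twoSided γ) (fun T => √(S.d T) * S.lam₁ T) := by
  obtain ⟨ρ₁, ρ₂, hρ₁, hρ₁₂, hRE⟩ := hRE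
  obtain ⟨hsm, B, hB⟩ := hsm
  have hB2 : ∀ T j, ∀ τ ∈ Set.Icc (0 : ℝ) 1,
      |iteratedDerivWithin 2 (fun x => S.β T x j) (Set.Icc 0 1) τ| ≤ B :=
    fun T j τ hτ => (hB T j τ hτ).2
  have hr0 : 0 < r := hR.2.2.2.1
  -- Nonzero target slopes can lose penalty on the support too, so both ratios of the penalties
  -- enter.
  have hMm : max 1 r < (1 + 2 * δ) * min 1 r := by
    rcases le_total 1 r with h | h
    · rw [max_eq_right h, min_eq_left h]; linarith
    · rw [max_eq_left h, min_eq_right h]; exact hr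
  obtain ⟨η, K, hη, hK0, hbound⟩ := exists_pairNorm_err_le.{u} (lt_min one_pos hr0)
    (zero_le_one.trans (le_max_left 1 r)) hδ hρ₁ hMm
  have hnoise := noise_tendsto hδ₁ hδ₂ hS hmix hM hD hK hN hψ hP hR .twoSided hη
  have hreg := regular_tendsto (γ := γ) hRE hnoise hγ
  have hlam := hR.2.2.2.2.1
  have hρ₂ : 0 < ρ₂ := hρ₁.trans_le hρ₁₂
  set C := K * (1 + ρ₂ * B ^ 2) with hC
  have hC0 : 0 < C := by positivity
  have hev : ∀ᶠ T in atTop, 0 < T ∧ ∀ ω,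
      (∀ t ∈ S.dates T .twoSided,
      (∀ v ∈ S.cone T δ, ρ₁ ≤ S.gram .twoSided T t ω v ∧ S.gram .twoSided T t ω v ≤ ρ₂) ∧
      (∀ i < 2, ∀ j, |S.noise .twoSided T t ω i j| ≤ η * S.lam₁ T) ∧
      ∀ b, S.objective .twoSided T t ω (γ T t ω) ≤ S.objective .twoSided T t ω b) →
      ∀ t ∈ S.dates T .twoSided, S.pairNorm T (S.err T (γ T t ω)
        (S.β T ((t : ℝ) / T), S.slope T ((t : ℝ) / T))) ≤ C * (√(S.d T) * S.lam₁ T) := by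
    filter_upwards [hR.tendsto.1.eventually_le_const one_pos, hR.tendsto_sqrt_mul.2,
      eventually_gt_atTop 0] with T h1 h2 hT
    refine ⟨hT, fun ω hgood t ht => ?_⟩
    have hh := hR.h_pos hT
    have hl := (hlam T).1
    obtain ⟨g1, g2, g3⟩ := hgood t ht
    have htT := mem_Icc_of_mem_dates hh.le ht
    have htm := div_mem_Icc htT.1 htT.2
    refine (hbound S .twoSided T t ω _ _ ρ₂ _ r hK hT hh hl (hlam T).2 g1 (g3 _) g2
      (penalty_ge hr0 (fun j hj => hsp T _ htm j hj) fun j hj => slope_eq_zero hsp htm hj)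
      (biasSq_le_of_slope hK hsp hsm hB2 hδ hh hT hρ₂.le htT g1)).trans ?_
    rw [hC, mul_assoc]
    refine mul_le_mul_of_nonneg_left ?_ hK0.le
    -- Since eventually `d h² / λ₁ ≤ 1` and `λ₁ ≤ √d λ₁`, the bias contributes at most the
    -- stochastic rate.
    have h3 : ρ₂ * (S.d T * (B * S.h T ^ 2)) ^ 2 / S.lam₁ T
        = ρ₂ * B ^ 2 * ((S.d T * S.h T ^ 2 * (S.lam₁ T)⁻¹) ^ 2 * S.lam₁ T) := by
      field_simp
    have h4 : (S.d T * S.h T ^ 2 * (S.lam₁ T)⁻¹) ^ 2 * S.lam₁ T ≤ √(S.d T) * S.lam₁ T := by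
      refine le_trans (mul_le_of_le_one_left hl.le (pow_le_one₀ (by positivity) h1)) h2
    have h5 : ρ₂ * B ^ 2 * ((S.d T * S.h T ^ 2 * (S.lam₁ T)⁻¹) ^ 2 * S.lam₁ T)
        ≤ ρ₂ * B ^ 2 * (√(S.d T) * S.lam₁ T) := mul_le_mul_of_nonneg_left h4 (by positivity)
    rw [h3]
    linarith
  constructor
  · intro ε hε
    refine ⟨C, hC0, ?_⟩
    filter_upwards [hev, hreg.eventually_le_const (ENNReal.ofReal_pos.2 hε)] with T ⟨_, hT⟩ hμ
    refine (measure_mono fun ω hω hgood => ?_).trans hμ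
    have hl := (hlam T).1
    have hle : S.maxErr .twoSided γ T ω ≤ C * (√(S.d T) * S.lam₁ T) :=
      coe_sup_nnnorm_le _ _ (by positivity) fun t ht =>
        (norm_fst_le_pairNorm T (S.err T (γ T t ω)
          (S.β T ((t : ℝ) / T), S.slope T ((t : ℝ) / T)))).trans (hT ω hgood t ht)
    have h0 : 0 ≤ S.maxErr .twoSided γ T ω := NNReal.coe_nonneg _
    have hω' : C * (√(S.d T) * S.lam₁ T) < |S.maxErr .twoSided γ T ω| := hω
    rw [abs_of_nonneg h0] at hω'
    linarith
  · intro ε hε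
    refine ⟨C, hC0, ?_⟩
    filter_upwards [hev, hreg.eventually_le_const (ENNReal.ofReal_pos.2 hε)] with T ⟨hT0, hT⟩ hμ
    refine (measure_mono fun ω hω hgood => ?_).trans hμ
    have hl := (hlam T).1
    have hh := hR.h_pos hT0
    have hle : S.maxSlopeErr .twoSided γ T ω ≤ C * (√(S.d T) * S.lam₁ T) := by
      rw [maxSlopeErr, mul_comm, ← le_div_iff₀ hh]
      refine coe_sup_nnnorm_le _ _ (by positivity) fun t ht => ?_
      rw [le_div_iff₀ hh, mul_comm]
      have h1 := (norm_snd_le_pairNorm T (S.err T (γ T t ω)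
          (S.β T ((t : ℝ) / T), S.slope T ((t : ℝ) / T)))).trans (hT ω hgood t ht)
      rwa [err, norm_smul, Real.norm_of_nonneg hh.le] at h1
    have h0 : 0 ≤ S.maxSlopeErr .twoSided γ T ω := mul_nonneg hh.le (NNReal.coe_nonneg _)
    have hω' : C * (√(S.d T) * S.lam₁ T) < |S.maxSlopeErr .twoSided γ T ω| := hω
    rw [abs_of_nonneg h0] at hω'
    linarith

end Setting

end TVComb

theorem mainTheorem6 (δ₁ δ₂ : ℝ) (hδ₁ : 0 ≤ δ₁) (hδ₂ : 0 < δ₂) (hδ₂' : δ₂ < 1) :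
    ∃ Ψ : ℝ, 2 + δ₁ / (1 - δ₂) ≤ Ψ ∧
      ∀ (Ω : Type u) [MeasurableSpace Ω] (μ : Measure Ω) [IsProbabilityMeasure μ]
        (S : TVComb.Setting Ω) (sch : TVComb.Scheme) (ψ δ r : ℝ)
        (γ : (T : ℕ) → ℤ → Ω → S.Coef T × S.Coef T),
        S.IsMeasurable → S.Sparse →
        S.Mixing μ → S.Moments μ → S.SmoothWeights → S.MartingaleDiff μ → S.KernelCond →
        S.RelevantMoments μ → Ψ < ψ → S.ProductMoments μ ψ →
        0 < δ → S.RestrictedEigenvalues μ sch δ →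
        S.Rates δ₁ δ₂ r →
        (sch = .twoSided → 1 < (1 + 2 * δ) * r) →
        S.IsEstimator μ sch γ →
        TendstoInMeasure μ (S.maxErr sch γ) atTop (fun _ => 0) ∧
        (sch = .twoSided → r < 1 + 2 * δ →
          TVComb.IsBigOp μ (S.maxErr sch γ) (fun T => √(S.d T) * S.lam₁ T) ∧
          TVComb.IsBigOp μ (S.maxSlopeErr sch γ) (fun T => √(S.d T) * S.lam₁ T)) := by
  -- The first entry is the prescribed lower bound for the threshold, the second the moment order
  -- used for truncation at `T ^ (1/24)`; an integer is taken because moments of natural order are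
  -- used.
  set N : ℕ := ⌈max (2 + δ₁ / (1 - δ₂)) (24 * (3 + δ₁))⌉₊ with hN
  have hNle : max (2 + δ₁ / (1 - δ₂)) (24 * (3 + δ₁)) ≤ N := Nat.le_ceil _
  refine ⟨N, (le_max_left _ _).trans hNle, ?_⟩
  intro Ω _ μ _ S sch ψ δ r γ hS hsp hmix hM hsm hD hK _ hψ hP hδ hRE hR hr hγ
  have hN24 := (le_max_right _ _).trans hNle
  refine ⟨TVComb.Setting.consistency hδ₁ hδ₂ hS hsp hmix hM hsm hD hK hN24 hψ.le hP hδ hRE hR hr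
    hγ, ?_⟩
  rintro rfl hr'
  exact TVComb.Setting.rate hδ₁ hδ₂ hS hsp hmix hM hsm hD hK hN24 hψ.le hP hδ hRE hR (hr rfl) hr' hγ
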